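/- **Setting.** $\mathbb R^{2N}=\{(p_1,\dots,p_N,q_1,\dots,q_N)\}$ carries the Euclidean norm, Lebesgue measure $\mu$ and the standard symplectic form $\sum_i dp_i\wedge dq_i$. Let $M$ be a closed (compact, boundaryless) smooth symplectic manifold of dimension $2N$ with symplectic form $\omega$ and a smooth Riemannian metric. Fix $K_{\mathcal A}>1$ such that the set $\mathcal A$ of all $C^1$ symplectic charts $\phi\colon V\to\mathbb R^{2N}$ ($V\subset M$ open) with $\|D\phi\|<K_{\mathcal A}$ and $\|D\phi^{-1}\|<K_{\mathcal A}$ everywhere covers $M$. Let $f$ be a $C^1$ diffeomorphism of $M$ preserving $\omega$, and let $1\le p\le N$, $\varepsilon>0$, $\kappa>0$. A point $x$ is *regular* if $T_xM=E^1\oplus\cdots\oplus E^k$ with non-zero $E^j$, and there are $\hat\lambda_1>\dots>\hat\lambda_k$ with $\lim_{n\to\pm\infty}\frac1n\log\|Df^n(x)v\|=\hat\lambda_j$ for all $0\ne v\in E^j$. Let $\lambda_1(f,x)\ge\dots\ge\lambda_{2N}(f,x)$ be the $\hat\lambda_j$ repeated $\dim E^j$ times. Let $\Sigma_p(f)$ be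 the set of non-periodic regular points $z$ with $\lambda_p(f,z)>\lambda_{p+1}(f,z)$. On it let $E^u,E^c,E^s$ be the sums of the spaces $E^j$ with exponents in $\{\lambda_1,\dots,\lambda_p\}$, $\{\lambda_{p+1},\dots,\lambda_{2N-p}\}$, $\{\lambda_{2N-p+1},\dots,\lambda_{2N}\}$ respectively, and let $E^{cs}=E^c\oplus E^s$. A *segment of length $n$* is $\{f^iz:0\le i<n\}$ with $z\in\Sigma_p(f)$. **Type IV.** A segment $\{z,\dots,f^{n-1}z\}$ is of type IV with constants $K_{\mathrm{IV}},\tau$ if $N\ge2$ and there are symplectic linear maps $L_i\colon T_{f^iz}M\to\mathbb R^{2N}$, $0\le i\le n-1$, such that $\|L_i^{\pm1}\|\le K_{\mathrm{IV}}$; the vectors $L_i^{-1}\frac{\partial}{\partial p_1}$, $L_i^{-1}\frac{\partial}{\partial p_2}$, $L_i^{-1}\frac{\partial}{\partial q_1}$, $L_i^{-1}\frac{\partial}{\partial q_2}$ belong to $E^u,E^c,E^s,E^c$ respectively; and, for $0\le i<n-1$, the map $A_i=L_{i+1}\circ Df(f^iz)\circ L_i^{-1}$ preserves the $p_1p_2q_1q_2$-space,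 where it is $(p_1,p_2,q_1,q_2)\mapsto(c_ip_1,c_ip_2,c_i^{-1}q_1,c_i^{-1}q_2)$ for some $c_i>\tau$. **Flexibility.** A *split sequence of length $n$ on $\mathbb R^{2N}$* consists of symplectic linear maps $A_0,\dots,A_{n-1}$ of $\mathbb R^{2N}$ and splittings $\mathbb R^{2N}=E^1_i\oplus E^2_i$ ($0\le i\le n$) into non-zero subspaces with $A_iE^*_i=E^*_{i+1}$. It is *$(\varepsilon,\kappa)$-flexible* if for every $\gamma>0$ there are a bounded open neighbourhood $U$ of $0$ and $C^1$ symplectic diffeomorphisms $g_0,\dots,g_{n-1}$ of $\mathbb R^{2N}$ such that: (1) $g_i=A_i$ outside $A_{i-1}\cdots A_0(U)$; (2) $\|D(A_i^{-1}\circ g_i)-\mathrm{Id}\|<\varepsilon$ everywhere; (3) there is a measurable set $G\subset U$ with $\mu(G)>(1-\kappa)\mu(U)$ such that $\angle\big(D(g_{n-1}\circ\cdots\circ g_0)(x)E^1_0,\,E^2_n\big)<\gamma$ for all $x\in G$, where the angle of two non-zero subspaces is the least angle between non-zero vectors of them. A segment $\{z,\dots,f^{n-1}z\}$ is *flexible*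 if for some charts $\phi_i\in\mathcal A$ around $f^iz$ ($0\le i\le n$) the maps $A_i=D(\phi_{i+1}\circ f\circ\phi_i^{-1})(\phi_i(f^iz))$, $0\le i<n$, and the splittings $D\phi_i(f^iz)E^u\oplus D\phi_i(f^iz)E^{cs}$, $0\le i\le n$, form an $(\varepsilon,\kappa)$-flexible split sequence. **Lemma.** Given $K_{\mathrm{IV}}>1$ and $\tau>1$, there exists $m_1$ such that every segment of length $m\ge m_1$ of type IV with constants $K_{\mathrm{IV}},\tau$ is flexible. -/

import Mathlib

open Bundle
open scoped Manifold ContDiff Bundle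
open MeasureTheory Filter Topology

noncomputable section

namespace SympFlex

/-! ### The standard symplectic space -/

/-- `ℝ^{2N}` with its Euclidean norm and Lebesgue measure; the coordinate `p_i` is the one of index
`Sum.inl i` and `q_i` is the one of index `Sum.inr i`. -/
abbrev Phase (N : ℕ) : Type := EuclideanSpace ℝ (Fin N ⊕ Fin N)

/-- The standard symplectic form `∑ dp_i ∧ dq_i`. -/
def stdForm {N : ℕ} (v w : Phase N) : ℝ :=
  ∑ i : Fin N, (v (Sum.inl i) * w (Sum.inr i) - v (Sum.inr i) * w (Sum.inl i))

/-- The coordinate vector `∂/∂p_i`. -/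
def pVec {N : ℕ} (i : Fin N) : Phase N := EuclideanSpace.single (Sum.inl i) 1

/-- The coordinate vector `∂/∂q_i`. -/
def qVec {N : ℕ} (i : Fin N) : Phase N := EuclideanSpace.single (Sum.inr i) 1

/-- The composition `g (i-1) ∘ ⋯ ∘ g 0`. -/
def compSeq {α : Type*} (g : ℕ → α → α) : ℕ → α → α
  | 0 => id
  | i + 1 => g i ∘ compSeq g i

/-- The angle between two non-zero subspaces: the least angle between non-zero vectors of them. -/
def subspaceAngle {N : ℕ} (E F : Submodule ℝ (Phase N)) : ℝ :=
  sInf {θ : ℝ | ∃ v ∈ E, v ≠ 0 ∧ ∃ w ∈ F, w ≠ 0 ∧ θ = InnerProductGeometry.angle v w}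

/-- The maps `A i` (`i < n`) and the splittings `E₁ i ⊕ E₂ i` (`i ≤ n`) form a split sequence of
length `n` on `ℝ^{2N}`. Values of `A`, `E₁`, `E₂` at other indices are irrelevant. -/
structure IsSplitSequence {N : ℕ} (n : ℕ) (A : ℕ → Phase N →L[ℝ] Phase N)
    (E₁ E₂ : ℕ → Submodule ℝ (Phase N)) : Prop where
  symplectic : ∀ i < n, ∀ v w, stdForm (A i v) (A i w) = stdForm v w
  isCompl : ∀ i ≤ n, IsCompl (E₁ i) (E₂ i)
  ne_bot₁ : ∀ i ≤ n, E₁ i ≠ ⊥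
  ne_bot₂ : ∀ i ≤ n, E₂ i ≠ ⊥
  map₁ : ∀ i < n, (E₁ i).map (A i).toLinearMap = E₁ (i + 1)
  map₂ : ∀ i < n, (E₂ i).map (A i).toLinearMap = E₂ (i + 1)

/-- `C¹` diffeomorphisms of `ℝ^{2N}` that preserve the standard symplectic form. -/
def IsSymplectomorphism {N : ℕ} (g : Phase N ≃ₘ^1⟮𝓘(ℝ, Phase N), 𝓘(ℝ, Phase N)⟯ Phase N) : Prop :=
  ∀ x v w, stdForm (fderiv ℝ g x v) (fderiv ℝ g x w) = stdForm v w

/-- `(ε, κ)`-flexibility of a split sequence of length `n` on `ℝ^{2N}`. -/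
def IsFlexible {N : ℕ} (ε κ : ℝ) (n : ℕ) (A : ℕ → Phase N →L[ℝ] Phase N)
    (E₁ E₂ : ℕ → Submodule ℝ (Phase N)) : Prop :=
  IsSplitSequence n A E₁ E₂ ∧
  ∀ γ : ℝ, 0 < γ →
    ∃ (U : Set (Phase N)) (g : ℕ → (Phase N ≃ₘ^1⟮𝓘(ℝ, Phase N), 𝓘(ℝ, Phase N)⟯ Phase N)),
      IsOpen U ∧ Bornology.IsBounded U ∧ (0 : Phase N) ∈ U ∧
      (∀ i < n, IsSymplectomorphism (g i)) ∧
      (∀ i < n, ∀ x, x ∉ compSeq (fun j => ⇑(A j)) i '' U → g i x = A i x) ∧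
      (∀ i < n, ∀ x,
        ‖fderiv ℝ (fun y => (A i).inverse (g i y)) x - ContinuousLinearMap.id ℝ (Phase N)‖ < ε) ∧
      ∃ G ⊆ U, MeasurableSet G ∧ (1 - κ) * volume.real U < volume.real G ∧
        ∀ x ∈ G, subspaceAngle
          ((E₁ 0).map (fderiv ℝ (compSeq (fun j => ⇑(g j)) n) x).toLinearMap) (E₂ n) < γ

/-! ### Symplectic manifolds and their diffeomorphisms -/

section Manifold

variable {N : ℕ} {M : Type*} [TopologicalSpace M] [ChartedSpace (Phase N) M]

/-- The expression in a chart `φ` of a field of alternating 2-forms on the tangent spaces. -/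
def localForm (Ω : ∀ x : M, TangentSpace 𝓘(ℝ, Phase N) x [⋀^Fin 2]→L[ℝ] ℝ)
    (φ : OpenPartialHomeomorph M (Phase N)) (y : Phase N) : Phase N [⋀^Fin 2]→L[ℝ] ℝ :=
  (Ω (φ.symm y)).compContinuousLinearMap
    (mfderiv 𝓘(ℝ, Phase N) 𝓘(ℝ, Phase N) φ.symm y :
      Phase N →L[ℝ] TangentSpace 𝓘(ℝ, Phase N) (φ.symm y))

variable (N M) in
/-- A symplectic form: a smooth, closed, non-degenerate differential 2-form on `M`. -/
structure SymplecticForm where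
  form : ∀ x : M, TangentSpace 𝓘(ℝ, Phase N) x [⋀^Fin 2]→L[ℝ] ℝ
  smooth : ∀ φ ∈ atlas (Phase N) M, ContDiffOn ℝ ∞ (localForm form φ) φ.target
  closed : ∀ φ ∈ atlas (Phase N) M, ∀ y ∈ φ.target, extDeriv (localForm form φ) y = 0
  nondegenerate : ∀ (x : M) (v : TangentSpace 𝓘(ℝ, Phase N) x),
    (∀ w, form x ![v, w] = 0) → v = 0

/-- `C¹` diffeomorphisms of `M`. -/
abbrev Diff1 (N : ℕ) (M : Type*) [TopologicalSpace M] [ChartedSpace (Phase N) M] : Type _ :=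
  M ≃ₘ^1⟮𝓘(ℝ, Phase N), 𝓘(ℝ, Phase N)⟯ M

/-- The derivative of `f` at `x`. -/
abbrev tangentMapAt (f : M → M) (x : M) :
    TangentSpace 𝓘(ℝ, Phase N) x →L[ℝ] TangentSpace 𝓘(ℝ, Phase N) (f x) :=
  mfderiv 𝓘(ℝ, Phase N) 𝓘(ℝ, Phase N) f x

/-- `f` preserves the symplectic form `Ω`. -/
def PreservesForm (Ω : SymplecticForm N M) (f : Diff1 N M) : Prop :=
  ∀ (x : M) (v w : TangentSpace 𝓘(ℝ, Phase N) x),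
    Ω.form (f x) ![tangentMapAt f x v, tangentMapAt f x w] = Ω.form x ![v, w]

/-- The point `f^i z`. -/
def orb (f : M → M) (z : M) : ℕ → M
  | 0 => z
  | i + 1 => f (orb f z i)

variable [RiemannianBundle (fun x : M => TangentSpace 𝓘(ℝ, Phase N) x)]

/-- The set of `C¹` symplectic charts `φ` of `M` (defined on open subsets) such that `‖Dφ‖ < K` and
`‖Dφ⁻¹‖ < K` everywhere. -/
def symplecticCharts (Ω : SymplecticForm N M) (K : ℝ) : Set (OpenPartialHomeomorph M (Phase N)) :=
  {φ | ContMDiffOn 𝓘(ℝ, Phase N) 𝓘(ℝ, Phase N) 1 φ φ.source ∧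
    ContMDiffOn 𝓘(ℝ, Phase N) 𝓘(ℝ, Phase N) 1 φ.symm φ.target ∧
    (∀ x ∈ φ.source, ∀ v w : TangentSpace 𝓘(ℝ, Phase N) x,
      stdForm (mfderiv 𝓘(ℝ, Phase N) 𝓘(ℝ, Phase N) φ x v : Phase N)
        (mfderiv 𝓘(ℝ, Phase N) 𝓘(ℝ, Phase N) φ x w : Phase N) = Ω.form x ![v, w]) ∧
    (∀ x ∈ φ.source, ‖(mfderiv 𝓘(ℝ, Phase N) 𝓘(ℝ, Phase N) φ x :
      TangentSpace 𝓘(ℝ, Phase N) x →L[ℝ] Phase N)‖ < K) ∧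
    (∀ y ∈ φ.target, ‖(mfderiv 𝓘(ℝ, Phase N) 𝓘(ℝ, Phase N) φ.symm y :
      Phase N →L[ℝ] TangentSpace 𝓘(ℝ, Phase N) (φ.symm y))‖ < K)}

/-! ### Oseledets splittings -/

/-- An Oseledets splitting `E^1 ⊕ ⋯ ⊕ E^k` of `T_x M`, with Lyapunov exponents in decreasing
order. -/
structure OseledetsSplitting (f : Diff1 N M) (x : M) where
  k : ℕ
  exponent : Fin k → ℝ
  space : Fin k → Submodule ℝ (TangentSpace 𝓘(ℝ, Phase N) x)
  exponent_strictAnti : StrictAnti exponent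
  space_ne_bot : ∀ j, space j ≠ ⊥
  isInternal : DirectSum.IsInternal space
  tendsto : ∀ j, ∀ v ∈ space j, v ≠ 0 →
    Tendsto (fun n : ℤ =>
      1 / (n : ℝ) * Real.log ‖tangentMapAt (⇑((f.toEquiv : Equiv.Perm M) ^ n)) x v‖)
      (atTop ⊔ atBot) (𝓝 (exponent j))

/-- `x` is an Oseledets regular point of `f`. -/
def IsRegularPoint (f : Diff1 N M) (x : M) : Prop := Nonempty (OseledetsSplitting f x)

/-- The Lyapunov exponents in non-increasing order, each repeated according to its
multiplicity. -/
def OseledetsSplitting.exponentList {f : Diff1 N M} {x : M} (D : OseledetsSplitting f x) : List ℝ :=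
  (List.finRange D.k).flatMap fun j => List.replicate (Module.finrank ℝ (D.space j)) (D.exponent j)

/-- `λ_i`, for `1 ≤ i ≤ 2N`. -/
def OseledetsSplitting.lam {f : Diff1 N M} {x : M} (D : OseledetsSplitting f x) (i : ℕ) : ℝ :=
  D.exponentList.getD (i - 1) 0

open Classical in
/-- `λ_i(f, x)` for `1 ≤ i ≤ 2N` and `x` a regular point. (An Oseledets splitting at a point is
unique, so that the choice made here is no choice.) -/
def lyapunovExponent (f : Diff1 N M) (x : M) (i : ℕ) : ℝ :=
  if h : IsRegularPoint f x then h.some.lam i else 0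

open Classical in
/-- At a regular point, the sum of the Oseledets spaces whose exponents belong to
`{λ_a, …, λ_b}`. -/
def oseledetsSum (f : Diff1 N M) (a b : ℕ) (x : M) :
    Submodule ℝ (TangentSpace 𝓘(ℝ, Phase N) x) :=
  if h : IsRegularPoint f x then
    ⨆ (j : Fin h.some.k) (_ : ∃ i, a ≤ i ∧ i ≤ b ∧ h.some.exponent j = h.some.lam i),
      h.some.space j
  else ⊥

/-- `E^u`: exponents `λ_1, …, λ_p`. -/
def Eu (f : Diff1 N M) (p : ℕ) (x : M) : Submodule ℝ (TangentSpace 𝓘(ℝ, Phase N) x) :=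
  oseledetsSum f 1 p x

/-- `E^c`: exponents `λ_{p+1}, …, λ_{2N-p}`. -/
def Ec (f : Diff1 N M) (p : ℕ) (x : M) : Submodule ℝ (TangentSpace 𝓘(ℝ, Phase N) x) :=
  oseledetsSum f (p + 1) (2 * N - p) x

/-- `E^s`: exponents `λ_{2N-p+1}, …, λ_{2N}`. -/
def Es (f : Diff1 N M) (p : ℕ) (x : M) : Submodule ℝ (TangentSpace 𝓘(ℝ, Phase N) x) :=
  oseledetsSum f (2 * N - p + 1) (2 * N) x

/-- `E^{cs} = E^c ⊕ E^s`. -/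
def Ecs (f : Diff1 N M) (p : ℕ) (x : M) : Submodule ℝ (TangentSpace 𝓘(ℝ, Phase N) x) :=
  Ec f p x ⊔ Es f p x

/-- The set `Σ_p(f)` of the non-periodic regular points with `λ_p > λ_{p+1}`. -/
def SigmaSet (f : Diff1 N M) (p : ℕ) : Set M :=
  {z | z ∉ Function.periodicPts f ∧ IsRegularPoint f z ∧
    lyapunovExponent f z (p + 1) < lyapunovExponent f z p}

/-! ### Segments -/

/-- The segment `{z, f z, …, f^{n-1} z}` is of type IV with constants `K` and `τ`.
Only the values of `L` at `i < n` matter; the map `A_i = L_{i+1} ∘ Df(f^i z) ∘ L_i⁻¹` makes sense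
for `i + 1 < n`. -/
def IsTypeIV (Ω : SymplecticForm N M) (f : Diff1 N M) (p : ℕ) (K τ : ℝ) (z : M) (n : ℕ) : Prop :=
  ∃ (hN : 2 ≤ N) (L : ∀ i : ℕ, TangentSpace 𝓘(ℝ, Phase N) (orb f z i) ≃L[ℝ] Phase N) (c : ℕ → ℝ),
    let p₁ : Phase N := pVec ⟨0, by omega⟩
    let p₂ : Phase N := pVec ⟨1, by omega⟩
    let q₁ : Phase N := qVec ⟨0, by omega⟩
    let q₂ : Phase N := qVec ⟨1, by omega⟩
    (∀ i < n,
      (∀ v w, stdForm (L i v) (L i w) = Ω.form (orb f z i) ![v, w]) ∧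
      ‖(L i : TangentSpace 𝓘(ℝ, Phase N) (orb f z i) →L[ℝ] Phase N)‖ ≤ K ∧
      ‖((L i).symm : Phase N →L[ℝ] TangentSpace 𝓘(ℝ, Phase N) (orb f z i))‖ ≤ K ∧
      (L i).symm p₁ ∈ Eu f p (orb f z i) ∧
      (L i).symm p₂ ∈ Ec f p (orb f z i) ∧
      (L i).symm q₁ ∈ Es f p (orb f z i) ∧
      (L i).symm q₂ ∈ Ec f p (orb f z i)) ∧
    (∀ i, i + 1 < n →
      let A : Phase N → Phase N :=
        fun v => L (i + 1) (tangentMapAt f (orb f z i) ((L i).symm v))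
      τ < c i ∧ A p₁ = c i • p₁ ∧ A p₂ = c i • p₂ ∧
        A q₁ = (c i)⁻¹ • q₁ ∧ A q₂ = (c i)⁻¹ • q₂)

/-- The segment `{z, f z, …, f^{n-1} z}` is flexible: for some choice of charts `φ i` around `f^i z`
in `symplecticCharts Ω KA`, the split sequence on `ℝ^{2N}` that these charts induce from
`Df(f^i z) : E^u ⊕ E^{cs} → E^u ⊕ E^{cs}` (`0 ≤ i < n`) is `(ε, κ)`-flexible. -/
def IsFlexibleSegment (Ω : SymplecticForm N M) (KA : ℝ) (f : Diff1 N M) (p : ℕ) (ε κ : ℝ)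
    (z : M) (n : ℕ) : Prop :=
  ∃ φ : ℕ → OpenPartialHomeomorph M (Phase N),
    (∀ i ≤ n, φ i ∈ symplecticCharts Ω KA ∧ orb f z i ∈ (φ i).source) ∧
    IsFlexible ε κ n
      (fun i => fderiv ℝ (φ (i + 1) ∘ f ∘ (φ i).symm) (φ i (orb f z i)))
      (fun i => (Eu f p (orb f z i)).map
        (mfderiv 𝓘(ℝ, Phase N) 𝓘(ℝ, Phase N) (φ i) (orb f z i) :
          TangentSpace 𝓘(ℝ, Phase N) (orb f z i) →L[ℝ] Phase N).toLinearMap)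
      (fun i => (Ecs f p (orb f z i)).map
        (mfderiv 𝓘(ℝ, Phase N) 𝓘(ℝ, Phase N) (φ i) (orb f z i) :
          TangentSpace 𝓘(ℝ, Phase N) (orb f z i) →L[ℝ] Phase N).toLinearMap)

end Manifold

end SympFlex

end

/-!
Let `A₀, …, A_{n-1}` be the derivative of `f` along the segment, read in the coordinates `L_i`. On
the `p₁p₂q₁q₂`-space each `A_i` multiplies the `p₁p₂`-plane by `c_i` and the `q₁q₂`-plane by
`c_i⁻¹`. The vector `∂/∂p₁` lies in `E^u` and `∂/∂p₂`, `∂/∂q₁`, `∂/∂q₂` lie in `E^{cs}`, so it is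
enough to perturb the `A_i` such that, at most points `x` of the unit ball, the image of `∂/∂p₁`
becomes almost a combination of the images of the other three. Since `A_i` acts conformally on the
`p₁p₂`-plane, a small rotation of `∂/∂p₁` towards `∂/∂p₂` is not undone by the dynamics, and the
rotations made at different times add up.

*The walk of directions* (`exists_walk_perturbation`). The perturbation at time `i` is generated by
the function `s ρ² sin (p₁/ρ + t) sin (q₂/ρ + t')`, with `s` small and `ρ` tiny, cut off near the
boundary of the image of the ball. It is symplectic, `C¹`-close to the identity by a bound which
does not involve `ρ`, moves points by `O(ρ)`, and takes `∂/∂p₁` to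
`∂/∂p₁ - s cos cos ∂/∂p₂` up to a multiple of `∂/∂q₁`. As `p₁` and `q₂` Poisson-commute, the
perturbation preserves both coordinates, so that the slopes met by an orbit are functions of the
initial values of `p₁`, `q₂`. After `r` steps the image of `∂/∂p₁` has the direction
`∂/∂p₁ + b(x) ∂/∂p₂ + …`, where `b(x)` is a sum of `r` terms `-s cos (α_i x) cos (β_i x)`.

*Anticoncentration* (`exists_phases_escape`). When the phases `t`, `t'` at the different times are
chosen independently in a finite set, each term has, for fixed `x`, a characteristic function
bounded away from one in modulus, uniformly in the angles. By the Fejér kernel, `|b(x)|` is larger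
than any prescribed bound with probability close to one, if `r` is large; by averaging over `x`, some
choice of the phases makes `|b|` large on most of the ball. The number `r` does not depend on the
`A_i`, and it determines the length `m₁`.

*The correction* (`exists_correction_step`, `exists_flexible_perturbation`). Where `|b|` is large,
a shear that adds `-1/b` times the `p₂`-component to the `p₁`-component is small and removes the
`p₁`-component altogether. It is generated by a wave in `p₂`, `q₁` with a sawtooth profile, whose
amplitude is a smooth approximation of `1/b`; as `b` oscillates with the wave length of the walk,
the sawtooth has to oscillate at a still smaller scale. All later maps are left unperturbed.

Conjugation by the coordinates, which have bounded distortion, gives the flexibility of a split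
sequence (`exists_isFlexible_of_isSqueeze`). It remains to see that a segment induces a split
sequence: the Oseledets splitting at a point is unique, because its spaces are determined by the
growth rates of vectors in both time directions; hence it is invariant under `Df`, and
`E^u ⊕ E^{cs}` is the whole tangent space at each point of the orbit (`isCompl_Eu_Ecs_orb`).
-/

noncomputable section

namespace SympFlex

/-! ### Symplectic maps from generating functions -/

/-- A map whose difference from the identity has derivative of norm at most `1/2` everywhere is a
diffeomorphism. -/
theorem exists_diffeomorph_id_add {E : Type*} [NormedAddCommGroup E] [NormedSpace ℝ E]
    [CompleteSpace E] {u : E → E} (hu : ContDiff ℝ 1 u) (hb : ∀ x, ‖fderiv ℝ u x‖ ≤ 1 / 2) :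
    ∃ e : E ≃ₘ^1⟮𝓘(ℝ, E), 𝓘(ℝ, E)⟯ E, ∀ x, e x = x + u x := by
  have hd : Differentiable ℝ u := hu.differentiable (by norm_num)
  have hlip : LipschitzWith (1 / 2) u :=
    lipschitzWith_of_nnnorm_fderiv_le hd (fun x => by
      rw [← NNReal.coe_le_coe]; simpa using hb x)
  set Φ : E → E := fun x => x + u x with hΦ
  have happ : ApproximatesLinearOn Φ ((ContinuousLinearEquiv.refl ℝ E : E ≃L[ℝ] E) : E →L[ℝ] E)
      Set.univ (1 / 2) := by
    intro x _ y _
    have := hlip.dist_le_mul x y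
    rw [dist_eq_norm, dist_eq_norm] at this
    have h2 : Φ x - Φ y - ((ContinuousLinearEquiv.refl ℝ E : E ≃L[ℝ] E) : E →L[ℝ] E) (x - y)
        = u x - u y := by
      simp only [hΦ, ContinuousLinearEquiv.coe_refl, ContinuousLinearMap.coe_id', id]
      abel
    rw [h2]; exact this
  have hc : Subsingleton E ∨ (1 / 2 : NNReal) <
      ‖((ContinuousLinearEquiv.refl ℝ E).symm : E →L[ℝ] E)‖₊⁻¹ := by
    rcases subsingleton_or_nontrivial E with h | h
    · exact Or.inl h
    · right
      have : ‖((ContinuousLinearEquiv.refl ℝ E).symm : E →L[ℝ] E)‖₊ = 1 := by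
        ext; simp
      rw [this, ← NNReal.coe_lt_coe]; norm_num
  let H : E ≃ₜ E := happ.toHomeomorph Φ hc
  have hH : (H : E → E) = Φ := rfl
  have hΦc : ContDiff ℝ 1 Φ := contDiff_id.add hu
  have hder : ∀ x, ∃ e : E ≃L[ℝ] E, HasFDerivAt Φ (e : E →L[ℝ] E) x := by
    intro x
    have h1 : HasFDerivAt Φ (ContinuousLinearMap.id ℝ E + fderiv ℝ u x) x :=
      (hasFDerivAt_id x).add (hd x).hasFDerivAt
    have hlt : ‖-fderiv ℝ u x‖ < 1 := by
      rw [norm_neg]; exact (hb x).trans_lt (by norm_num)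
    refine ⟨ContinuousLinearEquiv.ofUnit (Units.oneSub (-fderiv ℝ u x) hlt), ?_⟩
    convert h1 using 1
    ext v
    simp [ContinuousLinearEquiv.ofUnit, Units.oneSub]
  choose e he using hder
  have hsymm : ContDiff ℝ 1 H.symm := by
    refine Homeomorph.contDiff_symm (𝕜 := ℝ) H (f₀' := e) ?_ ?_
    · intro a; rw [hH]; exact he a
    · rw [hH]; exact hΦc
  exact ⟨{ toEquiv := H.toEquiv
           contMDiff_toFun := by
             rw [contMDiff_iff_contDiff]; exact hΦc
           contMDiff_invFun := by
             rw [contMDiff_iff_contDiff]; exact hsymm }, fun x => rfl⟩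

variable {N : ℕ}

/-- The projection of `ℝ^{2N}` to the space of the `p_i`. -/
def pProj (N : ℕ) : Phase N →L[ℝ] Phase N :=
  LinearMap.toContinuousLinearMap
    { toFun := fun v => WithLp.toLp 2 (Sum.elim (fun i => v (Sum.inl i)) (fun _ => 0))
      map_add' := fun v w => by
        ext k; cases k <;> simp
      map_smul' := fun c v => by
        ext k; cases k <;> simp }

/-- The projection of `ℝ^{2N}` to the space of the `q_i`. -/
def qProj (N : ℕ) : Phase N →L[ℝ] Phase N := ContinuousLinearMap.id ℝ (Phase N) - pProj N

/-- The linear map taking `dF` to the Hamiltonian vector `(-∂F/∂q, ∂F/∂p)`. -/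
def symplGrad (N : ℕ) : (Phase N →L[ℝ] ℝ) →L[ℝ] Phase N :=
  LinearMap.toContinuousLinearMap
    { toFun := fun ℓ => WithLp.toLp 2 (Sum.elim (fun i => -ℓ (qVec i)) (fun i => ℓ (pVec i)))
      map_add' := fun v w => by
        ext k; cases k <;> simp [add_comm]
      map_smul' := fun c v => by
        ext k; cases k <;> simp }

@[simp] theorem pProj_inl (v : Phase N) (i : Fin N) : pProj N v (Sum.inl i) = v (Sum.inl i) := rfl

@[simp] theorem pProj_inr (v : Phase N) (i : Fin N) : pProj N v (Sum.inr i) = 0 := rfl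

@[simp] theorem qProj_inl (v : Phase N) (i : Fin N) : qProj N v (Sum.inl i) = 0 := by
  simp [qProj]

@[simp] theorem qProj_inr (v : Phase N) (i : Fin N) : qProj N v (Sum.inr i) = v (Sum.inr i) := by
  simp [qProj]

@[simp] theorem symplGrad_inl (ℓ : Phase N →L[ℝ] ℝ) (i : Fin N) :
    symplGrad N ℓ (Sum.inl i) = -ℓ (qVec i) := rfl

@[simp] theorem symplGrad_inr (ℓ : Phase N →L[ℝ] ℝ) (i : Fin N) :
    symplGrad N ℓ (Sum.inr i) = ℓ (pVec i) := rfl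

theorem norm_pProj_apply_le (v : Phase N) : ‖pProj N v‖ ≤ ‖v‖ := by
  rw [EuclideanSpace.norm_eq, EuclideanSpace.norm_eq]
  refine Real.sqrt_le_sqrt (Finset.sum_le_sum fun k _ => ?_)
  cases k
  · simp
  · simpa using sq_nonneg _

theorem norm_qProj_apply_le (v : Phase N) : ‖qProj N v‖ ≤ ‖v‖ := by
  rw [EuclideanSpace.norm_eq, EuclideanSpace.norm_eq]
  refine Real.sqrt_le_sqrt (Finset.sum_le_sum fun k _ => ?_)
  cases k
  · simpa using sq_nonneg _
  · simp

theorem pProj_add_qProj (v : Phase N) : pProj N v + qProj N v = v := by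
  simp [qProj]

theorem stdForm_symplGrad (ℓ : Phase N →L[ℝ] ℝ) (v : Phase N) :
    stdForm (symplGrad N ℓ) v = -ℓ v := by
  have hv : v = ∑ i : Fin N, (v (Sum.inl i) • pVec i + v (Sum.inr i) • qVec i) := by
    have := (EuclideanSpace.basisFun (Fin N ⊕ Fin N) ℝ).sum_repr v
    rw [Fintype.sum_sum_type] at this
    rw [Finset.sum_add_distrib]
    conv_lhs => rw [← this]
    simp [pVec, qVec]
  conv_rhs => rw [hv]
  rw [map_sum, stdForm, ← Finset.sum_neg_distrib]
  refine Finset.sum_congr rfl fun i _ => ?_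
  simp
  ring

theorem stdForm_swap (v w : Phase N) : stdForm v w = -stdForm w v := by
  simp only [stdForm, ← Finset.sum_neg_distrib]
  exact Finset.sum_congr rfl fun i _ => by ring

/-- The algebra behind generating functions: `p = P + ∂F/∂q`, `Q = q + ∂F/∂p` define a symplectic
relation because the second derivative of `F` is symmetric. -/
theorem stdForm_generating {B : Phase N →L[ℝ] Phase N}
    (hB : ∀ u v, stdForm (B u) v = stdForm (B v) u) (u v : Phase N) :
    stdForm (u + qProj N (B u)) (v + qProj N (B v)) =
      stdForm (u - pProj N (B u)) (v - pProj N (B v)) := by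
  have h : stdForm (B u) v + stdForm u (B v) = 0 := by
    rw [hB u v, stdForm_swap u]; ring
  rw [← sub_eq_zero, ← h]
  simp only [stdForm, ← Finset.sum_sub_distrib, ← Finset.sum_add_distrib]
  refine Finset.sum_congr rfl fun i _ => ?_
  simp
  ring

/-- The Hamiltonian vector field `(-∂F/∂q, ∂F/∂p)` of `F`. -/
def hamField (F : Phase N → ℝ) (y : Phase N) : Phase N := symplGrad N (fderiv ℝ F y)

theorem contDiff_hamField {F : Phase N → ℝ} (hF : ContDiff ℝ 2 F) : ContDiff ℝ 1 (hamField F) :=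
  (symplGrad N).contDiff.comp (hF.fderiv_right (by norm_num))

theorem fderiv_hamField {F : Phase N → ℝ} (hF : ContDiff ℝ 2 F) (y v : Phase N) :
    fderiv ℝ (hamField F) y v = symplGrad N (fderiv ℝ (fderiv ℝ F) y v) := by
  have h1 : DifferentiableAt ℝ (fderiv ℝ F) y :=
    ((hF.fderiv_right (m := 1) (by norm_num)).differentiable (by norm_num)) y
  have : HasFDerivAt (hamField F) ((symplGrad N).comp (fderiv ℝ (fderiv ℝ F) y)) y :=
    (symplGrad N).hasFDerivAt.comp y h1.hasFDerivAt
  rw [this.fderiv]; rfl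

theorem stdForm_fderiv_hamField {F : Phase N → ℝ} (hF : ContDiff ℝ 2 F) (y u v : Phase N) :
    stdForm (fderiv ℝ (hamField F) y u) v = stdForm (fderiv ℝ (hamField F) y v) u := by
  have h1 : DifferentiableAt ℝ (fderiv ℝ F) y :=
    ((hF.fderiv_right (m := 1) (by norm_num)).differentiable (by norm_num)) y
  rw [fderiv_hamField hF, fderiv_hamField hF, stdForm_symplGrad, stdForm_symplGrad]
  rw [second_derivative_symmetric (f := F) (f' := fderiv ℝ F)
    (fun z => ((hF.differentiable (by norm_num)) z).hasFDerivAt) h1.hasFDerivAt u v]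

/-- A function with small second derivative generates a symplectic diffeomorphism: with `X` the
Hamiltonian field of `F`, it takes `x` to `x + X y`, where `y = (P, q)` mixes the new momenta with
the old positions. -/
theorem exists_symplectomorphism_of_generating {F : Phase N → ℝ} (hF : ContDiff ℝ 2 F)
    (hb : ∀ y, ‖fderiv ℝ (hamField F) y‖ ≤ 1 / 2) :
    ∃ (h : Phase N ≃ₘ^1⟮𝓘(ℝ, Phase N), 𝓘(ℝ, Phase N)⟯ Phase N) (η : Phase N → Phase N),
      IsSymplectomorphism h ∧ ∀ x,
        η x = x + pProj N (hamField F (η x)) ∧ h x = x + hamField F (η x) ∧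
        (hamField F x = 0 → h x = x) ∧
        ∀ v, ∃ w, w = v + pProj N (fderiv ℝ (hamField F) (η x) w) ∧
          fderiv ℝ h x v = v + fderiv ℝ (hamField F) (η x) w := by
  set X := hamField F with hX
  have hXc : ContDiff ℝ 1 X := contDiff_hamField hF
  have hXd : ∀ y, HasFDerivAt X (fderiv ℝ X y) y :=
    fun y => ((hXc.differentiable (by norm_num)) y).hasFDerivAt
  have hPd : ∀ y, HasFDerivAt (fun y => -pProj N (X y)) (-(pProj N).comp (fderiv ℝ X y)) y :=
    fun y => ((pProj N).hasFDerivAt.comp y (hXd y)).neg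
  have hQd : ∀ y, HasFDerivAt (fun y => qProj N (X y)) ((qProj N).comp (fderiv ℝ X y)) y :=
    fun y => (qProj N).hasFDerivAt.comp y (hXd y)
  obtain ⟨Φ, hΦ⟩ := exists_diffeomorph_id_add (u := fun y => -pProj N (X y))
    (((pProj N).contDiff.comp hXc).neg) (fun y => by
      rw [(hPd y).fderiv, norm_neg]
      refine ContinuousLinearMap.opNorm_le_bound _ (by norm_num) fun v => ?_
      exact (norm_pProj_apply_le _).trans (ContinuousLinearMap.le_of_opNorm_le _ (hb y) v))
  obtain ⟨Ψ, hΨ⟩ := exists_diffeomorph_id_add (u := fun y => qProj N (X y))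
    ((qProj N).contDiff.comp hXc) (fun y => by
      rw [(hQd y).fderiv]
      refine ContinuousLinearMap.opNorm_le_bound _ (by norm_num) fun v => ?_
      exact (norm_qProj_apply_le _).trans (ContinuousLinearMap.le_of_opNorm_le _ (hb y) v))
  have hΦd : ∀ y, HasFDerivAt Φ
      (ContinuousLinearMap.id ℝ _ + -(pProj N).comp (fderiv ℝ X y)) y := fun y => by
    have : (Φ : Phase N → Phase N) = fun y => y + -pProj N (X y) := funext hΦ
    rw [this]; exact (hasFDerivAt_id y).add (hPd y)
  have hΨd : ∀ y, HasFDerivAt Ψ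
      (ContinuousLinearMap.id ℝ _ + (qProj N).comp (fderiv ℝ X y)) y := fun y => by
    have : (Ψ : Phase N → Phase N) = fun y => y + qProj N (X y) := funext hΨ
    rw [this]; exact (hasFDerivAt_id y).add (hQd y)
  have hη : ∀ x, Φ.symm x = x + pProj N (X (Φ.symm x)) := fun x => by
    have h1 : Φ (Φ.symm x) = x := Φ.apply_symm_apply x
    rw [hΦ] at h1
    nth_rw 2 [← h1]; abel
  have hfd : ∀ x, HasFDerivAt (Φ.symm.trans Ψ)
      ((ContinuousLinearMap.id ℝ _ + (qProj N).comp (fderiv ℝ X (Φ.symm x))).comp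
        (fderiv ℝ Φ.symm x)) x := fun x => by
    have h1 : HasFDerivAt Φ.symm (fderiv ℝ Φ.symm x) x :=
      ((Φ.symm.contMDiff.contDiff.differentiable (by norm_num)) x).hasFDerivAt
    exact (hΨd (Φ.symm x)).comp x h1
  have hw : ∀ x v, v = fderiv ℝ Φ.symm x v
      - pProj N (fderiv ℝ X (Φ.symm x) (fderiv ℝ Φ.symm x v)) := fun x v => by
    have h1 : HasFDerivAt Φ.symm (fderiv ℝ Φ.symm x) x :=
      ((Φ.symm.contMDiff.contDiff.differentiable (by norm_num)) x).hasFDerivAt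
    have h2 := (hΦd (Φ.symm x)).comp x h1
    have h3 : (Φ : Phase N → Phase N) ∘ Φ.symm = id := funext fun x => Φ.apply_symm_apply x
    rw [h3] at h2
    have h4 := congrArg (fun L : Phase N →L[ℝ] Phase N => L v) ((hasFDerivAt_id x).unique h2)
    simpa [sub_eq_add_neg] using h4
  have hh : ∀ x, (Φ.symm.trans Ψ) x = x + X (Φ.symm x) := fun x => by
    change Ψ (Φ.symm x) = _
    rw [hΨ]
    nth_rw 1 [hη x]
    rw [add_assoc, pProj_add_qProj]
  refine ⟨Φ.symm.trans Ψ, Φ.symm, ?_, fun x => ⟨hη x, hh x, ?_, fun v => ?_⟩⟩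
  · intro x v w
    rw [(hfd x).fderiv]
    have := stdForm_generating (stdForm_fderiv_hamField hF (Φ.symm x))
      (fderiv ℝ Φ.symm x v) (fderiv ℝ Φ.symm x w)
    rw [← hX, ← hw, ← hw] at this
    rw [← this]; rfl
  · intro h0
    have h1 : Φ x = x := by rw [hΦ, h0]; simp
    have h2 : Φ.symm x = x := by
      nth_rw 1 [← h1]; exact Φ.symm_apply_apply x
    rw [hh, h2, h0, add_zero]
  · refine ⟨fderiv ℝ Φ.symm x v, ?_, ?_⟩
    · nth_rw 2 [hw x v]; abel
    · rw [(hfd x).fderiv]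
      nth_rw 2 [hw x v]
      simp only [ContinuousLinearMap.comp_apply, add_apply, ContinuousLinearMap.id_apply, qProj,
        sub_apply]
      abel

/-! ### Choosing phases by averaging -/

/-- If every point lies in at most `D` of the sets `S t`, then one of them has measure at most the
fraction `D / #T` of the whole. -/
theorem exists_measureReal_le_of_card_le {X T : Type*} [MeasurableSpace X] (μ : Measure X)
    [IsFiniteMeasure μ] [Fintype T] [Nonempty T] {S : T → Set X} (hS : ∀ t, MeasurableSet (S t))
    {D : ℝ} (hD : ∀ x, (Nat.card {t // x ∈ S t} : ℝ) ≤ D) :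
    ∃ t, μ.real (S t) ≤ D / Fintype.card T * μ.real Set.univ := by
  classical
  have hint : ∀ t, Integrable ((S t).indicator (fun _ => (1 : ℝ))) μ := fun t =>
    (integrable_const 1).indicator (hS t)
  have hsum : ∑ t, μ.real (S t) ≤ D * μ.real Set.univ := by
    calc ∑ t, μ.real (S t) = ∑ t, ∫ x, (S t).indicator (fun _ => (1 : ℝ)) x ∂μ := by
          refine Finset.sum_congr rfl fun t _ => ?_
          rw [integral_indicator_const _ (hS t)]; simp
      _ = ∫ x, ∑ t, (S t).indicator (fun _ => (1 : ℝ)) x ∂μ := by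
          rw [integral_finsetSum _ fun t _ => hint t]
      _ ≤ ∫ _, D ∂μ := by
          refine integral_mono (integrable_finsetSum _ fun t _ => hint t) (integrable_const D)
            fun x => ?_
          refine le_trans (le_of_eq ?_) (hD x)
          simp [Set.indicator_apply, Nat.card_eq_fintype_card, Fintype.card_subtype]
      _ = D * μ.real Set.univ := by simp [mul_comm]
  have hcard : (0 : ℝ) < Fintype.card T := by exact_mod_cast Fintype.card_pos
  obtain ⟨t, -, ht⟩ := Finset.exists_le_of_sum_le (s := (Finset.univ : Finset T))
    (f := fun t => μ.real (S t)) (g := fun _ => D / Fintype.card T * μ.real Set.univ)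
    Finset.univ_nonempty (by
      refine hsum.trans (le_of_eq ?_)
      simp only [Finset.sum_const, Finset.card_univ, nsmul_eq_mul]
      field_simp)
  exact ⟨t, ht⟩

/-- The characteristic function of a sum of independent random variables is the product of the
characteristic functions; here for variables `ξ i` uniform in a finite set of outcomes. -/
theorem norm_sum_exp_le {ι Θ : Type*} [Fintype ι] [DecidableEq ι] [Fintype Θ] (ξ : ι → Θ → ℝ)
    (v C : ℝ) (h : ∀ i, ‖∑ θ, Complex.exp ((v * ξ i θ : ℝ) * Complex.I)‖ ≤ C) :
    ‖∑ t : ι → Θ, Complex.exp ((v * ∑ i, ξ i (t i) : ℝ) * Complex.I)‖ ≤ C ^ Fintype.card ι := by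
  have h1 : ∑ t : ι → Θ, Complex.exp ((v * ∑ i, ξ i (t i) : ℝ) * Complex.I)
      = ∏ i, ∑ θ, Complex.exp ((v * ξ i θ : ℝ) * Complex.I) := by
    rw [Finset.prod_univ_sum, Fintype.piFinset_univ]
    refine Finset.sum_congr rfl fun t _ => ?_
    rw [← Complex.exp_sum]
    congr 1
    push_cast
    rw [Finset.mul_sum, Finset.sum_mul]
  rw [h1, norm_prod]
  calc _ ≤ ∏ _i : ι, C := Finset.prod_le_prod (fun i _ => norm_nonneg _) fun i _ => h i
    _ = _ := by simp

/-- Anticoncentration from a bound `q` on the characteristic functions of the summands at the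
frequencies between `u` and `M * u`: the sum lies in `[-B, B]` with probability at most
`4 * (1 / M + q ^ r)`. The Fejér kernel `|∑_{k<M} exp (iku·)|²` majorizes the interval. -/
theorem card_abs_sum_le {ι Θ : Type*} [Fintype ι] [DecidableEq ι] [Fintype Θ] [Nonempty Θ]
    (ξ : ι → Θ → ℝ) {B u q : ℝ} {M : ℕ} (hM : 0 < M) (hu : 0 < u) (hB : M * u * B ≤ 1)
    (hq : 0 ≤ q)
    (h : ∀ i v, u ≤ |v| → |v| ≤ M * u →
      ‖∑ θ, Complex.exp ((v * ξ i θ : ℝ) * Complex.I)‖ ≤ q * Fintype.card Θ) :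
    (Nat.card {t : ι → Θ // |∑ i, ξ i (t i)| ≤ B} : ℝ) ≤
      4 * (1 / M + q ^ Fintype.card ι) * Fintype.card (ι → Θ) := by
  classical
  set S : (ι → Θ) → ℝ := fun t => ∑ i, ξ i (t i) with hS
  set V : (ι → Θ) → ℝ := fun t =>
    ∑ k ∈ Finset.range M, ∑ l ∈ Finset.range M, Real.cos (((k : ℝ) - l) * u * S t) with hV
  have hM' : (0 : ℝ) < M := by exact_mod_cast hM
  have hVeq : ∀ t, V t = (∑ k ∈ Finset.range M, Real.cos (k * u * S t)) ^ 2
      + (∑ k ∈ Finset.range M, Real.sin (k * u * S t)) ^ 2 := by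
    intro t
    rw [sq, sq, Finset.sum_mul_sum, Finset.sum_mul_sum, ← Finset.sum_add_distrib, hV]
    refine Finset.sum_congr rfl fun k _ => ?_
    rw [← Finset.sum_add_distrib]
    refine Finset.sum_congr rfl fun l _ => ?_
    rw [← Real.cos_sub]; congr 1; ring
  have hV0 : ∀ t, 0 ≤ V t := fun t => by rw [hVeq]; positivity
  have hVB : ∀ t, |S t| ≤ B → (M : ℝ) ^ 2 / 4 ≤ V t := by
    intro t ht
    have h1 : (M : ℝ) / 2 ≤ ∑ k ∈ Finset.range M, Real.cos (k * u * S t) := by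
      calc (M : ℝ) / 2 = ∑ _k ∈ Finset.range M, (1 / 2 : ℝ) := by simp; ring
        _ ≤ _ := Finset.sum_le_sum fun k hk => by
          have hk' : (k : ℝ) ≤ M := by exact_mod_cast (Finset.mem_range.1 hk).le
          have h2 : |(k : ℝ) * u * S t| ≤ 1 := by
            rw [abs_mul, abs_of_nonneg (by positivity)]
            calc (k : ℝ) * u * |S t| ≤ M * u * B := by gcongr
              _ ≤ 1 := hB
          have h3 := Real.one_sub_sq_div_two_le_cos (x := k * u * S t)
          have h4 : ((k : ℝ) * u * S t) ^ 2 ≤ 1 := by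
            rw [← sq_abs]; exact pow_le_one₀ (abs_nonneg _) h2
          linarith
    rw [hVeq]
    nlinarith [sq_nonneg (∑ k ∈ Finset.range M, Real.sin (k * u * S t))]
  have hcardT : (0 : ℝ) < Fintype.card (ι → Θ) := by exact_mod_cast Fintype.card_pos
  have hcos : ∀ v, |∑ t, Real.cos (v * S t)| ≤
      ‖∑ t : ι → Θ, Complex.exp ((v * S t : ℝ) * Complex.I)‖ := by
    intro v
    have : ∑ t, Real.cos (v * S t)
        = (∑ t : ι → Θ, Complex.exp ((v * S t : ℝ) * Complex.I)).re := by
      rw [Complex.re_sum]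
      exact Finset.sum_congr rfl fun t _ => (Complex.exp_ofReal_mul_I_re _).symm
    rw [this]; exact Complex.abs_re_le_norm _
  have hpair : ∀ k ∈ Finset.range M, ∀ l ∈ Finset.range M,
      ∑ t, Real.cos (((k : ℝ) - l) * u * S t) ≤
        (if k = l then (Fintype.card (ι → Θ) : ℝ) else 0)
          + q ^ Fintype.card ι * Fintype.card (ι → Θ) := by
    intro k hk l hl
    have hqn : (0 : ℝ) ≤ q ^ Fintype.card ι * Fintype.card (ι → Θ) := by positivity
    split_ifs with hkl
    · subst hkl; simp; positivity
    · rw [zero_add]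
      have hk' : (k : ℝ) < M := by exact_mod_cast Finset.mem_range.1 hk
      have hl' : (l : ℝ) < M := by exact_mod_cast Finset.mem_range.1 hl
      have h1 : (1 : ℝ) ≤ |(k : ℝ) - l| := by
        have : (1 : ℤ) ≤ |(k : ℤ) - l| := Int.one_le_abs (by omega)
        exact_mod_cast this
      have h2 : |(k : ℝ) - l| ≤ M := by
        rw [abs_le]; constructor <;> linarith [k.cast_nonneg (α := ℝ), l.cast_nonneg (α := ℝ)]
      have h3 : |((k : ℝ) - l) * u| = |(k : ℝ) - l| * u := by rw [abs_mul, abs_of_pos hu]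
      refine (le_abs_self _).trans ((hcos _).trans ?_)
      refine (norm_sum_exp_le ξ _ (q * Fintype.card Θ) fun i => h i _ ?_ ?_).trans (le_of_eq ?_)
      · rw [h3]; nlinarith
      · rw [h3]; gcongr
      · rw [mul_pow]; congr 1; simp
  have hsumV : ∑ t, V t ≤ (M + M ^ 2 * q ^ Fintype.card ι) * Fintype.card (ι → Θ) := by
    have : ∑ t, V t = ∑ k ∈ Finset.range M, ∑ l ∈ Finset.range M,
        ∑ t, Real.cos (((k : ℝ) - l) * u * S t) := by
      rw [hV, Finset.sum_comm]
      exact Finset.sum_congr rfl fun k _ => Finset.sum_comm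
    rw [this]
    refine (Finset.sum_le_sum fun k hk => Finset.sum_le_sum fun l hl => hpair k hk l hl).trans
      (le_of_eq ?_)
    have hrow : ∀ k ∈ Finset.range M, ∑ l ∈ Finset.range M,
        ((if k = l then (Fintype.card (ι → Θ) : ℝ) else 0)
          + q ^ Fintype.card ι * Fintype.card (ι → Θ))
        = Fintype.card (ι → Θ) + M * (q ^ Fintype.card ι * Fintype.card (ι → Θ)) := by
      intro k hk
      rw [Finset.sum_add_distrib, Finset.sum_ite_eq, if_pos hk]; simp
    rw [Finset.sum_congr rfl hrow, Finset.sum_const, Finset.card_range, nsmul_eq_mul]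
    ring
  have hlow : (Nat.card {t : ι → Θ // |S t| ≤ B} : ℝ) * (M ^ 2 / 4) ≤ ∑ t, V t := by
    have h1 : (Nat.card {t : ι → Θ // |S t| ≤ B} : ℝ) * (M ^ 2 / 4)
        = ∑ t ∈ Finset.univ.filter (fun t => |S t| ≤ B), ((M : ℝ) ^ 2 / 4) := by
      simp [Nat.card_eq_fintype_card, Fintype.card_subtype]
    rw [h1]
    refine (Finset.sum_le_sum fun t ht => hVB t (Finset.mem_filter.1 ht).2).trans ?_
    exact Finset.sum_le_sum_of_subset_of_nonneg (Finset.filter_subset _ _) fun t _ _ => hV0 t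
  have h4 := hlow.trans hsumV
  have h5 : 4 * (1 / (M : ℝ) + q ^ Fintype.card ι) * Fintype.card (ι → Θ)
      = ((M + M ^ 2 * q ^ Fintype.card ι) * Fintype.card (ι → Θ)) / (M ^ 2 / 4) := by
    field_simp
  rw [h5, le_div_iff₀ (by positivity)]
  exact h4

/-- The phases among which the perturbations choose: `(0 or π/2) + (0 or π)` in the first variable
and `0` or `π/2` in the second. -/
def phase (θ : Bool × Bool × Bool) : ℝ × ℝ :=
  ((if θ.1 then Real.pi else 0) + (if θ.2.1 then Real.pi / 2 else 0),
    if θ.2.2 then Real.pi / 2 else 0)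

/-- Over the eight phases, `cos · cos` is symmetrically distributed with second moment `1/4`
whatever the two angles are, whence a uniform bound on its characteristic function. -/
theorem norm_sum_exp_phase_le {s v : ℝ} (hv : |v * s| ≤ 1) (α β : ℝ) :
    ‖∑ θ, Complex.exp ((v * (s * Real.cos (α + (phase θ).1) * Real.cos (β + (phase θ).2)) : ℝ)
      * Complex.I)‖ ≤ (1 - (v * s) ^ 2 / 32) * Fintype.card (Bool × Bool × Bool) := by
  set w := v * s with hw
  have hpair : ∀ x : ℝ, Complex.exp ((x : ℝ) * Complex.I) + Complex.exp (((-x : ℝ)) * Complex.I)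
      = ((2 * Real.cos x : ℝ) : ℂ) := by
    intro x
    rw [Complex.ofReal_mul, Complex.ofReal_cos, Complex.ofReal_ofNat, Complex.two_cos]
    push_cast; rfl
  have hsum : ∑ θ, Complex.exp ((v * (s * Real.cos (α + (phase θ).1) * Real.cos (β + (phase θ).2))
      : ℝ) * Complex.I) = ((2 * (Real.cos (w * (Real.cos α * Real.cos β))
        + Real.cos (w * (Real.cos α * Real.sin β)) + Real.cos (w * (Real.sin α * Real.cos β))
        + Real.cos (w * (Real.sin α * Real.sin β))) : ℝ) : ℂ) := by
    have e1 := hpair (w * (Real.cos α * Real.cos β))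
    have e2 := hpair (w * (Real.cos α * Real.sin β))
    have e3 := hpair (w * (Real.sin α * Real.cos β))
    have e4 := hpair (w * (Real.sin α * Real.sin β))
    rw [mul_add, mul_add, mul_add, Complex.ofReal_add, Complex.ofReal_add, Complex.ofReal_add,
      ← e1, ← e2, ← e3, ← e4]
    simp only [Fintype.sum_prod_type, Fintype.sum_bool, phase, if_true, Bool.false_eq_true,
      if_false, add_zero, zero_add, Real.cos_add_pi_div_two, Real.cos_add_pi]
    have a1 : Real.cos (α + (Real.pi + Real.pi / 2)) = Real.sin α := by
      rw [← add_assoc, Real.cos_add_pi_div_two, Real.sin_add_pi, neg_neg]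
    rw [a1]
    have r1 : v * (s * Real.sin α * -Real.sin β) = -(w * (Real.sin α * Real.sin β)) := by
      rw [hw]; ring
    have r2 : v * (s * Real.sin α * Real.cos β) = w * (Real.sin α * Real.cos β) := by
      rw [hw]; ring
    have r3 : v * (s * -Real.cos α * -Real.sin β) = w * (Real.cos α * Real.sin β) := by
      rw [hw]; ring
    have r4 : v * (s * -Real.cos α * Real.cos β) = -(w * (Real.cos α * Real.cos β)) := by
      rw [hw]; ring
    have r5 : v * (s * -Real.sin α * -Real.sin β) = w * (Real.sin α * Real.sin β) := by
      rw [hw]; ring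
    have r6 : v * (s * -Real.sin α * Real.cos β) = -(w * (Real.sin α * Real.cos β)) := by
      rw [hw]; ring
    have r7 : v * (s * Real.cos α * -Real.sin β) = -(w * (Real.cos α * Real.sin β)) := by
      rw [hw]; ring
    have r8 : v * (s * Real.cos α * Real.cos β) = w * (Real.cos α * Real.cos β) := by
      rw [hw]; ring
    rw [r1, r2, r3, r4, r5, r6, r7, r8]
    ring
  have hcos : ∀ z : ℝ, |z| ≤ 1 → 0 ≤ Real.cos (w * z) ∧
      Real.cos (w * z) ≤ 1 - w ^ 2 * z ^ 2 / 8 := by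
    intro z hz
    have h1 : |w * z| ≤ 1 := by
      rw [abs_mul]; exact mul_le_one₀ hv (abs_nonneg _) hz
    constructor
    · refine (Real.cos_pos_of_le_one h1).le
    · have h2 := Real.cos_le_one_sub_mul_cos_sq (x := w * z) (h1.trans (by linarith [Real.pi_gt_three]))
      have h3 : (1 / 8 : ℝ) ≤ 2 / Real.pi ^ 2 := by
        rw [div_le_div_iff₀ (by norm_num) (by positivity)]
        nlinarith [Real.pi_le_four, Real.pi_pos]
      have h4 : 1 / 8 * (w * z) ^ 2 ≤ 2 / Real.pi ^ 2 * (w * z) ^ 2 := by gcongr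
      linarith [mul_pow w z 2]
  have hle : ∀ x y : ℝ, |x| ≤ 1 → |y| ≤ 1 → |x * y| ≤ 1 := fun x y hx hy => by
    rw [abs_mul]; exact mul_le_one₀ hx (abs_nonneg _) hy
  obtain ⟨p1, b1⟩ := hcos _ (hle _ _ (Real.abs_cos_le_one α) (Real.abs_cos_le_one β))
  obtain ⟨p2, b2⟩ := hcos _ (hle _ _ (Real.abs_cos_le_one α) (Real.abs_sin_le_one β))
  obtain ⟨p3, b3⟩ := hcos _ (hle _ _ (Real.abs_sin_le_one α) (Real.abs_cos_le_one β))
  obtain ⟨p4, b4⟩ := hcos _ (hle _ _ (Real.abs_sin_le_one α) (Real.abs_sin_le_one β))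
  rw [hsum, Complex.norm_real, Real.norm_eq_abs, abs_of_nonneg (by positivity)]
  have hone : (Real.cos α * Real.cos β) ^ 2 + (Real.cos α * Real.sin β) ^ 2
      + (Real.sin α * Real.cos β) ^ 2 + (Real.sin α * Real.sin β) ^ 2 = 1 := by
    have h1 := Real.sin_sq_add_cos_sq α
    have h2 := Real.sin_sq_add_cos_sq β
    calc _ = (Real.sin α ^ 2 + Real.cos α ^ 2) * (Real.sin β ^ 2 + Real.cos β ^ 2) := by ring
      _ = 1 := by rw [h1, h2, one_mul]
  have hc : (Fintype.card (Bool × Bool × Bool) : ℝ) = 8 := by simp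
  rw [hc]
  have : w ^ 2 * ((Real.cos α * Real.cos β) ^ 2 + (Real.cos α * Real.sin β) ^ 2
      + (Real.sin α * Real.cos β) ^ 2 + (Real.sin α * Real.sin β) ^ 2) = w ^ 2 := by
    rw [hone, mul_one]
  linarith

/-- Enough steps of the walk with steps `s cos cos` leave `[-B, B]` on most of the space, for some
choice of the phases. The number of steps depends neither on the angles nor on the space. -/
theorem exists_phases_escape {X : Type*} [MeasurableSpace X] (μ : Measure X) [IsFiniteMeasure μ]
    {s B δ : ℝ} (hs : 0 < s) (hB : 0 < B) (hδ : 0 < δ) :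
    ∃ r : ℕ, ∀ α β : ℕ → X → ℝ, (∀ i, Measurable (α i)) → (∀ i, Measurable (β i)) →
      ∃ t t' : ℕ → ℝ, μ.real {x | |∑ i ∈ Finset.range r,
        s * Real.cos (α i x + t i) * Real.cos (β i x + t' i)| ≤ B} ≤ δ * μ.real Set.univ := by
  obtain ⟨M, hM⟩ := exists_nat_gt (8 / δ)
  have hM0 : (0 : ℝ) < M := lt_trans (by positivity) hM
  have hMn : 0 < M := by exact_mod_cast hM0
  set u : ℝ := 1 / (M * (B + s)) with hu
  have hu0 : 0 < u := by positivity
  have hMu : M * u = 1 / (B + s) := by rw [hu]; field_simp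
  set q : ℝ := 1 - (u * s) ^ 2 / 32 with hq
  have hus : M * u * s ≤ 1 := by
    rw [hMu, div_mul_eq_mul_div, one_mul, div_le_one (by positivity)]; linarith
  have hM1 : (1 : ℝ) ≤ M := by exact_mod_cast hMn
  have hus1 : u * s ≤ 1 := by
    refine le_trans ?_ hus
    rw [mul_assoc]; nlinarith [mul_pos hu0 hs]
  have hq1 : q < 1 := by rw [hq]; have := mul_pos hu0 hs; linarith [pow_pos this 2]
  have hq0 : 0 ≤ q := by
    rw [hq]; have := mul_pos hu0 hs
    have := pow_le_one₀ (n := 2) this.le hus1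
    linarith
  obtain ⟨r, hr⟩ := exists_pow_lt_of_lt_one (show 0 < δ / 8 by positivity) hq1
  refine ⟨r, fun α β hα hβ => ?_⟩
  let S : (Fin r → Bool × Bool × Bool) → Set X := fun t =>
    {x | |∑ i : Fin r, s * Real.cos (α i x + (phase (t i)).1)
      * Real.cos (β i x + (phase (t i)).2)| ≤ B}
  have hS : ∀ t, MeasurableSet (S t) := by
    intro t
    refine measurableSet_le (Measurable.abs (Finset.measurable_fun_sum _ fun i _ => ?_))
      measurable_const
    exact (((Real.measurable_cos.comp ((hα i).add_const _)).const_mul s)).mul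
      (Real.measurable_cos.comp ((hβ i).add_const _))
  obtain ⟨t, ht⟩ := exists_measureReal_le_of_card_le μ hS
    (D := δ * Fintype.card (Fin r → Bool × Bool × Bool)) (fun x => by
      have h1 := card_abs_sum_le (ι := Fin r) (Θ := Bool × Bool × Bool)
        (fun i θ => s * Real.cos (α i x + (phase θ).1) * Real.cos (β i x + (phase θ).2))
        (B := B) (q := q) hMn hu0
        (by rw [hMu, div_mul_eq_mul_div, one_mul, div_le_one (by positivity)]; linarith) hq0
        (fun i v hv1 hv2 => by
          refine (norm_sum_exp_phase_le (s := s) (v := v) ?_ _ _).trans ?_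
          · rw [abs_mul, abs_of_pos hs]
            exact le_trans (by gcongr) hus
          · gcongr
            rw [hq]
            have : (u * s) ^ 2 ≤ (v * s) ^ 2 := by
              rw [← sq_abs (v * s), abs_mul, abs_of_pos hs]; gcongr
            linarith)
      refine h1.trans ?_
      gcongr
      rw [Fintype.card_fin]
      have : 1 / (M : ℝ) ≤ δ / 8 := by
        rw [div_le_div_iff₀ hM0 (by norm_num)]
        rw [div_lt_iff₀ hδ] at hM; linarith
      linarith)
  refine ⟨fun i => if h : i < r then (phase (t ⟨i, h⟩)).1 else 0,
    fun i => if h : i < r then (phase (t ⟨i, h⟩)).2 else 0, ?_⟩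
  rw [mul_div_assoc, div_self (by positivity), mul_one] at ht
  convert ht using 2
  ext x
  simp only [Set.mem_ofPred_eq, S]
  rw [← Fin.sum_univ_eq_sum_range (fun i => s * Real.cos (α i x + (if h : i < r then
    (phase (t ⟨i, h⟩)).1 else 0)) * Real.cos (β i x + (if h : i < r then
    (phase (t ⟨i, h⟩)).2 else 0)))]
  simp

/-! ### Periodic profiles -/

/-- A `C²` function `g` on the line with derivatives `g₁`, `g₂`, all bounded by `C`. -/
structure IsProfile (C : ℝ) (g g₁ g₂ : ℝ → ℝ) : Prop where
  hasDerivAt : ∀ x, HasDerivAt g (g₁ x) x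
  hasDerivAt₁ : ∀ x, HasDerivAt g₁ (g₂ x) x
  continuous₂ : Continuous g₂
  abs_le : ∀ x, |g x| ≤ C
  abs_le₁ : ∀ x, |g₁ x| ≤ C
  abs_le₂ : ∀ x, |g₂ x| ≤ C

theorem isProfile_sin : IsProfile 1 Real.sin Real.cos (fun x => -Real.sin x) where
  hasDerivAt := Real.hasDerivAt_sin
  hasDerivAt₁ := Real.hasDerivAt_cos
  continuous₂ := Real.continuous_sin.neg
  abs_le := Real.abs_sin_le_one
  abs_le₁ := Real.abs_cos_le_one
  abs_le₂ := fun x => by rw [abs_neg]; exact Real.abs_sin_le_one x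

theorem IsProfile.contDiff {C : ℝ} {g g₁ g₂ : ℝ → ℝ} (h : IsProfile C g g₁ g₂) :
    ContDiff ℝ 2 g := by
  have e1 : deriv g = g₁ := funext fun x => (h.hasDerivAt x).deriv
  have e2 : deriv g₁ = g₂ := funext fun x => (h.hasDerivAt₁ x).deriv
  have h1 : ContDiff ℝ 1 g₁ := contDiff_one_iff_deriv.2
    ⟨fun x => (h.hasDerivAt₁ x).differentiableAt, by rw [e2]; exact h.continuous₂⟩
  have : ContDiff ℝ (1 + 1) g := contDiff_succ_iff_deriv.2
    ⟨fun x => (h.hasDerivAt x).differentiableAt, by simp, by rw [e1]; exact h1⟩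
  simpa [one_add_one_eq_two] using this

theorem hasDerivAt_periodized {ψ : ℝ → ℝ} (hψ : Differentiable ℝ ψ) {ρ : ℝ} (hρ : ρ < 1 / 2)
    (hsupp : ∀ u, ρ < |u| → ψ u = 0) (x : ℝ) :
    HasDerivAt (fun x : ℝ => ψ (x - round x)) (deriv ψ (x - round x)) x := by
  rcases lt_or_eq_of_le (abs_sub_round x) with h | h
  · have hev : ∀ᶠ y : ℝ in 𝓝 x, ψ (y - round y) = ψ (y - round x) := by
      have hc : ∀ᶠ y : ℝ in 𝓝 x, |y - round x| < 1 / 2 :=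
        (continuous_abs.comp (continuous_id.sub continuous_const)).continuousAt.eventually_lt_const h
      filter_upwards [hc] with y hy
      have h1 := round_le y (round x)
      have h2 : |((round y - round x : ℤ) : ℝ)| < 1 := by
        push_cast
        have : (round y : ℝ) - round x = (y - round x) - (y - round y) := by ring
        rw [this]
        exact (abs_sub _ _).trans_lt (by linarith)
      have h3 : round y - round x = 0 := by
        rw [← Int.cast_abs] at h2
        exact Int.abs_lt_one_iff.1 (by exact_mod_cast h2)
      rw [show round y = round x by omega]
    have hd : HasDerivAt (fun y => ψ (y - round x)) (deriv ψ (x - round x)) x :=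
      ((hψ _).hasDerivAt).comp_sub_const x (round x : ℝ)
    exact hd.congr_of_eventuallyEq hev
  · have hnear : ∀ᶠ u in 𝓝 (x - round x), ψ u = 0 := by
      have : ∀ᶠ u in 𝓝 (x - round x), ρ < |u| :=
        continuous_abs.continuousAt.eventually_const_lt (by rw [h]; exact hρ)
      filter_upwards [this] with u hu using hsupp u hu
    have hd0 : deriv ψ (x - round x) = 0 := by
      have : ψ =ᶠ[𝓝 (x - round x)] fun _ => 0 := hnear
      rw [this.deriv_eq]; simp
    rw [hd0]
    have hev : ∀ᶠ y : ℝ in 𝓝 x, ψ (y - round y) = 0 := by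
      have hc : ∀ᶠ y in 𝓝 x, |y - x| < 1 / 2 - ρ := by
        refine (continuous_abs.comp (continuous_id.sub continuous_const)).continuousAt.eventually_lt_const ?_
        simpa using hρ
      filter_upwards [hc] with y hy
      refine hsupp _ ?_
      have h1 := round_le x (round y)
      have h2 : |x - round y| ≤ |y - x| + |y - round y| := by
        have : x - round y = -(y - x) + (y - round y) := by ring
        rw [this, ← abs_neg (y - x)]; exact abs_add_le _ _
      linarith
    exact (hasDerivAt_const x (0 : ℝ)).congr_of_eventuallyEq hev

/-- A smoothed sawtooth of period one: it has slope one except within `σ` of the half-integers. -/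
theorem exists_sawtooth {σ : ℝ} (hσ : 0 < σ) (hσ' : σ < 1 / 2) :
    ∃ (C : ℝ) (g g₁ g₂ : ℝ → ℝ), IsProfile C g g₁ g₂ ∧
      ∀ x : ℝ, |x - round x| < 1 / 2 - σ → g₁ x = 1 ∧ g₂ x = 0 := by
  let b : ContDiffBump (0 : ℝ) := ⟨1 / 2 - σ, 1 / 2 - σ / 2, by linarith, by linarith⟩
  set ψ : ℝ → ℝ := fun u => u * b u with hψdef
  have hψ : ContDiff ℝ 3 ψ := contDiff_id.mul b.contDiff
  have hψ1 : ContDiff ℝ 2 (deriv ψ) :=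
    (contDiff_succ_iff_deriv.1 (show ContDiff ℝ (2 + 1) ψ by exact_mod_cast hψ)).2.2
  have hψ2 : ContDiff ℝ 1 (deriv (deriv ψ)) :=
    (contDiff_succ_iff_deriv.1 (show ContDiff ℝ (1 + 1) (deriv ψ) by exact_mod_cast hψ1)).2.2
  have hcs : HasCompactSupport ψ := b.hasCompactSupport.mul_left
  have hcs1 := hcs.deriv
  have hcs2 := hcs1.deriv
  have hs0 : ∀ u, 1 / 2 - σ / 2 < |u| → ψ u = 0 := by
    intro u hu
    have : b u = 0 := b.zero_of_le_dist (by rw [Real.dist_0_eq_abs]; exact hu.le)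
    simp [hψdef, this]
  have hstep : ∀ f : ℝ → ℝ, (∀ u, 1 / 2 - σ / 2 < |u| → f u = 0) →
      ∀ u, 1 / 2 - σ / 2 < |u| → deriv f u = 0 := by
    intro f hf u hu
    have : f =ᶠ[𝓝 u] fun _ => 0 := by
      filter_upwards [continuous_abs.continuousAt.eventually_const_lt hu] with v hv using hf v hv
    rw [this.deriv_eq]; simp
  have hs1 := hstep _ hs0
  have hs2 := hstep _ hs1
  obtain ⟨C0, hC0⟩ := hψ.continuous.bounded_above_of_compact_support hcs
  obtain ⟨C1, hC1⟩ := hψ1.continuous.bounded_above_of_compact_support hcs1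
  obtain ⟨C2, hC2⟩ := hψ2.continuous.bounded_above_of_compact_support hcs2
  refine ⟨max C0 (max C1 C2), fun x : ℝ => ψ (x - round x), fun x : ℝ => deriv ψ (x - round x),
    fun x : ℝ => deriv (deriv ψ) (x - round x), ?_, ?_⟩
  · exact {
      hasDerivAt := hasDerivAt_periodized (hψ.differentiable (by norm_num))
        (ρ := 1 / 2 - σ / 2) (by linarith) hs0
      hasDerivAt₁ := hasDerivAt_periodized (hψ1.differentiable (by norm_num))
        (ρ := 1 / 2 - σ / 2) (by linarith) hs1
      continuous₂ := continuous_iff_continuousAt.2 fun x =>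
        (hasDerivAt_periodized (hψ2.differentiable (by norm_num))
        (ρ := 1 / 2 - σ / 2) (by linarith) hs2 x).continuousAt
      abs_le := fun x => (hC0 _).trans (le_max_left _ _)
      abs_le₁ := fun x => (hC1 _).trans ((le_max_left _ _).trans (le_max_right _ _))
      abs_le₂ := fun x => (hC2 _).trans ((le_max_right _ _).trans (le_max_right _ _)) }
  · intro x hx
    have hev : ∀ u : ℝ, |u| < 1 / 2 - σ → ψ =ᶠ[𝓝 u] id := by
      intro u hu
      filter_upwards [continuous_abs.continuousAt.eventually_lt_const hu] with v hv
      have : b v = 1 := b.one_of_mem_closedBall (by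
        rw [mem_closedBall_zero_iff, Real.norm_eq_abs]; exact hv.le)
      simp [hψdef, this]
    have hd : ∀ u : ℝ, |u| < 1 / 2 - σ → deriv ψ u = 1 := fun u hu => by
      rw [(hev u hu).deriv_eq]; simp
    refine ⟨hd _ hx, ?_⟩
    have : deriv ψ =ᶠ[𝓝 (x - round x)] fun _ => 1 := by
      filter_upwards [continuous_abs.continuousAt.eventually_lt_const hx] with v hv using hd v hv
    change deriv (deriv ψ) _ = 0
    rw [this.deriv_eq]; simp

/-- Among `m` equally spaced phases, at most one brings a given angle within `1 / (2m)` of the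
half-integers. -/
theorem card_bad_phase_le {m : ℕ} (hm : 0 < m) (x : ℝ) :
    (Nat.card {k : Fin m // 1 / 2 - 1 / (2 * m) <
      |(x + (k : ℕ) / m) - round (x + ((k : ℕ) : ℝ) / m)|} : ℝ) ≤ 1 := by
  have hm' : (0 : ℝ) < m := by exact_mod_cast hm
  have hhalf : ∀ z : ℝ, 1 / 2 - 1 / (2 * m) < |z - round z| →
      ∃ n : ℤ, |z - n - 1 / 2| < 1 / (2 * m) := by
    intro z hz
    have h1 := abs_sub_round z
    rcases le_or_gt 0 (z - round z) with h | h
    · rw [abs_of_nonneg h] at hz h1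
      refine ⟨round z, ?_⟩
      rw [abs_lt]
      have : (0 : ℝ) < 1 / (2 * m) := by positivity
      constructor <;> linarith
    · rw [abs_of_neg h] at hz h1
      refine ⟨round z - 1, ?_⟩
      push_cast
      have : (0 : ℝ) < 1 / (2 * m) := by positivity
      rw [abs_lt]
      constructor <;> linarith
  have hsub : Subsingleton {k : Fin m // 1 / 2 - 1 / (2 * m) <
      |(x + (k : ℕ) / m) - round (x + ((k : ℕ) : ℝ) / m)|} := by
    refine ⟨fun k l => ?_⟩
    obtain ⟨k, hk⟩ := k
    obtain ⟨l, hl⟩ := l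
    obtain ⟨n, hn⟩ := hhalf _ hk
    obtain ⟨n', hn'⟩ := hhalf _ hl
    have h1 : |((k : ℕ) : ℝ) / m - (l : ℕ) / m - (n - n')| < 1 / m := by
      have : ((k : ℕ) : ℝ) / m - (l : ℕ) / m - (n - n')
        = (x + (k : ℕ) / m - n - 1 / 2) - (x + (l : ℕ) / m - n' - 1 / 2) := by ring
      rw [this]
      refine (abs_sub _ _).trans_lt ?_
      have : (1 : ℝ) / m = 1 / (2 * m) + 1 / (2 * m) := by field_simp; norm_num
      linarith
    have h2 : |(((k : ℕ) - (l : ℕ) - (n - n') * m : ℤ) : ℝ)| < 1 := by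
      have : (((k : ℕ) - (l : ℕ) - (n - n') * m : ℤ) : ℝ)
        = (((k : ℕ) : ℝ) / m - (l : ℕ) / m - (n - n')) * m := by
        push_cast; field_simp
      rw [this, abs_mul, abs_of_pos hm']
      calc _ < 1 / (m : ℝ) * m := by gcongr
        _ = 1 := by field_simp
    have h3 : ((k : ℕ) - (l : ℕ) - (n - n') * m : ℤ) = 0 := by
      rw [← Int.cast_abs] at h2
      exact Int.abs_lt_one_iff.1 (by exact_mod_cast h2)
    have hkm := k.2
    have hlm := l.2
    have h4 : n - n' = 0 := by
      by_contra hne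
      have h5 : (m : ℤ) ≤ |(n - n') * m| := by
        rw [abs_mul, abs_of_nonneg (by positivity : (0 : ℤ) ≤ (m : ℤ))]
        have := Int.one_le_abs hne
        nlinarith
      have h6 : |(n - n') * (m : ℤ)| < m := by
        rw [show (n - n') * (m : ℤ) = (k : ℕ) - (l : ℕ) by linarith, abs_lt]
        constructor <;> omega
      omega
    rw [h4] at h3
    ext
    simp only
    omega
  exact_mod_cast Finite.card_le_one_iff_subsingleton.2 hsub

/-- Two phases can be chosen such that, outside a set of small measure, both angles stay away from
the half-integers. -/
theorem exists_phases_good {X : Type*} [MeasurableSpace X] (μ : Measure X) [IsFiniteMeasure μ]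
    {m : ℕ} (hm : 0 < m) {α β : X → ℝ} (hα : Measurable α) (hβ : Measurable β) :
    ∃ t t' : ℝ,
      μ.real {x | 1 / 2 - 1 / (2 * m) < |(α x + t) - round (α x + t)|} ≤
        1 / m * μ.real Set.univ ∧
      μ.real {x | 1 / 2 - 1 / (2 * m) < |(β x + t') - round (β x + t')|} ≤
        1 / m * μ.real Set.univ := by
  have key : ∀ γ : X → ℝ, Measurable γ → ∃ t : ℝ,
      μ.real {x | 1 / 2 - 1 / (2 * m) < |(γ x + t) - round (γ x + t)|} ≤
        1 / m * μ.real Set.univ := by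
    intro γ hγ
    have : Nonempty (Fin m) := ⟨⟨0, hm⟩⟩
    have hround : Measurable (round : ℝ → ℤ) := by
      have : (round : ℝ → ℤ) = fun x => ⌊x + 1 / 2⌋ := funext fun x => round_eq x
      rw [this]; exact Int.measurable_floor.comp (measurable_id.add_const _)
    obtain ⟨k, hk⟩ := exists_measureReal_le_of_card_le μ (T := Fin m)
      (S := fun k => {x | 1 / 2 - 1 / (2 * m) <
        |(γ x + (k : ℕ) / m) - round (γ x + ((k : ℕ) : ℝ) / m)|}) (D := 1)
      (fun k => by
        refine measurableSet_lt measurable_const (Measurable.abs ?_)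
        have h1 : Measurable fun x => γ x + ((k : ℕ) : ℝ) / m := hγ.add_const _
        exact h1.sub ((measurable_from_top (f := fun n : ℤ => (n : ℝ))).comp (hround.comp h1)))
      (fun x => card_bad_phase_le hm (γ x))
    exact ⟨_, by simpa using hk⟩
  obtain ⟨t, ht⟩ := key α hα
  obtain ⟨t', ht'⟩ := key β hβ
  exact ⟨t, t', ht, ht'⟩

/-! ### Rapidly oscillating generating functions -/

section Wave

variable {E : Type*} [NormedAddCommGroup E] [NormedSpace ℝ E]

/-- The wave `ρ² g(α/ρ + t) g(β/ρ + t')`, of size `ρ²` with second derivatives of size one. -/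
def wave (g : ℝ → ℝ) (α β : E →L[ℝ] ℝ) (ρ t t' : ℝ) (y : E) : ℝ :=
  ρ ^ 2 * (g (α y / ρ + t) * g (β y / ρ + t'))

/-- The first derivative of `wave g α β ρ t t'` when `g₁ = g'`. -/
def waveGrad (g g₁ : ℝ → ℝ) (α β : E →L[ℝ] ℝ) (ρ t t' : ℝ) (y : E) : E →L[ℝ] ℝ :=
  ρ • ((g₁ (α y / ρ + t) * g (β y / ρ + t')) • α + (g (α y / ρ + t) * g₁ (β y / ρ + t')) • β)

/-- The second derivative of `wave g α β ρ t t'` when `g₁ = g'` and `g₂ = g''`. -/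
def waveHess (g g₁ g₂ : ℝ → ℝ) (α β : E →L[ℝ] ℝ) (ρ t t' : ℝ) (y : E) : E →L[ℝ] E →L[ℝ] ℝ :=
  ((g₂ (α y / ρ + t) * g (β y / ρ + t')) • α.smulRight α +
    (g₁ (α y / ρ + t) * g₁ (β y / ρ + t')) • β.smulRight α) +
  ((g₁ (α y / ρ + t) * g₁ (β y / ρ + t')) • α.smulRight β +
    (g (α y / ρ + t) * g₂ (β y / ρ + t')) • β.smulRight β)

variable {C : ℝ} {g g₁ g₂ : ℝ → ℝ} {α β : E →L[ℝ] ℝ} {ρ t t' : ℝ}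

theorem hasFDerivAt_comp_phase {f : ℝ → ℝ} {f' : ℝ} {y : E} (h : HasDerivAt f f' (α y / ρ + t)) :
    HasFDerivAt (fun y => f (α y / ρ + t)) ((f' / ρ) • α) y := by
  have h1 : HasFDerivAt (fun y => α y / ρ + t) (ρ⁻¹ • α) y := by
    have := (α.hasFDerivAt (x := y)).const_smul ρ⁻¹
    refine (this.add_const t).congr_of_eventuallyEq (Eventually.of_forall fun z => ?_)
    simp [div_eq_inv_mul]
  refine (h.comp_hasFDerivAt y h1).congr_fderiv ?_
  rw [smul_smul, div_eq_mul_inv]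

theorem hasFDerivAt_mul_phase {f k : ℝ → ℝ} {f' k' : ℝ} {y : E}
    (hf : HasDerivAt f f' (α y / ρ + t)) (hk : HasDerivAt k k' (β y / ρ + t')) :
    HasFDerivAt (fun y => f (α y / ρ + t) * k (β y / ρ + t'))
      (ρ⁻¹ • ((f' * k (β y / ρ + t')) • α + (f (α y / ρ + t) * k') • β)) y := by
  refine ((hasFDerivAt_comp_phase hf).mul (hasFDerivAt_comp_phase hk)).congr_fderiv ?_
  ext v
  simp only [add_apply, smul_apply, smul_eq_mul]
  ring

theorem IsProfile.hasFDerivAt_wave (h : IsProfile C g g₁ g₂) (hρ : ρ ≠ 0) (y : E) :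
    HasFDerivAt (wave g α β ρ t t') (waveGrad g g₁ α β ρ t t' y) y := by
  refine ((hasFDerivAt_mul_phase (h.hasDerivAt _) (h.hasDerivAt _)).const_mul (ρ ^ 2)).congr_fderiv
    ?_
  ext v
  simp only [waveGrad, add_apply, smul_apply, smul_eq_mul]
  field_simp

theorem IsProfile.hasFDerivAt_waveGrad (h : IsProfile C g g₁ g₂) (hρ : ρ ≠ 0) (y : E) :
    HasFDerivAt (waveGrad g g₁ α β ρ t t') (waveHess g g₁ g₂ α β ρ t t' y) y := by
  have h1 := hasFDerivAt_mul_phase (α := α) (β := β) (ρ := ρ) (y := y)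
    (h.hasDerivAt₁ (α y / ρ + t)) (h.hasDerivAt (β y / ρ + t'))
  have h2 := hasFDerivAt_mul_phase (α := α) (β := β) (ρ := ρ) (y := y)
    (h.hasDerivAt (α y / ρ + t)) (h.hasDerivAt₁ (β y / ρ + t'))
  refine (((h1.smul_const α).add (h2.smul_const β)).const_smul ρ).congr_fderiv ?_
  ext v w
  simp only [waveHess, add_apply, smul_apply, smul_eq_mul, ContinuousLinearMap.smulRight_apply]
  field_simp

theorem IsProfile.const_nonneg (h : IsProfile C g g₁ g₂) : 0 ≤ C :=
  (abs_nonneg _).trans (h.abs_le 0)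

theorem abs_mul_le_sq {x y : ℝ} (hx : |x| ≤ C) (hy : |y| ≤ C) : |x * y| ≤ C ^ 2 := by
  rw [abs_mul, sq]; exact mul_le_mul hx hy (abs_nonneg _) ((abs_nonneg _).trans hx)

theorem norm_smul_add_smul_le {F : Type*} [NormedAddCommGroup F] [NormedSpace ℝ F] {x y K R : ℝ}
    {a b : F} (hx : |x| ≤ K) (hy : |y| ≤ K) (ha : ‖a‖ ≤ R) (hb : ‖b‖ ≤ R) :
    ‖x • a + y • b‖ ≤ 2 * K * R := by
  have hK : 0 ≤ K := (abs_nonneg _).trans hx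
  calc _ ≤ ‖x • a‖ + ‖y • b‖ := norm_add_le _ _
    _ ≤ K * R + K * R := by
      rw [norm_smul, norm_smul, Real.norm_eq_abs, Real.norm_eq_abs]
      gcongr
    _ = _ := by ring

theorem IsProfile.abs_wave_le (h : IsProfile C g g₁ g₂) (y : E) :
    |wave g α β ρ t t' y| ≤ ρ ^ 2 * C ^ 2 := by
  rw [wave, abs_mul, abs_of_nonneg (sq_nonneg ρ)]
  gcongr
  exact abs_mul_le_sq (h.abs_le _) (h.abs_le _)

theorem IsProfile.norm_waveGrad_le (h : IsProfile C g g₁ g₂) (hα : ‖α‖ ≤ 1) (hβ : ‖β‖ ≤ 1)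
    (hρ : 0 ≤ ρ) (y : E) : ‖waveGrad g g₁ α β ρ t t' y‖ ≤ ρ * (2 * C ^ 2) := by
  rw [waveGrad, norm_smul, Real.norm_eq_abs, abs_of_nonneg hρ]
  gcongr
  simpa using norm_smul_add_smul_le (abs_mul_le_sq (h.abs_le₁ _) (h.abs_le _))
    (abs_mul_le_sq (h.abs_le _) (h.abs_le₁ _)) hα hβ

theorem IsProfile.norm_waveHess_apply_le (h : IsProfile C g g₁ g₂) (hα : ‖α‖ ≤ 1) (hβ : ‖β‖ ≤ 1)
    (y v : E) : ‖waveHess g g₁ g₂ α β ρ t t' y v‖ ≤ 4 * C ^ 2 * ‖v‖ := by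
  have hs : ∀ a b : E →L[ℝ] ℝ, ‖a‖ ≤ 1 → ‖b‖ ≤ 1 → ‖a v • b‖ ≤ ‖v‖ := fun a b ha hb => by
    rw [norm_smul]
    calc ‖a v‖ * ‖b‖ ≤ (1 * ‖v‖) * 1 := by gcongr; exact a.le_of_opNorm_le ha v
      _ = ‖v‖ := by ring
  have h1 := norm_smul_add_smul_le (abs_mul_le_sq (h.abs_le₂ (α y / ρ + t)) (h.abs_le (β y / ρ + t')))
    (abs_mul_le_sq (h.abs_le₁ (α y / ρ + t)) (h.abs_le₁ (β y / ρ + t'))) (hs α α hα hα) (hs β α hβ hα)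
  have h2 := norm_smul_add_smul_le (abs_mul_le_sq (h.abs_le₁ (α y / ρ + t)) (h.abs_le₁ (β y / ρ + t')))
    (abs_mul_le_sq (h.abs_le (α y / ρ + t)) (h.abs_le₂ (β y / ρ + t'))) (hs α β hα hβ) (hs β β hβ hβ)
  simp only [waveHess, add_apply, smul_apply, ContinuousLinearMap.smulRight_apply]
  refine (norm_add_le _ _).trans ?_
  linarith

theorem IsProfile.contDiff_wave (h : IsProfile C g g₁ g₂) : ContDiff ℝ 2 (wave g α β ρ t t') := by
  have hc : ∀ (γ : E →L[ℝ] ℝ) (τ : ℝ), ContDiff ℝ 2 fun y => g (γ y / ρ + τ) := fun γ τ =>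
    h.contDiff.comp ((γ.contDiff.div_const ρ).add contDiff_const)
  exact contDiff_const.mul ((hc α t).mul (hc β t'))

variable {a : E → ℝ}

theorem IsProfile.fderiv_mul_wave (h : IsProfile C g g₁ g₂) (ha : ContDiff ℝ 2 a) (hρ : ρ ≠ 0)
    (y : E) : fderiv ℝ (fun y => a y * wave g α β ρ t t' y) y =
      a y • waveGrad g g₁ α β ρ t t' y + wave g α β ρ t t' y • fderiv ℝ a y :=
  (((ha.differentiable (by norm_num)) y).hasFDerivAt.mul (h.hasFDerivAt_wave hρ y)).fderiv

theorem IsProfile.fderiv_fderiv_mul_wave (h : IsProfile C g g₁ g₂) (ha : ContDiff ℝ 2 a)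
    (hρ : ρ ≠ 0) (y v : E) : fderiv ℝ (fderiv ℝ (fun y => a y * wave g α β ρ t t' y)) y v =
      a y • waveHess g g₁ g₂ α β ρ t t' y v + (fderiv ℝ a y v • waveGrad g g₁ α β ρ t t' y +
        (wave g α β ρ t t' y • fderiv ℝ (fderiv ℝ a) y v +
          waveGrad g g₁ α β ρ t t' y v • fderiv ℝ a y)) := by
  have h1 : fderiv ℝ (fun y => a y * wave g α β ρ t t' y) = fun y =>
      a y • waveGrad g g₁ α β ρ t t' y + wave g α β ρ t t' y • fderiv ℝ a y :=
    funext fun y => h.fderiv_mul_wave ha hρ y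
  rw [h1]
  have had : HasFDerivAt a (fderiv ℝ a y) y :=
    ((ha.differentiable (by norm_num)) y).hasFDerivAt
  have had2 : HasFDerivAt (fderiv ℝ a) (fderiv ℝ (fderiv ℝ a) y) y :=
    (((ha.fderiv_right (m := 1) (by norm_num)).differentiable (by norm_num)) y).hasFDerivAt
  refine (congrArg (fun L => L v) ((had.smul (h.hasFDerivAt_waveGrad hρ y)).add
    ((h.hasFDerivAt_wave hρ y).smul had2)).fderiv).trans ?_
  simp only [add_apply, smul_apply, ContinuousLinearMap.smulRight_apply, add_assoc]

end Wave

variable {N : ℕ} {C : ℝ} {g g₁ g₂ : ℝ → ℝ} {a : Phase N → ℝ}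

theorem symplGrad_proj_inl (i : Fin N) :
    symplGrad N (EuclideanSpace.proj (Sum.inl i)) = qVec i := by
  ext k
  rcases k with k | k
  · simp [qVec]
  · by_cases hk : k = i <;> simp [pVec, qVec, hk, eq_comm]

theorem symplGrad_proj_inr (j : Fin N) :
    symplGrad N (EuclideanSpace.proj (Sum.inr j)) = -pVec j := by
  ext k
  rcases k with k | k
  · by_cases hk : k = j <;> simp [pVec, qVec, hk, eq_comm]
  · simp [pVec]

theorem norm_euclideanProj_le (k : Fin N ⊕ Fin N) :
    ‖(EuclideanSpace.proj k : Phase N →L[ℝ] ℝ)‖ ≤ 1 :=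
  ContinuousLinearMap.opNorm_le_bound _ zero_le_one fun v => by
    rw [one_mul]; exact PiLp.norm_apply_le v k

/-- A wave in the coordinates `p_i`, `q_j` with amplitude `a`, as a generating function. -/
def waveFun (g : ℝ → ℝ) (a : Phase N → ℝ) (i j : Fin N) (ρ t t' : ℝ) (y : Phase N) : ℝ :=
  a y * wave g (EuclideanSpace.proj (Sum.inl i)) (EuclideanSpace.proj (Sum.inr j)) ρ t t' y

/-- What the second derivative of a wave of amplitude one in the coordinates `p_i`, `q_j`
contributes to the derivative of the Hamiltonian field. -/
def waveShear (g g₁ g₂ : ℝ → ℝ) (i j : Fin N) (ρ t t' : ℝ) (y v : Phase N) : Phase N :=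
  (g₂ (y (Sum.inl i) / ρ + t) * g (y (Sum.inr j) / ρ + t') * v (Sum.inl i)
    + g₁ (y (Sum.inl i) / ρ + t) * g₁ (y (Sum.inr j) / ρ + t') * v (Sum.inr j)) • qVec i
  - (g₁ (y (Sum.inl i) / ρ + t) * g₁ (y (Sum.inr j) / ρ + t') * v (Sum.inl i)
    + g (y (Sum.inl i) / ρ + t) * g₂ (y (Sum.inr j) / ρ + t') * v (Sum.inr j)) • pVec j

theorem symplGrad_waveHess (i j : Fin N) (ρ t t' : ℝ) (y v : Phase N) :
    symplGrad N (waveHess g g₁ g₂ (EuclideanSpace.proj (Sum.inl i))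
      (EuclideanSpace.proj (Sum.inr j)) ρ t t' y v) = waveShear g g₁ g₂ i j ρ t t' y v := by
  have hp : ∀ (k : Fin N ⊕ Fin N) (z : Phase N), EuclideanSpace.proj (𝕜 := ℝ) k z = z k :=
    fun _ _ => rfl
  simp only [waveHess, waveShear, add_apply, smul_apply, ContinuousLinearMap.smulRight_apply,
    map_add, map_smul, symplGrad_proj_inl, symplGrad_proj_inr, hp]
  module

theorem contDiff_waveFun (hg : IsProfile C g g₁ g₂) (ha : ContDiff ℝ 2 a) {i j : Fin N}
    {ρ t t' : ℝ} : ContDiff ℝ 2 (waveFun g a i j ρ t t') :=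
  ha.mul hg.contDiff_wave

theorem hamField_waveFun (hg : IsProfile C g g₁ g₂) (ha : ContDiff ℝ 2 a) {i j : Fin N}
    {ρ : ℝ} (hρ : ρ ≠ 0) (t t' : ℝ) (y : Phase N) :
    hamField (waveFun g a i j ρ t t') y = a y • symplGrad N (waveGrad g g₁
      (EuclideanSpace.proj (Sum.inl i)) (EuclideanSpace.proj (Sum.inr j)) ρ t t' y) +
      wave g (EuclideanSpace.proj (Sum.inl i)) (EuclideanSpace.proj (Sum.inr j)) ρ t t' y •
        symplGrad N (fderiv ℝ a y) := by
  rw [← map_smul, ← map_smul, ← map_add, ← hg.fderiv_mul_wave ha hρ]; rfl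

theorem fderiv_hamField_waveFun (hg : IsProfile C g g₁ g₂) (ha : ContDiff ℝ 2 a) {i j : Fin N}
    {ρ : ℝ} (hρ : ρ ≠ 0) (t t' : ℝ) (y v : Phase N) :
    fderiv ℝ (hamField (waveFun g a i j ρ t t')) y v =
      a y • waveShear g g₁ g₂ i j ρ t t' y v + symplGrad N
      (fderiv ℝ a y v • waveGrad g g₁
          (EuclideanSpace.proj (Sum.inl i)) (EuclideanSpace.proj (Sum.inr j)) ρ t t' y +
        (wave g (EuclideanSpace.proj (Sum.inl i)) (EuclideanSpace.proj (Sum.inr j)) ρ t t' y •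
          fderiv ℝ (fderiv ℝ a) y v +
          waveGrad g g₁ (EuclideanSpace.proj (Sum.inl i)) (EuclideanSpace.proj (Sum.inr j))
            ρ t t' y v • fderiv ℝ a y)) := by
  rw [fderiv_hamField (contDiff_waveFun hg ha), ← symplGrad_waveHess, ← map_smul, ← map_add,
    ← hg.fderiv_fderiv_mul_wave ha hρ]
  rfl

theorem norm_waveShear_le (hg : IsProfile C g g₁ g₂) (i j : Fin N) (ρ t t' : ℝ)
    (y v : Phase N) :
    ‖waveShear g g₁ g₂ i j ρ t t' y v‖ ≤ ‖symplGrad N‖ * (4 * C ^ 2) * ‖v‖ := by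
  rw [← symplGrad_waveHess, mul_assoc]
  refine ((symplGrad N).le_opNorm _).trans ?_
  exact mul_le_mul_of_nonneg_left (hg.norm_waveHess_apply_le (norm_euclideanProj_le _)
    (norm_euclideanProj_le _) y v) (symplGrad N).opNorm_nonneg

/-- The Hamiltonian field of a wave of wave length `ρ` is of size `ρ`, and the slow variation of its
amplitude contributes only `O(ρ)` to its derivative. -/
theorem exists_waveFun_bound (hg : IsProfile C g g₁ g₂) (ha : ContDiff ℝ 2 a)
    (hac : HasCompactSupport a) {i j : Fin N} (hij : i ≠ j) :
    ∃ K, 0 ≤ K ∧ (∀ y, |a y| ≤ K) ∧ ∀ ρ t t' : ℝ, 0 < ρ → ρ ≤ 1 → ∀ y,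
      ‖hamField (waveFun g a i j ρ t t') y‖ ≤ K * ρ ∧
      |hamField (waveFun g a i j ρ t t') y (Sum.inl i)| ≤ K * ρ ^ 2 ∧
      ∀ v, ‖fderiv ℝ (hamField (waveFun g a i j ρ t t')) y v
        - a y • waveShear g g₁ g₂ i j ρ t t' y v‖ ≤ K * ρ * ‖v‖ := by
  obtain ⟨C₁, hC₁⟩ := (ha.continuous_fderiv (by norm_num)).bounded_above_of_compact_support
    (hac.fderiv (𝕜 := ℝ))
  obtain ⟨C₂, hC₂⟩ := (((ha.fderiv_right (m := 1) (by norm_num)).continuous_fderiv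
    (by norm_num))).bounded_above_of_compact_support ((hac.fderiv (𝕜 := ℝ)).fderiv (𝕜 := ℝ))
  obtain ⟨C₀, hC₀⟩ := ha.continuous.bounded_above_of_compact_support hac
  have hC := hg.const_nonneg
  have hC₀' : 0 ≤ C₀ := (norm_nonneg _).trans (hC₀ 0)
  have hC₁' : 0 ≤ C₁ := (norm_nonneg _).trans (hC₁ 0)
  have hC₂' : 0 ≤ C₂ := (norm_nonneg (fderiv ℝ (fderiv ℝ a) 0)).trans (hC₂ 0)
  obtain ⟨J, hJ0, hJ⟩ : ∃ J : ℝ, 0 ≤ J ∧ ∀ ℓ, ‖symplGrad N ℓ‖ ≤ J * ‖ℓ‖ :=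
    ⟨_, (symplGrad N).opNorm_nonneg, (symplGrad N).le_opNorm⟩
  have k₁ : 0 ≤ C₀ * (J * (2 * C ^ 2)) + C ^ 2 * (J * C₁) := by positivity
  have k₂ : 0 ≤ J * (C₁ * (2 * C ^ 2) + (C ^ 2 * C₂ + 2 * C ^ 2 * C₁)) := by positivity
  refine ⟨C₀ + (C₀ * (J * (2 * C ^ 2)) + C ^ 2 * (J * C₁)) +
    J * (C₁ * (2 * C ^ 2) + (C ^ 2 * C₂ + 2 * C ^ 2 * C₁)), by linarith,
    fun y => (hC₀ y).trans (by linarith), fun ρ t t' hρ hρ1 y => ?_⟩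
  set α : Phase N →L[ℝ] ℝ := EuclideanSpace.proj (Sum.inl i) with hα
  set β : Phase N →L[ℝ] ℝ := EuclideanSpace.proj (Sum.inr j) with hβ
  have hwave : |wave g α β ρ t t' y| ≤ ρ * C ^ 2 :=
    (hg.abs_wave_le y).trans (by gcongr; nlinarith)
  have hGn : ‖waveGrad g g₁ α β ρ t t' y‖ ≤ ρ * (2 * C ^ 2) :=
    hg.norm_waveGrad_le (norm_euclideanProj_le _) (norm_euclideanProj_le _) hρ.le y
  refine ⟨?_, ?_, fun v => ?_⟩
  rotate_left
  · have h1 : hamField (waveFun g a i j ρ t t') y (Sum.inl i) =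
        wave g α β ρ t t' y * symplGrad N (fderiv ℝ a y) (Sum.inl i) := by
      rw [hamField_waveFun hg ha hρ.ne', waveGrad]
      simp only [map_smul, map_add, symplGrad_proj_inl, symplGrad_proj_inr]
      simp [pVec, qVec, hij, hα, hβ]
    rw [h1, abs_mul]
    calc _ ≤ ρ ^ 2 * C ^ 2 * (J * C₁) := by
          gcongr
          · exact hg.abs_wave_le y
          · exact (PiLp.norm_apply_le (symplGrad N (fderiv ℝ a y)) _).trans
              ((hJ _).trans (by gcongr; exact hC₁ y))
      _ = C ^ 2 * (J * C₁) * ρ ^ 2 := by ring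
      _ ≤ _ := by
          have : 0 ≤ C₀ * (J * (2 * C ^ 2)) := by positivity
          exact mul_le_mul_of_nonneg_right (by linarith) (sq_nonneg ρ)
  rotate_left
  · rw [hamField_waveFun hg ha hρ.ne']
    refine (norm_add_le _ _).trans ?_
    rw [norm_smul, norm_smul]
    calc _ ≤ C₀ * (J * (ρ * (2 * C ^ 2))) + ρ * C ^ 2 * (J * C₁) := by
          gcongr
          · exact hC₀ y
          · exact (hJ _).trans (by gcongr)
          · exact hwave
          · exact (hJ _).trans (by gcongr; exact hC₁ y)
      _ = (C₀ * (J * (2 * C ^ 2)) + C ^ 2 * (J * C₁)) * ρ := by ring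
      _ ≤ _ := mul_le_mul_of_nonneg_right (by linarith) hρ.le
  · rw [fderiv_hamField_waveFun hg ha hρ.ne', add_sub_cancel_left]
    refine (hJ _).trans ?_
    have h1 : ‖fderiv ℝ a y v‖ ≤ C₁ * ‖v‖ := (fderiv ℝ a y).le_of_opNorm_le (hC₁ y) v
    have h2 : ‖fderiv ℝ (fderiv ℝ a) y v‖ ≤ C₂ * ‖v‖ :=
      (fderiv ℝ (fderiv ℝ a) y).le_of_opNorm_le (hC₂ y) v
    have h3 : ‖waveGrad g g₁ α β ρ t t' y v‖ ≤ ρ * (2 * C ^ 2) * ‖v‖ :=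
      (waveGrad g g₁ α β ρ t t' y).le_of_opNorm_le hGn v
    have h4 : ‖fderiv ℝ a y v • waveGrad g g₁ α β ρ t t' y + (wave g α β ρ t t' y •
        fderiv ℝ (fderiv ℝ a) y v + waveGrad g g₁ α β ρ t t' y v • fderiv ℝ a y)‖ ≤
        C₁ * ‖v‖ * (ρ * (2 * C ^ 2)) + (ρ * C ^ 2 * (C₂ * ‖v‖) +
          ρ * (2 * C ^ 2) * ‖v‖ * C₁) := by
      refine (norm_add_le _ _).trans (add_le_add ?_ ((norm_add_le _ _).trans (add_le_add ?_ ?_)))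
      · rw [norm_smul]; gcongr
      · rw [norm_smul]; gcongr; exact hwave
      · rw [norm_smul]; gcongr; exact hC₁ y
    calc _ ≤ J * (C₁ * ‖v‖ * (ρ * (2 * C ^ 2)) + (ρ * C ^ 2 * (C₂ * ‖v‖) +
          ρ * (2 * C ^ 2) * ‖v‖ * C₁)) := by gcongr
      _ = J * (C₁ * (2 * C ^ 2) + (C ^ 2 * C₂ + 2 * C ^ 2 * C₁)) * ρ * ‖v‖ := by ring
      _ ≤ _ := by gcongr; linarith

/-- Where the amplitude is locally constant, the Hamiltonian field of a wave and its derivative are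
explicit. -/
theorem hamField_waveFun_of_eventually_const (hg : IsProfile C g g₁ g₂) (ha : ContDiff ℝ 2 a)
    {i j : Fin N} {ρ t t' : ℝ} (hρ : ρ ≠ 0) {y : Phase N} (hy : ∀ᶠ z in 𝓝 y, a z = a y) :
    (∃ c d : ℝ, hamField (waveFun g a i j ρ t t') y = c • qVec i + d • pVec j) ∧
      ∀ v, fderiv ℝ (hamField (waveFun g a i j ρ t t')) y v =
        a y • waveShear g g₁ g₂ i j ρ t t' y v := by
  have h1 : a =ᶠ[𝓝 y] fun _ => a y := hy
  have hd : fderiv ℝ a y = 0 := by rw [h1.fderiv_eq]; simp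
  have hd2 : fderiv ℝ (fderiv ℝ a) y = 0 := by
    have h2 : fderiv ℝ a =ᶠ[𝓝 y] fun _ => 0 := by
      filter_upwards [h1.fderiv (𝕜 := ℝ)] with z hz
      rw [hz]; simp
    rw [h2.fderiv_eq]; simp
  refine ⟨?_, fun v => ?_⟩
  · rw [hamField_waveFun hg ha hρ, hd, map_zero, smul_zero, add_zero, waveGrad]
    simp only [map_smul, map_add, symplGrad_proj_inl, symplGrad_proj_inr, smul_neg, smul_add,
      smul_smul]
    exact ⟨_, _, by rw [← neg_smul]⟩
  · rw [fderiv_hamField_waveFun hg ha hρ, hd, hd2]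
    simp

/-- The symplectic map generated by a wave in the Poisson-commuting coordinates `p_i`, `q_j`
(`i ≠ j`) with slowly varying amplitude `a`. Up to errors of order `ρ` its derivative is the
explicit one; where `a` is constant, it is exactly the shear which adds multiples of `dp_i`, `dq_j`
to `q_i`, `p_j`. The auxiliary point `y x`, at which the amplitude and the phases are evaluated,
differs from `x` by `O(ρ)`, and by `O(ρ²)` in the coordinates `p_i`, `q_j` of the wave. -/
theorem exists_wave_symplectomorphism (hg : IsProfile C g g₁ g₂) (ha : ContDiff ℝ 2 a)
    (hac : HasCompactSupport a) {η : ℝ} (hη : 0 < η) (hη' : η ≤ 1)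
    (has : ∀ y, |a y| * (‖symplGrad N‖ * (4 * C ^ 2)) ≤ η / 4) {i j : Fin N} (hij : i ≠ j) :
    ∃ K ρ₀ : ℝ, 0 ≤ K ∧ 0 < ρ₀ ∧ ∀ ρ t t' : ℝ, 0 < ρ → ρ ≤ ρ₀ →
      ∃ (h : Phase N ≃ₘ^1⟮𝓘(ℝ, Phase N), 𝓘(ℝ, Phase N)⟯ Phase N) (y : Phase N → Phase N),
        IsSymplectomorphism h ∧ ∀ x,
        ‖y x - x‖ ≤ K * ρ ∧ |y x (Sum.inl i) - x (Sum.inl i)| ≤ K * ρ ^ 2 ∧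
        y x (Sum.inr j) = x (Sum.inr j) ∧ ‖h x - x‖ ≤ K * ρ ∧ (x ∉ tsupport a → h x = x) ∧
        (∀ v, ‖fderiv ℝ h x v - v‖ ≤ η * ‖v‖) ∧
        ((∀ᶠ z in 𝓝 (y x), a z = a (y x)) →
          h x (Sum.inl i) = x (Sum.inl i) ∧ h x (Sum.inr j) = x (Sum.inr j) ∧
          ∀ v : Phase N, v (Sum.inr j) = 0 → ∃ d : ℝ, fderiv ℝ h x v = v
            - (a (y x) * g₁ (x (Sum.inl i) / ρ + t) * g₁ (x (Sum.inr j) / ρ + t')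
              * v (Sum.inl i)) • pVec j + d • qVec i) ∧
        (g₁ (y x (Sum.inl i) / ρ + t) = 1 → g₂ (y x (Sum.inl i) / ρ + t) = 0 →
          g₁ (y x (Sum.inr j) / ρ + t') = 1 → g₂ (y x (Sum.inr j) / ρ + t') = 0 →
          ∀ v : Phase N, ‖fderiv ℝ h x v - (v - (a (y x) * v (Sum.inl i)) • pVec j
            + (a (y x) * v (Sum.inr j)) • qVec i)‖ ≤ K * ρ * ‖v‖) := by
  obtain ⟨K, hK0, haK, hbound⟩ := exists_waveFun_bound hg ha hac hij
  have hρ₀ : 0 < min 1 (η / (4 * (K + 1))) := by positivity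
  refine ⟨K + 2 * (1 + K) * K, min 1 (η / (4 * (K + 1))), by positivity, hρ₀,
    fun ρ t t' hρ hρ' => ?_⟩
  have hρ1 : ρ ≤ 1 := hρ'.trans (min_le_left _ _)
  have hρK : K * ρ ≤ η / 4 := by
    have h1 : ρ ≤ η / (4 * (K + 1)) := hρ'.trans (min_le_right _ _)
    rw [le_div_iff₀ (by positivity)] at h1
    nlinarith
  have hFc : ContDiff ℝ 2 (waveFun g a i j ρ t t') := contDiff_waveFun hg ha
  have hXn := fun y => (hbound ρ t t' hρ hρ1 y).1
  have hXi := fun y => (hbound ρ t t' hρ hρ1 y).2.1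
  have happrox := fun y => (hbound ρ t t' hρ hρ1 y).2.2
  have hshear : ∀ y v, ‖a y • waveShear g g₁ g₂ i j ρ t t' y v‖ ≤ η / 4 * ‖v‖ := fun y v => by
    rw [norm_smul, Real.norm_eq_abs]
    calc _ ≤ |a y| * (‖symplGrad N‖ * (4 * C ^ 2) * ‖v‖) :=
          mul_le_mul_of_nonneg_left (norm_waveShear_le hg i j ρ t t' y v) (abs_nonneg _)
      _ = |a y| * (‖symplGrad N‖ * (4 * C ^ 2)) * ‖v‖ := by rw [mul_assoc |a y|]
      _ ≤ _ := mul_le_mul_of_nonneg_right (has y) (norm_nonneg _)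
  have hX0 : ∀ x, x ∉ tsupport a → hamField (waveFun g a i j ρ t t') x = 0 := fun x hx => by
    have hd : fderiv ℝ a x = 0 := by
      have : x ∉ tsupport (fderiv ℝ a) := fun hx' => hx (tsupport_fderiv_subset ℝ hx')
      exact image_eq_zero_of_notMem_tsupport this
    rw [hamField_waveFun hg ha hρ.ne', image_eq_zero_of_notMem_tsupport hx, hd]; simp
  have hlocal := fun y => hamField_waveFun_of_eventually_const (t := t) (t' := t') (y := y)
    (i := i) (j := j) hg ha hρ.ne'
  set X := hamField (waveFun g a i j ρ t t') with hX
  have hDXn : ∀ y v, ‖fderiv ℝ X y v‖ ≤ η / 2 * ‖v‖ := fun y v => by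
    calc _ = ‖(fderiv ℝ X y v - a y • waveShear g g₁ g₂ i j ρ t t' y v)
          + a y • waveShear g g₁ g₂ i j ρ t t' y v‖ := by rw [sub_add_cancel]
      _ ≤ K * ρ * ‖v‖ + η / 4 * ‖v‖ :=
          (norm_add_le _ _).trans (add_le_add (happrox y v) (hshear y v))
      _ ≤ η / 4 * ‖v‖ + η / 4 * ‖v‖ := by gcongr
      _ = _ := by ring
  obtain ⟨h, y, hsymp, hprop⟩ := exists_symplectomorphism_of_generating hFc (fun y =>
    ContinuousLinearMap.opNorm_le_bound _ (by norm_num) fun v =>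
      (hDXn y v).trans (by gcongr))
  have hKle : K ≤ K + 2 * (1 + K) * K := by linarith [show 0 ≤ 2 * (1 + K) * K by positivity]
  refine ⟨h, y, hsymp, fun x => ?_⟩
  obtain ⟨hy, hhx, h0, hD⟩ := hprop x
  rw [← hX] at hy hhx h0
  simp only [← hX] at hD
  -- the solution `w` of the implicit linear equation is at most twice as long as `v`
  have hwn : ∀ v w, w = v + pProj N (fderiv ℝ X (y x) w) → ‖w‖ ≤ 2 * ‖v‖ := by
    intro v w hw
    have h1 : ‖w‖ ≤ ‖v‖ + η / 2 * ‖w‖ := by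
      calc ‖w‖ = ‖v + pProj N (fderiv ℝ X (y x) w)‖ := by rw [← hw]
        _ ≤ _ := (norm_add_le _ _).trans (add_le_add le_rfl
            ((norm_pProj_apply_le _).trans (hDXn _ _)))
    nlinarith [norm_nonneg w]
  refine ⟨?_, ?_, by rw [hy]; simp, ?_, fun hx => h0 (hX0 x hx), fun v => ?_, fun hconst => ?_,
    fun e1 e2 e3 e4 v => ?_⟩
  · have : y x - x = pProj N (X (y x)) := by nth_rw 1 [hy]; abel
    rw [this]
    exact (norm_pProj_apply_le _).trans ((hXn _).trans (by gcongr))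
  · have : y x (Sum.inl i) - x (Sum.inl i) = X (y x) (Sum.inl i) := by
      nth_rw 1 [hy]; simp
    rw [this]
    exact (hXi _).trans (by gcongr)
  · rw [hhx, add_sub_cancel_left]
    exact (hXn _).trans (by gcongr)
  · obtain ⟨w, hw, hDw⟩ := hD v
    rw [hDw, add_sub_cancel_left]
    calc _ ≤ η / 2 * ‖w‖ := hDXn _ _
      _ ≤ η / 2 * (2 * ‖v‖) := by gcongr; exact hwn v w hw
      _ = _ := by ring
  · obtain ⟨⟨c, d, hXe⟩, hDXe⟩ := hlocal (y x) hconst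
    have hyi : y x (Sum.inl i) = x (Sum.inl i) := by
      rw [hy, hXe]; simp [pVec, qVec, hij]
    have hyj : y x (Sum.inr j) = x (Sum.inr j) := by
      rw [hy]; simp
    refine ⟨?_, ?_, fun v hv => ?_⟩
    · rw [hhx, hXe]; simp [pVec, qVec, hij]
    · rw [hhx, hXe]; simp [pVec, qVec, hij.symm]
    · obtain ⟨w, hw, hDw⟩ := hD v
      have hwj : w (Sum.inr j) = 0 := by rw [hw]; simp [hv]
      have hwi : w (Sum.inl i) = v (Sum.inl i) := by
        rw [hw, hDXe]; simp [waveShear, pVec, qVec, hij]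
      refine ⟨a (y x) * (g₂ (x (Sum.inl i) / ρ + t) * g (x (Sum.inr j) / ρ + t')
        * v (Sum.inl i)), ?_⟩
      rw [hDw, hDXe, waveShear, hwj, hwi, hyi, hyj]
      module
  · obtain ⟨w, hw, hDw⟩ := hD v
    have hwle := hwn v w hw
    set R := fderiv ℝ X (y x) w - a (y x) • waveShear g g₁ g₂ i j ρ t t' (y x) w with hR
    have hRn : ‖R‖ ≤ K * ρ * (2 * ‖v‖) := (happrox (y x) w).trans (by gcongr)
    have hBw : fderiv ℝ X (y x) w =
        R + a (y x) • (w (Sum.inr j) • qVec i - w (Sum.inl i) • pVec j) := by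
      rw [hR, waveShear, e1, e2, e3, e4]; module
    have hwj : w (Sum.inr j) = v (Sum.inr j) := by rw [hw]; simp
    have hwi : w (Sum.inl i) = v (Sum.inl i) + R (Sum.inl i) := by
      rw [hw, hBw]; simp [pVec, qVec, hij]
    have hfin : fderiv ℝ h x v - (v - (a (y x) * v (Sum.inl i)) • pVec j
        + (a (y x) * v (Sum.inr j)) • qVec i) = R - (a (y x) * R (Sum.inl i)) • pVec j := by
      rw [hDw, hBw, hwj, hwi]; module
    have hpn : ‖(pVec j : Phase N)‖ = 1 := by simp [pVec]
    rw [hfin]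
    calc _ ≤ ‖R‖ + K * ‖R‖ * 1 := by
          refine (norm_sub_le _ _).trans ?_
          rw [norm_smul, hpn, norm_mul]
          gcongr
          · exact haK _
          · exact PiLp.norm_apply_le R _
      _ = (1 + K) * ‖R‖ := by ring
      _ ≤ (1 + K) * (K * ρ * (2 * ‖v‖)) := by gcongr
      _ = 2 * (1 + K) * K * ρ * ‖v‖ := by ring
      _ ≤ _ := by gcongr; linarith

/-! ### The random walk of directions -/

/-- The composition `A (i-1) ∘ ⋯ ∘ A 0` of linear isomorphisms. -/
def linSeq (A : ℕ → Phase N ≃L[ℝ] Phase N) : ℕ → (Phase N ≃L[ℝ] Phase N)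
  | 0 => ContinuousLinearEquiv.refl ℝ _
  | i + 1 => (linSeq A i).trans (A i)

theorem compSeq_eq_linSeq (A : ℕ → Phase N ≃L[ℝ] Phase N) (i : ℕ) :
    compSeq (fun j => ⇑(A j)) i = linSeq A i := by
  induction i with
  | zero => rfl
  | succ i ih => rw [compSeq, ih]; rfl

theorem compSeq_congr {α : Type*} {f g : ℕ → α → α} {n : ℕ} (h : ∀ i < n, f i = g i) :
    ∀ i ≤ n, compSeq f i = compSeq g i := by
  intro i
  induction i with
  | zero => intro _; rfl
  | succ i ih => intro hi; rw [compSeq, compSeq, ih (by omega), h i (by omega)]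

theorem differentiable_compSeq {f : ℕ → Phase N → Phase N} (hf : ∀ i, Differentiable ℝ (f i))
    (i : ℕ) : Differentiable ℝ (compSeq f i) := by
  induction i with
  | zero => exact differentiable_id
  | succ i ih => exact (hf i).comp ih

theorem stdForm_qVec (v : Phase N) (i : Fin N) : stdForm v (qVec i) = v (Sum.inl i) := by
  simp [stdForm, qVec]

theorem stdForm_pVec (v : Phase N) (i : Fin N) : stdForm v (pVec i) = -v (Sum.inr i) := by
  simp [stdForm, pVec]

theorem stdForm_smul_left (c : ℝ) (v w : Phase N) : stdForm (c • v) w = c * stdForm v w := by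
  simp only [stdForm, Finset.mul_sum]
  exact Finset.sum_congr rfl fun i _ => by simp; ring

theorem stdForm_smul_right (c : ℝ) (v w : Phase N) : stdForm v (c • w) = c * stdForm v w := by
  rw [stdForm_swap, stdForm_smul_left, stdForm_swap w]; ring

/-- A symplectic isomorphism acting on the `p_i p_j`-plane as multiplication by `c > 0` and on the
`q_i q_j`-plane as multiplication by `c⁻¹`. -/
structure IsSqueeze (A : Phase N ≃L[ℝ] Phase N) (i j : Fin N) (c : ℝ) : Prop where
  symplectic : ∀ v w, stdForm (A v) (A w) = stdForm v w
  pos : 0 < c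
  map_p : A (pVec i) = c • pVec i
  map_p' : A (pVec j) = c • pVec j
  map_q : A (qVec i) = c⁻¹ • qVec i
  map_q' : A (qVec j) = c⁻¹ • qVec j

theorem isSqueeze_refl (i j : Fin N) : IsSqueeze (ContinuousLinearEquiv.refl ℝ (Phase N)) i j 1 where
  symplectic := fun _ _ => rfl
  pos := one_pos
  map_p := by simp
  map_p' := by simp
  map_q := by simp
  map_q' := by simp

theorem IsSqueeze.trans {A B : Phase N ≃L[ℝ] Phase N} {i j : Fin N} {c d : ℝ}
    (hA : IsSqueeze A i j c) (hB : IsSqueeze B i j d) : IsSqueeze (A.trans B) i j (c * d) where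
  symplectic := fun v w => (hB.symplectic _ _).trans (hA.symplectic _ _)
  pos := mul_pos hA.pos hB.pos
  map_p := by simp [hA.map_p, hB.map_p, smul_smul]
  map_p' := by simp [hA.map_p', hB.map_p', smul_smul]
  map_q := by simp [hA.map_q, hB.map_q, smul_smul, mul_comm]
  map_q' := by simp [hA.map_q', hB.map_q', smul_smul, mul_comm]

theorem IsSqueeze.swap {A : Phase N ≃L[ℝ] Phase N} {i j : Fin N} {c : ℝ}
    (h : IsSqueeze A i j c) : IsSqueeze A j i c :=
  ⟨h.symplectic, h.pos, h.map_p', h.map_p, h.map_q', h.map_q⟩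

theorem IsSqueeze.apply_inl {A : Phase N ≃L[ℝ] Phase N} {i j : Fin N} {c : ℝ}
    (h : IsSqueeze A i j c) (x : Phase N) : A x (Sum.inl i) = c * x (Sum.inl i) := by
  have h1 := h.symplectic x (qVec i)
  rw [h.map_q, stdForm_smul_right, stdForm_qVec, stdForm_qVec] at h1
  rw [← h1, mul_inv_cancel_left₀ h.pos.ne']

theorem IsSqueeze.apply_inr {A : Phase N ≃L[ℝ] Phase N} {i j : Fin N} {c : ℝ}
    (h : IsSqueeze A i j c) (x : Phase N) : A x (Sum.inr i) = c⁻¹ * x (Sum.inr i) := by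
  have h1 := h.symplectic x (pVec i)
  rw [h.map_p, stdForm_smul_right, stdForm_pVec, stdForm_pVec] at h1
  have h2 : c * A x (Sum.inr i) = x (Sum.inr i) := by linarith
  rw [← h2, inv_mul_cancel_left₀ h.pos.ne']

theorem isSqueeze_linSeq {A : ℕ → Phase N ≃L[ℝ] Phase N} {i j : Fin N} {c : ℕ → ℝ} {r : ℕ}
    (h : ∀ k < r, IsSqueeze (A k) i j (c k)) :
    ∀ k ≤ r, IsSqueeze (linSeq A k) i j (∏ l ∈ Finset.range k, c l) := by
  intro k
  induction k with
  | zero => intro _; simpa [linSeq] using isSqueeze_refl i j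
  | succ k ih =>
    intro hk
    rw [Finset.prod_range_succ]
    exact (ih (by omega)).trans (h k (by omega))

theorem exists_norm_linSeq_le (A : ℕ → Phase N ≃L[ℝ] Phase N) (n : ℕ) :
    ∃ D : ℝ, 1 ≤ D ∧ ∀ k ≤ n, (∀ v, ‖linSeq A k v‖ ≤ D * ‖v‖) ∧
      ∀ v, ‖(linSeq A k).symm v‖ ≤ D * ‖v‖ := by
  have hs : ∀ k ∈ Finset.range (n + 1), 0 ≤ ‖(linSeq A k : Phase N →L[ℝ] Phase N)‖ +
      ‖((linSeq A k).symm : Phase N →L[ℝ] Phase N)‖ := fun _ _ => by positivity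
  refine ⟨1 + ∑ k ∈ Finset.range (n + 1), (‖(linSeq A k : Phase N →L[ℝ] Phase N)‖ +
    ‖((linSeq A k).symm : Phase N →L[ℝ] Phase N)‖), by
      linarith [Finset.sum_nonneg hs], fun k hk => ?_⟩
  have h1 := Finset.single_le_sum hs (Finset.mem_range.2 (Nat.lt_succ_of_le hk))
  have h2 := norm_nonneg (linSeq A k : Phase N →L[ℝ] Phase N)
  have h3 := norm_nonneg ((linSeq A k).symm : Phase N →L[ℝ] Phase N)
  exact ⟨fun v => ContinuousLinearMap.le_of_opNorm_le (linSeq A k : Phase N →L[ℝ] Phase N)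
      (by linarith) v,
    fun v => ContinuousLinearMap.le_of_opNorm_le ((linSeq A k).symm : Phase N →L[ℝ] Phase N)
      (by linarith) v⟩

/-- The sum of the first `k` slopes met by a point `x` whose coordinates `p_i`, `q_j` are
multiplied by `C l`, `(C l)⁻¹` up to time `l`. -/
def walk (s ρ : ℝ) (t t' C : ℕ → ℝ) (i j : Fin N) (k : ℕ) (x : Phase N) : ℝ :=
  ∑ l ∈ Finset.range k, s * Real.cos (C l * x (Sum.inl i) / ρ + t l)
    * Real.cos ((C l)⁻¹ * x (Sum.inr j) / ρ + t' l)

theorem contDiff_walk {s ρ : ℝ} {t t' C : ℕ → ℝ} {i j : Fin N} {k : ℕ} {n : WithTop ℕ∞} :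
    ContDiff ℝ n (walk (N := N) s ρ t t' C i j k) := by
  have hp : ∀ m : Fin N ⊕ Fin N, ContDiff ℝ n fun x : Phase N => x m := fun m =>
    (EuclideanSpace.proj (𝕜 := ℝ) m).contDiff
  refine ContDiff.sum fun l _ => ?_
  refine (contDiff_const.mul (Real.contDiff_cos.comp ?_)).mul (Real.contDiff_cos.comp ?_)
  · exact ((contDiff_const.mul (hp _)).div_const _).add contDiff_const
  · exact ((contDiff_const.mul (hp _)).div_const _).add contDiff_const

theorem abs_walk_le {s : ℝ} (hs : 0 ≤ s) (ρ : ℝ) (t t' C : ℕ → ℝ) (i j : Fin N) (k : ℕ)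
    (x : Phase N) : |walk s ρ t t' C i j k x| ≤ k * s := by
  refine (Finset.abs_sum_le_sum_abs _ _).trans ?_
  calc _ ≤ ∑ _l ∈ Finset.range k, s := Finset.sum_le_sum fun l _ => by
        rw [abs_mul, abs_mul, abs_of_nonneg hs]
        calc _ ≤ s * 1 * 1 := by
              gcongr
              · exact Real.abs_cos_le_one _
              · exact Real.abs_cos_le_one _
          _ = s := by ring
    _ = k * s := by simp

theorem tsupport_subset_image_closedBall (L : Phase N ≃L[ℝ] Phase N) {R : ℝ} {a : Phase N → ℝ}
    (h : ∀ y, R < ‖L.symm y‖ → a y = 0) : tsupport a ⊆ L '' Metric.closedBall 0 R := by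
  have hc : IsCompact (L '' Metric.closedBall (0 : Phase N) R) :=
    (isCompact_closedBall _ _).image L.continuous
  refine closure_minimal (fun y hy => ?_) hc.isClosed
  refine ⟨L.symm y, ?_, L.apply_symm_apply y⟩
  rw [mem_closedBall_zero_iff]
  by_contra hn
  exact hy (h y (not_le.1 hn))

theorem hasCompactSupport_of_symm (L : Phase N ≃L[ℝ] Phase N) {R : ℝ} {a : Phase N → ℝ}
    (h : ∀ y, R < ‖L.symm y‖ → a y = 0) : HasCompactSupport a :=
  ((isCompact_closedBall _ _).image L.continuous).of_isClosed_subset (isClosed_tsupport a)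
    (tsupport_subset_image_closedBall L h)

/-- One step of the walk: a `C¹`-small symplectic map supported in `L '' ball 0 1` which on the
smaller set `L '' ball 0 R₁` is a shear whose slope oscillates with wave length `ρ`. -/
theorem exists_walk_step (L : Phase N ≃L[ℝ] Phase N) {R₀ R₁ : ℝ} (hR : 0 < R₀) (hR₁ : R₀ < R₁)
    (hR₂ : R₁ < 1) {η s : ℝ} (hη : 0 < η) (hη' : η ≤ 1) (hs : 0 ≤ s)
    (hsη : s * (‖symplGrad N‖ * 4) ≤ η / 4) {i j : Fin N} (hij : i ≠ j) :
    ∃ K ρ₀ : ℝ, 0 ≤ K ∧ 0 < ρ₀ ∧ ∀ ρ t t' : ℝ, 0 < ρ → ρ ≤ ρ₀ →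
      ∃ h : Phase N ≃ₘ^1⟮𝓘(ℝ, Phase N), 𝓘(ℝ, Phase N)⟯ Phase N,
        IsSymplectomorphism h ∧ (∀ x, x ∉ L '' Metric.ball 0 1 → h x = x) ∧
        (∀ x v, ‖fderiv ℝ h x v - v‖ ≤ η * ‖v‖) ∧ (∀ x, ‖h x - x‖ ≤ K * ρ) ∧
        ∀ x, (∀ y, ‖y - x‖ ≤ K * ρ → L.symm y ∈ Metric.ball 0 R₁) →
          h x (Sum.inl i) = x (Sum.inl i) ∧ h x (Sum.inr j) = x (Sum.inr j) ∧
          ∀ v : Phase N, v (Sum.inr j) = 0 → ∃ d : ℝ, fderiv ℝ h x v = v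
            - (s * Real.cos (x (Sum.inl i) / ρ + t) * Real.cos (x (Sum.inr j) / ρ + t')
              * v (Sum.inl i)) • pVec j + d • qVec i := by
  let χ : ContDiffBump (0 : Phase N) := ⟨R₁, (R₁ + 1) / 2, by linarith, by linarith⟩
  set a : Phase N → ℝ := fun y => s * χ (L.symm y) with ha
  have hac : ContDiff ℝ 2 a := contDiff_const.mul (χ.contDiff.comp L.symm.contDiff)
  have ha0 : ∀ y, (R₁ + 1) / 2 < ‖L.symm y‖ → a y = 0 := fun y hy => by
    have : χ (L.symm y) = 0 := χ.zero_of_le_dist (by rw [dist_zero_right]; exact hy.le)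
    rw [ha]; simp only [this, mul_zero]
  have hsupp : HasCompactSupport a := hasCompactSupport_of_symm L ha0
  have hts : ∀ x, x ∈ tsupport a → x ∈ L '' Metric.ball 0 1 := fun x hx =>
    Set.image_mono (Metric.closedBall_subset_ball (by linarith))
      (tsupport_subset_image_closedBall L ha0 hx)
  have hbd : ∀ y, |a y| * (‖symplGrad N‖ * (4 * 1 ^ 2)) ≤ η / 4 := by
    intro y
    refine le_trans ?_ hsη
    have h1 : |a y| ≤ s := by
      rw [ha, abs_mul, abs_of_nonneg hs, abs_of_nonneg χ.nonneg]
      exact mul_le_of_le_one_right hs χ.le_one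
    have h2 : 0 ≤ ‖symplGrad N‖ := (symplGrad N).opNorm_nonneg
    rw [one_pow, mul_one]
    exact mul_le_mul_of_nonneg_right h1 (by positivity)
  obtain ⟨K, ρ₀, hK, hρ₀, hex⟩ :=
    exists_wave_symplectomorphism isProfile_sin hac hsupp hη hη' hbd hij
  refine ⟨K, ρ₀, hK, hρ₀, fun ρ t t' hρ hρ' => ?_⟩
  obtain ⟨h, y, hsymp, hh⟩ := hex ρ t t' hρ hρ'
  refine ⟨h, hsymp, fun x hx => (hh x).2.2.2.2.1 fun hx' => hx (hts x hx'),
    fun x => (hh x).2.2.2.2.2.1, fun x => (hh x).2.2.2.1, fun x hx => ?_⟩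
  have hyx := hx (y x) (hh x).1
  have hone : ∀ z, L.symm z ∈ Metric.ball (0 : Phase N) R₁ → a z = s := by
    intro z hz
    have : χ (L.symm z) = 1 := χ.one_of_mem_closedBall (Metric.ball_subset_closedBall hz)
    simp [ha, this]
  have hev : ∀ᶠ z in 𝓝 (y x), a z = a (y x) := by
    have : ∀ᶠ z in 𝓝 (y x), L.symm z ∈ Metric.ball (0 : Phase N) R₁ :=
      L.symm.continuous.continuousAt.eventually (Metric.isOpen_ball.mem_nhds hyx)
    filter_upwards [this] with z hz
    rw [hone z hz, hone _ hyx]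
  have h3 := (hh x).2.2.2.2.2.2.1 hev
  rw [hone _ hyx] at h3
  exact h3

/-- The walk of directions: composing `A i` with small oscillating shears, the image of the vector
`∂/∂p_i` at a point `x` acquires a component along `∂/∂p_j` whose relative size is the sum of the
slopes met, while the coordinates of `x` which determine these slopes are transported exactly. -/
theorem exists_walk_perturbation (A : ℕ → Phase N ≃L[ℝ] Phase N) {i j : Fin N} (hij : i ≠ j)
    {c : ℕ → ℝ} {r : ℕ} (hA : ∀ k < r, IsSqueeze (A k) i j (c k))
    {R₀ R₁ : ℝ} (hR : 0 < R₀) (hR₁ : R₀ < R₁) (hR₂ : R₁ < 1)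
    {η s : ℝ} (hη : 0 < η) (hη' : η ≤ 1) (hs : 0 ≤ s)
    (hsη : s * (‖symplGrad N‖ * 4) ≤ η / 4) :
    ∃ ρ : ℝ, 0 < ρ ∧ ∀ t t' : ℕ → ℝ,
      ∃ h : ℕ → (Phase N ≃ₘ^1⟮𝓘(ℝ, Phase N), 𝓘(ℝ, Phase N)⟯ Phase N),
        (∀ k, IsSymplectomorphism (h k)) ∧
        (∀ k x, x ∉ linSeq A k '' Metric.ball 0 1 → h k x = x) ∧
        (∀ k x v, ‖fderiv ℝ (h k) x v - v‖ ≤ η * ‖v‖) ∧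
        ∀ x ∈ Metric.ball (0 : Phase N) R₀, ∀ k ≤ r,
          (linSeq A k).symm (compSeq (fun l y => A l (h l y)) k x) ∈ Metric.ball 0 R₁ ∧
          compSeq (fun l y => A l (h l y)) k x (Sum.inl i) =
            (∏ l ∈ Finset.range k, c l) * x (Sum.inl i) ∧
          compSeq (fun l y => A l (h l y)) k x (Sum.inr j) =
            (∏ l ∈ Finset.range k, c l)⁻¹ * x (Sum.inr j) ∧
          ∃ d : ℝ, fderiv ℝ (compSeq (fun l y => A l (h l y)) k) x (pVec i) =
            (∏ l ∈ Finset.range k, c l) • (pVec i -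
              walk s ρ t t' (fun m => ∏ l ∈ Finset.range m, c l) i j k x • pVec j) +
              d • qVec i := by
  choose K ρ₀ hK hρ₀ hstep using fun k =>
    exists_walk_step (linSeq A k) hR hR₁ hR₂ hη hη' hs hsη hij
  obtain ⟨D, hD1, hD⟩ := exists_norm_linSeq_le A r
  set Kt : ℝ := ∑ k ∈ Finset.range r, K k with hKt
  have hKle : ∀ k < r, K k ≤ Kt := fun k hk =>
    Finset.single_le_sum (fun k _ => hK k) (Finset.mem_range.2 hk)
  have hKt0 : 0 ≤ Kt := Finset.sum_nonneg fun k _ => hK k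
  obtain ⟨ρ, hρ, hρle, hρsmall⟩ : ∃ ρ : ℝ, 0 < ρ ∧ (∀ k ∈ Finset.range r, ρ ≤ ρ₀ k) ∧
      (r + 1) * D * Kt * ρ < R₁ - R₀ := by
    have h1 : ∀ᶠ ρ in 𝓝[>] (0 : ℝ), ∀ k ∈ Finset.range r, ρ ≤ ρ₀ k := by
      rw [Finset.eventually_all]
      intro k _
      filter_upwards [nhdsWithin_le_nhds (eventually_lt_nhds (hρ₀ k))] with ρ hρ using hρ.le
    have h2 : ∀ᶠ ρ in 𝓝[>] (0 : ℝ), (r + 1) * D * Kt * ρ < R₁ - R₀ := by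
      have : Tendsto (fun ρ : ℝ => (r + 1) * D * Kt * ρ) (𝓝 0) (𝓝 ((r + 1) * D * Kt * 0)) :=
        tendsto_id.const_mul _
      rw [mul_zero] at this
      exact nhdsWithin_le_nhds (this.eventually_lt_const (by linarith))
    obtain ⟨ρ, ⟨h1, h2⟩, h3⟩ := ((h1.and h2).and self_mem_nhdsWithin).exists
    exact ⟨ρ, h3, h1, h2⟩
  refine ⟨ρ, hρ, fun t t' => ?_⟩
  have hex : ∀ k, ∃ h : Phase N ≃ₘ^1⟮𝓘(ℝ, Phase N), 𝓘(ℝ, Phase N)⟯ Phase N,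
        IsSymplectomorphism h ∧ (∀ x, x ∉ linSeq A k '' Metric.ball 0 1 → h x = x) ∧
        (∀ x v, ‖fderiv ℝ h x v - v‖ ≤ η * ‖v‖) ∧ (k < r → (∀ x, ‖h x - x‖ ≤ K k * ρ) ∧
        ∀ x, (∀ y, ‖y - x‖ ≤ K k * ρ → (linSeq A k).symm y ∈ Metric.ball 0 R₁) →
          h x (Sum.inl i) = x (Sum.inl i) ∧ h x (Sum.inr j) = x (Sum.inr j) ∧
          ∀ v : Phase N, v (Sum.inr j) = 0 → ∃ d : ℝ, fderiv ℝ h x v = v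
            - (s * Real.cos (x (Sum.inl i) / ρ + t k) * Real.cos (x (Sum.inr j) / ρ + t' k)
              * v (Sum.inl i)) • pVec j + d • qVec i) := by
    intro k
    by_cases hk : k < r
    · obtain ⟨h, h1, h2, h3, h4⟩ := hstep k ρ (t k) (t' k) hρ (hρle k (Finset.mem_range.2 hk))
      exact ⟨h, h1, h2, h3, fun _ => h4⟩
    · refine ⟨Diffeomorph.refl _ _ _, ?_, fun _ _ => rfl, ?_, fun h => absurd h hk⟩
      · intro x v w
        simp
      · intro x v
        simp; positivity
  choose h hsymp hsupp hclose hloc using hex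
  refine ⟨h, hsymp, hsupp, hclose, fun x hx => ?_⟩
  set f : ℕ → Phase N → Phase N := fun l y => A l (h l y) with hf
  set P : ℕ → ℝ := fun k => ∏ l ∈ Finset.range k, c l with hP
  have hhd : ∀ k, Differentiable ℝ (h k) := fun k =>
    (h k).contMDiff.contDiff.differentiable (by norm_num)
  have hfd : ∀ k, Differentiable ℝ (f k) := fun k => (A k).differentiable.comp (hhd k)
  have hpos : ∀ k ≤ r, 0 < P k := fun k hk => (isSqueeze_linSeq hA k hk).pos
  -- in the coordinates pulled back to time `0`, each step moves the point by `D * Kt * ρ` at most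
  have hmain : ∀ k ≤ r,
      ‖(linSeq A k).symm (compSeq f k x) - x‖ ≤ k * (D * Kt * ρ) ∧
      compSeq f k x (Sum.inl i) = P k * x (Sum.inl i) ∧
      compSeq f k x (Sum.inr j) = (P k)⁻¹ * x (Sum.inr j) ∧
      ∃ d : ℝ, fderiv ℝ (compSeq f k) x (pVec i) =
        P k • (pVec i - walk s ρ t t' P i j k x • pVec j) + d • qVec i := by
    intro k
    induction k with
    | zero =>
      intro _
      refine ⟨by simp [linSeq, compSeq], by simp [compSeq, hP], by simp [compSeq, hP], 0, ?_⟩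
      simp [compSeq, hP, walk]
    | succ k ih =>
      intro hk
      have hkr : k < r := by omega
      obtain ⟨h1, h2, h3, d, h4⟩ := ih hkr.le
      obtain ⟨hm, hl⟩ := hloc k hkr
      set X := compSeq f k x with hX
      have hin : ∀ y, ‖y - X‖ ≤ K k * ρ → (linSeq A k).symm y ∈ Metric.ball 0 R₁ := by
        intro y hy
        rw [mem_ball_zero_iff] at hx ⊢
        have e : (linSeq A k).symm y = (linSeq A k).symm (y - X) +
            ((linSeq A k).symm X - x) + x := by rw [map_sub]; abel
        have e1 : ‖(linSeq A k).symm (y - X)‖ ≤ D * Kt * ρ := by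
          calc _ ≤ D * ‖y - X‖ := (hD k hkr.le).2 _
            _ ≤ D * (Kt * ρ) := by
              gcongr; exact hy.trans (by gcongr; exact hKle k hkr)
            _ = _ := by ring
        have e2 : (k + 1) * (D * Kt * ρ) ≤ (r + 1) * (D * Kt * ρ) := by
          have : (k : ℝ) ≤ r := by exact_mod_cast hkr.le
          gcongr
        rw [e]
        refine (norm_add₃_le).trans_lt ?_
        linarith
      obtain ⟨l1, l2, l3⟩ := hl X hin
      have hAk := hA k hkr
      have hPs : P (k + 1) = P k * c k := Finset.prod_range_succ _ _
      have hcs : compSeq f (k + 1) x = A k (h k X) := rfl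
      refine ⟨?_, ?_, ?_, ?_⟩
      · have e : (linSeq A (k + 1)).symm (compSeq f (k + 1) x) - x =
            (linSeq A k).symm (h k X - X) + ((linSeq A k).symm X - x) := by
          rw [hcs, map_sub]; simp [linSeq]
        have e1 : ‖(linSeq A k).symm (h k X - X)‖ ≤ D * Kt * ρ := by
          calc _ ≤ D * ‖h k X - X‖ := (hD k hkr.le).2 _
            _ ≤ D * (Kt * ρ) := by
              gcongr; exact (hm X).trans (by gcongr; exact hKle k hkr)
            _ = _ := by ring
        rw [e]
        refine (norm_add_le _ _).trans ?_
        push_cast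
        linarith
      · rw [hcs, hAk.apply_inl, l1, h2, hPs]; ring
      · rw [hcs, hAk.swap.apply_inr, l2, h3, hPs, mul_inv]; ring
      · have hder : fderiv ℝ (compSeq f (k + 1)) x (pVec i) =
            A k (fderiv ℝ (h k) X (fderiv ℝ (compSeq f k) x (pVec i))) := by
          have e1 : HasFDerivAt (compSeq f k) (fderiv ℝ (compSeq f k) x) x :=
            (differentiable_compSeq hfd k x).hasFDerivAt
          have e2 : HasFDerivAt (h k) (fderiv ℝ (h k) X) X := (hhd k X).hasFDerivAt
          have e3 := (A k).hasFDerivAt.comp x (e2.comp x e1)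
          exact congrArg (fun L => L (pVec i)) e3.fderiv
        obtain ⟨d', hd'⟩ := l3 (fderiv ℝ (compSeq f k) x (pVec i))
          (by rw [h4]; simp [pVec, qVec, hij.symm])
        have hv : (fderiv ℝ (compSeq f k) x (pVec i)) (Sum.inl i) = P k := by
          rw [h4]; simp [pVec, qVec, hij]
        have hw : walk s ρ t t' P i j (k + 1) x = walk s ρ t t' P i j k x +
            s * Real.cos (P k * x (Sum.inl i) / ρ + t k)
              * Real.cos ((P k)⁻¹ * x (Sum.inr j) / ρ + t' k) :=
          Finset.sum_range_succ _ _
        refine ⟨(c k)⁻¹ * (d + d'), ?_⟩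
        rw [hder, hd', hv, h4, h2, h3, hw, hPs]
        simp only [map_add, map_sub, map_smul, hAk.map_p, hAk.map_p', hAk.map_q]
        module
  intro k hk
  refine ⟨?_, (hmain k hk).2⟩
  rw [mem_ball_zero_iff] at hx ⊢
  have h1 := (hmain k hk).1
  have h2 : (k : ℝ) * (D * Kt * ρ) ≤ (r + 1) * (D * Kt * ρ) := by
    have : (k : ℝ) ≤ r := by exact_mod_cast hk
    gcongr
    linarith
  have e : (linSeq A k).symm (compSeq f k x) =
    ((linSeq A k).symm (compSeq f k x) - x) + x := by abel
  rw [e]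
  refine (norm_add_le _ _).trans_lt ?_
  linarith

/-! ### The final correction -/

/-- A smooth substitute for `1 / b`: it is bounded by `1 / c`, and on `|b| ≥ 2c` it approximates
`1 / b` as well as one likes when `k` is large. -/
def softInv (c : ℝ) (k : ℕ) (b : ℝ) : ℝ :=
  b * (b ^ 2) ^ k / ((b ^ 2) ^ (k + 1) + (c ^ 2) ^ (k + 1))

theorem contDiff_softInv {c : ℝ} (hc : 0 < c) (k : ℕ) {n : WithTop ℕ∞} :
    ContDiff ℝ n (softInv c k) := by
  refine ContDiff.div (contDiff_id.mul ((contDiff_id.pow 2).pow k))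
    (((contDiff_id.pow 2).pow (k + 1)).add contDiff_const) fun b => ?_
  have : 0 ≤ ((id b : ℝ) ^ 2) ^ (k + 1) := by positivity
  positivity

theorem abs_softInv_le {c : ℝ} (hc : 0 < c) (k : ℕ) (b : ℝ) : |softInv c k b| ≤ 1 / c := by
  have hden : 0 < (b ^ 2) ^ (k + 1) + (c ^ 2) ^ (k + 1) := by positivity
  rw [softInv, abs_div, abs_of_pos hden, div_le_div_iff₀ hden hc, one_mul, abs_mul,
    abs_of_nonneg (by positivity : 0 ≤ (b ^ 2) ^ k)]
  rcases le_total c |b| with h | h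
  · calc |b| * (b ^ 2) ^ k * c ≤ |b| * (b ^ 2) ^ k * |b| := by gcongr
      _ = (b ^ 2) ^ (k + 1) := by rw [pow_succ (b ^ 2) k, ← sq_abs b]; ring
      _ ≤ _ := le_add_of_nonneg_right (by positivity)
  · calc |b| * (b ^ 2) ^ k * c ≤ c * (c ^ 2) ^ k * c := by
          have : b ^ 2 ≤ c ^ 2 := by rw [← sq_abs]; gcongr
          gcongr
      _ = (c ^ 2) ^ (k + 1) := by rw [pow_succ (c ^ 2) k]; ring
      _ ≤ _ := le_add_of_nonneg_left (by positivity)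

theorem abs_one_sub_softInv_mul_le {c : ℝ} (hc : 0 < c) (k : ℕ) {b : ℝ} (hb : 2 * c ≤ |b|) :
    |1 - softInv c k b * b| ≤ (1 / 2) ^ k := by
  have hden : 0 < (b ^ 2) ^ (k + 1) + (c ^ 2) ^ (k + 1) := by positivity
  have h1 : 1 - softInv c k b * b =
      (c ^ 2) ^ (k + 1) / ((b ^ 2) ^ (k + 1) + (c ^ 2) ^ (k + 1)) := by
    rw [softInv, eq_div_iff hden.ne', sub_mul, mul_comm _ b, mul_div_assoc', div_mul_cancel₀ _ hden.ne',
      pow_succ (b ^ 2) k]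
    ring
  have h2 : 4 * c ^ 2 ≤ b ^ 2 := by
    rw [← sq_abs b]; nlinarith
  rw [h1, abs_of_nonneg (by positivity), div_le_iff₀ hden]
  calc (c ^ 2) ^ (k + 1) ≤ ((1 / 2) * b ^ 2) ^ (k + 1) := by
        gcongr; nlinarith
    _ = (1 / 2) ^ k * ((1 / 2) * (b ^ 2) ^ (k + 1)) := by rw [mul_pow, pow_succ (1 / 2 : ℝ)]; ring
    _ ≤ (1 / 2) ^ k * ((b ^ 2) ^ (k + 1) + (c ^ 2) ^ (k + 1)) := by
        gcongr
        have : 0 ≤ (b ^ 2) ^ (k + 1) := by positivity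
        have : 0 ≤ (c ^ 2) ^ (k + 1) := by positivity
        linarith

/-- A sawtooth wave with slowly varying amplitude `σ ∘ L⁻¹`. Away from the break points of the
sawtooth its slope is `σ` up to `O(ρ)`. -/
theorem exists_correction_step (L : Phase N ≃L[ℝ] Phase N) {R₁ : ℝ} (hR₁ : 0 < R₁) (hR₂ : R₁ < 1)
    {η s C : ℝ} {g g₁ g₂ : ℝ → ℝ} (hg : IsProfile C g g₁ g₂) {m : ℕ} (hm : 0 < m)
    (hsaw : ∀ x : ℝ, |x - round x| < 1 / 2 - 1 / (4 * m) → g₁ x = 1 ∧ g₂ x = 0)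
    (hη : 0 < η) (hη' : η ≤ 1) (hsη : s * (‖symplGrad N‖ * (4 * C ^ 2)) ≤ η / 4)
    {i j : Fin N} (hij : i ≠ j) {σ : Phase N → ℝ} (hσ : ContDiff ℝ 2 σ) (hσs : ∀ x, |σ x| ≤ s) :
    ∃ K ρ₀ : ℝ, 0 ≤ K ∧ 0 < ρ₀ ∧ ∀ ρ t t' : ℝ, 0 < ρ → ρ ≤ ρ₀ →
      ∃ h : Phase N ≃ₘ^1⟮𝓘(ℝ, Phase N), 𝓘(ℝ, Phase N)⟯ Phase N,
        IsSymplectomorphism h ∧ (∀ x, x ∉ L '' Metric.ball 0 1 → h x = x) ∧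
        (∀ x v, ‖fderiv ℝ h x v - v‖ ≤ η * ‖v‖) ∧
        ∀ x, L.symm x ∈ Metric.ball 0 R₁ →
          ¬ 1 / 2 - 1 / (2 * m) <
            |(x (Sum.inl i) / ρ + t) - round (x (Sum.inl i) / ρ + t)| →
          ¬ 1 / 2 - 1 / (2 * m) <
            |(x (Sum.inr j) / ρ + t') - round (x (Sum.inr j) / ρ + t')| →
          ∃ a : ℝ, |a - σ (L.symm x)| ≤ K * ρ ∧ ∀ v : Phase N,
            ‖fderiv ℝ h x v - (v - (a * v (Sum.inl i)) • pVec j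
              + (a * v (Sum.inr j)) • qVec i)‖ ≤ K * ρ * ‖v‖ := by
  have hm' : (0 : ℝ) < m := by exact_mod_cast hm
  let χ : ContDiffBump (0 : Phase N) := ⟨R₁, (R₁ + 1) / 2, by linarith, by linarith⟩
  set a : Phase N → ℝ := fun y => χ (L.symm y) * σ (L.symm y) with ha
  have hac : ContDiff ℝ 2 a :=
    (χ.contDiff.comp L.symm.contDiff).mul (hσ.comp L.symm.contDiff)
  have ha0 : ∀ y, (R₁ + 1) / 2 < ‖L.symm y‖ → a y = 0 := fun y hy => by
    have : χ (L.symm y) = 0 := χ.zero_of_le_dist (by rw [dist_zero_right]; exact hy.le)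
    rw [ha]; simp only [this, zero_mul]
  have hsupp : HasCompactSupport a := hasCompactSupport_of_symm L ha0
  have hts : ∀ x, x ∈ tsupport a → x ∈ L '' Metric.ball 0 1 := fun x hx =>
    Set.image_mono (Metric.closedBall_subset_ball (by linarith))
      (tsupport_subset_image_closedBall L ha0 hx)
  have hbd : ∀ y, |a y| * (‖symplGrad N‖ * (4 * C ^ 2)) ≤ η / 4 := by
    intro y
    refine le_trans ?_ hsη
    have h1 : |a y| ≤ s := by
      rw [ha, abs_mul, abs_of_nonneg χ.nonneg]
      calc _ ≤ 1 * s := by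
            gcongr
            · exact χ.le_one
            · exact hσs _
        _ = s := one_mul s
    have h2 : 0 ≤ ‖symplGrad N‖ := (symplGrad N).opNorm_nonneg
    exact mul_le_mul_of_nonneg_right h1 (by positivity)
  obtain ⟨K, ρ₀, hK, hρ₀, hex⟩ := exists_wave_symplectomorphism hg hac hsupp hη hη' hbd hij
  obtain ⟨Λ, hΛ⟩ := ContDiff.lipschitzWith_of_hasCompactSupport hsupp hac (by norm_num)
  have hmin : 0 < min ρ₀ (1 / (8 * m * (K + 1))) := by positivity
  refine ⟨K + Λ * K, min ρ₀ (1 / (8 * m * (K + 1))), by positivity, hmin,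
    fun ρ t t' hρ hρ' => ?_⟩
  obtain ⟨h, y, hsymp, hh⟩ := hex ρ t t' hρ (hρ'.trans (min_le_left _ _))
  refine ⟨h, hsymp, fun x hx => (hh x).2.2.2.2.1 fun hx' => hx (hts x hx'),
    fun x => (hh x).2.2.2.2.2.1, fun x hx hp hq => ?_⟩
  obtain ⟨h1, h2, h3, -, -, -, -, h4⟩ := hh x
  have hKρ : K * ρ ≤ 1 / (8 * m) := by
    have e1 : ρ ≤ 1 / (8 * m * (K + 1)) := hρ'.trans (min_le_right _ _)
    rw [le_div_iff₀ (by positivity)] at e1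
    rw [le_div_iff₀ (by positivity)]
    nlinarith [mul_pos (mul_pos (show (0 : ℝ) < 8 by norm_num) hm') hρ]
  have hlt : (1 : ℝ) / (8 * m) < 1 / (4 * m) := by
    apply one_div_lt_one_div_of_lt <;> linarith
  have hhalf : (1 : ℝ) / (2 * m) = 1 / (4 * m) + 1 / (4 * m) := by field_simp; norm_num
  have hq' : |(x (Sum.inr j) / ρ + t') - round (x (Sum.inr j) / ρ + t')| <
      1 / 2 - 1 / (4 * m) := by
    have : (0 : ℝ) < 1 / (4 * m) := by positivity
    linarith [not_lt.1 hq]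
  have hp' : |(y x (Sum.inl i) / ρ + t) - round (y x (Sum.inl i) / ρ + t)| <
      1 / 2 - 1 / (4 * m) := by
    have e1 := round_le (y x (Sum.inl i) / ρ + t) (round (x (Sum.inl i) / ρ + t))
    have e2 : |y x (Sum.inl i) / ρ - x (Sum.inl i) / ρ| ≤ K * ρ := by
      rw [← sub_div, abs_div, abs_of_pos hρ, div_le_iff₀ hρ]
      calc _ ≤ K * ρ ^ 2 := h2
        _ = _ := by ring
    have e3 : y x (Sum.inl i) / ρ + t - round (x (Sum.inl i) / ρ + t) =
      (y x (Sum.inl i) / ρ - x (Sum.inl i) / ρ) +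
        (x (Sum.inl i) / ρ + t - round (x (Sum.inl i) / ρ + t)) := by ring
    rw [e3] at e1
    have e4 := e1.trans (abs_add_le _ _)
    linarith [not_lt.1 hp]
  refine ⟨a (y x), ?_, fun v => ?_⟩
  · have hax : a x = σ (L.symm x) := by
      have : χ (L.symm x) = 1 := χ.one_of_mem_closedBall (Metric.ball_subset_closedBall hx)
      simp [ha, this]
    rw [← hax]
    have e1 := hΛ.dist_le_mul (y x) x
    rw [Real.dist_eq, dist_eq_norm] at e1
    calc _ ≤ Λ * ‖y x - x‖ := e1
      _ ≤ Λ * (K * ρ) := by gcongr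
      _ = Λ * K * ρ := by ring
      _ ≤ _ := by gcongr; linarith
  · refine (h4 (hsaw _ hp').1 (hsaw _ hp').2 ?_ ?_ v).trans ?_
    · rw [h3]; exact (hsaw _ hq').1
    · rw [h3]; exact (hsaw _ hq').2
    · have : 0 ≤ Λ * K := by positivity
      gcongr
      linarith

theorem exists_ball_measureReal_ge (κ : ℝ) (hκ : 0 < κ) :
    ∃ R : ℝ, 0 < R ∧ R < 1 ∧ (1 - κ) * volume.real (Metric.ball (0 : Phase N) 1) ≤
      volume.real (Metric.ball (0 : Phase N) R) := by
  have h1 : ∀ᶠ R in 𝓝[<] (1 : ℝ), 1 - κ < R ^ Module.finrank ℝ (Phase N) := by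
    have : Tendsto (fun R : ℝ => R ^ Module.finrank ℝ (Phase N)) (𝓝 1)
        (𝓝 (1 ^ Module.finrank ℝ (Phase N))) := (continuous_pow _).tendsto 1
    rw [one_pow] at this
    exact nhdsWithin_le_nhds (this.eventually_const_lt (by linarith))
  have h2 : ∀ᶠ R in 𝓝[<] (1 : ℝ), 0 < R :=
    nhdsWithin_le_nhds (eventually_gt_nhds one_pos)
  obtain ⟨R, ⟨h3, h4⟩, h5⟩ := ((h1.and h2).and self_mem_nhdsWithin).exists
  refine ⟨R, h4, h5, ?_⟩
  rw [Measure.real, Measure.real, Measure.addHaar_ball_of_pos volume (0 : Phase N) h4,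
    ENNReal.toReal_mul, ENNReal.toReal_ofReal (by positivity)]
  gcongr

theorem norm_fderiv_compSeq_le {A : ℕ → Phase N ≃L[ℝ] Phase N}
    {h : ℕ → (Phase N ≃ₘ^1⟮𝓘(ℝ, Phase N), 𝓘(ℝ, Phase N)⟯ Phase N)} {r : ℕ} {D : ℝ} (hD : 0 ≤ D)
    (hA : ∀ k < r, ∀ v, ‖A k v‖ ≤ D * ‖v‖) (hh : ∀ k x v, ‖fderiv ℝ (h k) x v - v‖ ≤ 1 * ‖v‖)
    (x v : Phase N) : ∀ k ≤ r,
      ‖fderiv ℝ (compSeq (fun l y => A l (h l y)) k) x v‖ ≤ (2 * D) ^ k * ‖v‖ := by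
  have hhd : ∀ k, Differentiable ℝ (h k) := fun k =>
    (h k).contMDiff.contDiff.differentiable (by norm_num)
  intro k
  induction k with
  | zero => intro _; simp [compSeq]
  | succ k ih =>
    intro hk
    set f : ℕ → Phase N → Phase N := fun l y => A l (h l y) with hf
    have hfd : ∀ k, Differentiable ℝ (f k) := fun k => (A k).differentiable.comp (hhd k)
    have e1 : HasFDerivAt (compSeq f k) (fderiv ℝ (compSeq f k) x) x :=
      (differentiable_compSeq hfd k x).hasFDerivAt
    have e2 : HasFDerivAt (h k) (fderiv ℝ (h k) (compSeq f k x)) (compSeq f k x) :=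
      (hhd k _).hasFDerivAt
    have hder : fderiv ℝ (compSeq f (k + 1)) x v =
        A k (fderiv ℝ (h k) (compSeq f k x) (fderiv ℝ (compSeq f k) x v)) :=
      congrArg (fun L => L v) ((A k).hasFDerivAt.comp x (e2.comp x e1)).fderiv
    rw [hder]
    set u := fderiv ℝ (compSeq f k) x v
    have h2 : ‖fderiv ℝ (h k) (compSeq f k x) u‖ ≤ 2 * ‖u‖ := by
      calc _ = ‖(fderiv ℝ (h k) (compSeq f k x) u - u) + u‖ := by rw [sub_add_cancel]
        _ ≤ 1 * ‖u‖ + ‖u‖ := (norm_add_le _ _).trans (add_le_add (hh _ _ _) le_rfl)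
        _ = _ := by ring
    calc _ ≤ D * (2 * ‖u‖) := (hA k (by omega) _).trans (by gcongr)
      _ ≤ D * (2 * ((2 * D) ^ k * ‖v‖)) := by gcongr; exact ih (by omega)
      _ = _ := by ring

theorem compSeq_eq_of_eventually_linear {A : ℕ → Phase N ≃L[ℝ] Phase N}
    {h : ℕ → Phase N → Phase N} {r n : ℕ} (hh : ∀ k, r < k → ∀ x, h k x = x) (hn : r < n)
    (x : Phase N) : compSeq (fun l y => A l (h l y)) n x =
      linSeq A n ((linSeq A r).symm (h r (compSeq (fun l y => A l (h l y)) r x))) := by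
  induction n, hn using Nat.le_induction with
  | base => simp [compSeq, linSeq]
  | succ n hn ih =>
    have : compSeq (fun l y => A l (h l y)) (n + 1) x =
      A n (h n (compSeq (fun l y => A l (h l y)) n x)) := rfl
    rw [this, hh n hn, ih]; rfl

/-! ### Flexibility of sequences of squeezes -/

theorem measurable_phase_dist {X : Type*} [MeasurableSpace X] {α : X → ℝ} (hα : Measurable α) :
    Measurable fun x => |α x - round (α x)| := by
  have hround : Measurable (round : ℝ → ℤ) := by
    have : (round : ℝ → ℤ) = fun x => ⌊x + 1 / 2⌋ := funext fun x => round_eq x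
    rw [this]; exact Int.measurable_floor.comp (measurable_id.add_const _)
  exact Measurable.abs
    (hα.sub ((measurable_from_top (f := fun n : ℤ => (n : ℝ))).comp (hround.comp hα)))

/-- A set of small measure fails each of three conditions, hence most of the ball of radius `R`
satisfies all of them. -/
theorem measureReal_good_ge {R κ : ℝ} (hR : R < 1) {B₁ B₂ B₃ : Set (Phase N)}
    (hRκ : (1 - κ) * volume.real (Metric.ball (0 : Phase N) 1) ≤
      volume.real (Metric.ball (0 : Phase N) R))
    (h₁ : (volume.restrict (Metric.ball (0 : Phase N) 1)).real B₁ ≤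
      κ * volume.real (Metric.ball (0 : Phase N) 1))
    (h₂ : (volume.restrict (Metric.ball (0 : Phase N) 1)).real B₂ ≤
      κ * volume.real (Metric.ball (0 : Phase N) 1))
    (h₃ : (volume.restrict (Metric.ball (0 : Phase N) 1)).real B₃ ≤
      κ * volume.real (Metric.ball (0 : Phase N) 1)) :
    (1 - 4 * κ) * volume.real (Metric.ball (0 : Phase N) 1) ≤
      volume.real (Metric.ball (0 : Phase N) R ∩ (B₁ᶜ ∩ (B₂ᶜ ∩ B₃ᶜ))) := by
  set U := Metric.ball (0 : Phase N) 1
  set V := Metric.ball (0 : Phase N) R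
  have hVU : V ⊆ U := Metric.ball_subset_ball hR.le
  have hU : volume U ≠ ⊤ := measure_ball_lt_top.ne
  rw [measureReal_restrict_apply' Metric.isOpen_ball.measurableSet] at h₁ h₂ h₃
  have hsub : V ⊆ (V ∩ (B₁ᶜ ∩ (B₂ᶜ ∩ B₃ᶜ))) ∪ ((B₁ ∩ U) ∪ ((B₂ ∩ U) ∪ (B₃ ∩ U))) := by
    intro x hx
    have := hVU hx
    by_cases b1 : x ∈ B₁ <;> by_cases b2 : x ∈ B₂ <;> by_cases b3 : x ∈ B₃ <;> simp_all
  have hfin : volume ((V ∩ (B₁ᶜ ∩ (B₂ᶜ ∩ B₃ᶜ))) ∪ ((B₁ ∩ U) ∪ ((B₂ ∩ U) ∪ (B₃ ∩ U)))) ≠ ⊤ := by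
    refine ne_top_of_le_ne_top hU (measure_mono ?_)
    rintro x (hx | hx | hx | hx)
    · exact hVU hx.1
    · exact hx.2
    · exact hx.2
    · exact hx.2
  have h4 := measureReal_mono (μ := volume) hsub hfin
  have h5 := measureReal_union_le (μ := volume) (V ∩ (B₁ᶜ ∩ (B₂ᶜ ∩ B₃ᶜ)))
    ((B₁ ∩ U) ∪ ((B₂ ∩ U) ∪ (B₃ ∩ U)))
  have h6 := measureReal_union_le (μ := volume) (B₁ ∩ U) ((B₂ ∩ U) ∪ (B₃ ∩ U))
  have h7 := measureReal_union_le (μ := volume) (B₂ ∩ U) (B₃ ∩ U)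
  linarith

set_option maxHeartbeats 1000000 in
/-- After sufficiently many squeezes, whatever linear maps come next, `C¹`-small symplectic
perturbations bring the image of `∂/∂p_i` arbitrarily close to the image of the span of `∂/∂p_j`,
`∂/∂q_i`, `∂/∂q_j`, at most of the points of the unit ball. -/
theorem exists_flexible_perturbation {i j : Fin N} (hij : i ≠ j) {η κ : ℝ} (hη : 0 < η)
    (hη' : η ≤ 1) (hκ : 0 < κ) :
    ∃ r : ℕ, ∀ (n : ℕ) (A : ℕ → Phase N ≃L[ℝ] Phase N) (c : ℕ → ℝ), r < n →
      (∀ k < r, IsSqueeze (A k) i j (c k)) → ∀ γ : ℝ, 0 < γ →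
      ∃ h : ℕ → (Phase N ≃ₘ^1⟮𝓘(ℝ, Phase N), 𝓘(ℝ, Phase N)⟯ Phase N),
        (∀ k, IsSymplectomorphism (h k)) ∧
        (∀ k x, x ∉ linSeq A k '' Metric.ball 0 1 → h k x = x) ∧
        (∀ k x v, ‖fderiv ℝ (h k) x v - v‖ ≤ η * ‖v‖) ∧
        ∃ G ⊆ Metric.ball (0 : Phase N) 1, MeasurableSet G ∧
          (1 - κ) * volume.real (Metric.ball (0 : Phase N) 1) < volume.real G ∧
          ∀ x ∈ G, ∃ w ∈ Submodule.span ℝ {pVec j, qVec i, qVec j}, w ≠ 0 ∧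
            ‖fderiv ℝ (compSeq (fun l y => A l (h l y)) n) x (pVec i) - linSeq A n w‖ ≤
              γ * ‖linSeq A n w‖ := by
  have hJ : 0 ≤ ‖symplGrad N‖ := (symplGrad N).opNorm_nonneg
  -- `1 / m` bounds the proportion of points which the breaks of the sawtooth spoil
  obtain ⟨m, hm⟩ := exists_nat_gt (max (8 / κ) 1)
  have hm1 : (1 : ℝ) < m := lt_of_le_of_lt (le_max_right _ _) hm
  have hm0 : 0 < m := by
    have : (0 : ℝ) < m := by linarith
    exact_mod_cast this
  have hmκ : 1 / (m : ℝ) ≤ κ / 8 := by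
    have : 8 / κ < m := lt_of_le_of_lt (le_max_left _ _) hm
    rw [div_lt_iff₀ hκ] at this
    rw [div_le_div_iff₀ (by linarith) (by norm_num)]
    linarith
  obtain ⟨C, g, g₁, g₂, hg, hsaw⟩ := exists_sawtooth (σ := 1 / (4 * m)) (by positivity) (by
    rw [div_lt_div_iff₀ (by positivity) (by norm_num)]; linarith)
  set s : ℝ := η / (16 * (‖symplGrad N‖ + 1)) with hs
  have hs0 : 0 < s := by positivity
  have hsη : s * (‖symplGrad N‖ * 4) ≤ η / 4 := by
    rw [hs, div_mul_eq_mul_div, div_le_div_iff₀ (by positivity) (by norm_num)]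
    nlinarith
  -- the walk has to reach slopes `2 * B`, whose inverses are small enough for the sawtooth
  set B : ℝ := 16 * (‖symplGrad N‖ * C ^ 2 + 1) / η with hB
  have hB0 : 0 < B := by positivity
  have hBη : 1 / B * (‖symplGrad N‖ * (4 * C ^ 2)) ≤ η / 4 := by
    have : 0 ≤ ‖symplGrad N‖ * C ^ 2 := by positivity
    rw [hB, one_div_div, div_mul_eq_mul_div, div_le_div_iff₀ (by positivity) (by norm_num)]
    nlinarith
  have : IsFiniteMeasure (volume.restrict (Metric.ball (0 : Phase N) 1)) :=
    isFiniteMeasure_restrict.2 measure_ball_lt_top.ne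
  obtain ⟨r, hr⟩ := exists_phases_escape (volume.restrict (Metric.ball (0 : Phase N) 1))
    (s := s) (B := 2 * B) (δ := κ / 8) hs0 (by positivity) (by positivity)
  refine ⟨r, fun n A c hrn hA γ hγ => ?_⟩
  obtain ⟨R₀, hR₀, hR₀1, hvol⟩ := exists_ball_measureReal_ge (N := N) (κ / 8) (by positivity)
  obtain ⟨R₁, hR₁, hR₁1⟩ := exists_between hR₀1
  have hcoord : ∀ l : Fin N ⊕ Fin N, Continuous fun x : Phase N => x l := fun l =>
    (EuclideanSpace.proj (𝕜 := ℝ) l).continuous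
  obtain ⟨ρ, hρ, hwalk⟩ := exists_walk_perturbation A hij hA hR₀ hR₁ hR₁1 hη hη' hs0.le hsη
  set P : ℕ → ℝ := fun k => ∏ l ∈ Finset.range k, c l with hP
  obtain ⟨t, t', htt⟩ := hr (fun l x => P l * x (Sum.inl i) / ρ)
    (fun l x => (P l)⁻¹ * x (Sum.inr j) / ρ)
    (fun l => (((hcoord _).const_mul _).div_const _).measurable)
    (fun l => (((hcoord _).const_mul _).div_const _).measurable)
  obtain ⟨h, hsymp, hsupp, hclose, hwalk⟩ := hwalk t t'
  have hsq := isSqueeze_linSeq hA r le_rfl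
  change IsSqueeze (linSeq A r) i j (P r) at hsq
  have hPr := hsq.pos
  set b : Phase N → ℝ := walk s ρ t t' P i j r with hb
  have hbc : ContDiff ℝ 2 b := contDiff_walk
  obtain ⟨D, hD1, hD⟩ := exists_norm_linSeq_le A n
  have hD0 : 0 < D := by linarith
  have hPD : P r ≤ D ∧ 1 / D ≤ P r := by
    have hpn : ‖(pVec i : Phase N)‖ = 1 := by simp [pVec]
    have h1 := (hD r hrn.le).1 (pVec i)
    have h2 := (hD r hrn.le).2 (linSeq A r (pVec i))
    rw [ContinuousLinearEquiv.symm_apply_apply] at h2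
    rw [hsq.map_p, norm_smul, hpn, mul_one, Real.norm_eq_abs, abs_of_pos hPr] at h1 h2
    refine ⟨by linarith, ?_⟩
    rw [div_le_iff₀ hD0]; linarith
  -- `θ` is the precision required at time `r` to have precision `γ` at time `n`
  set θ : ℝ := γ * B / D ^ 5 with hθ
  have hθ0 : 0 < θ := by positivity
  obtain ⟨k, hk⟩ := exists_pow_lt_of_lt_one (show 0 < θ / (2 * D) by positivity)
    (show (1 / 2 : ℝ) < 1 by norm_num)
  have hσc : ContDiff ℝ 2 fun x => -softInv B k (b x) := ((contDiff_softInv hB0 k).comp hbc).neg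
  obtain ⟨K, ρ₀, hK, hρ₀, hcorr⟩ := exists_correction_step (linSeq A r) (hR₀.trans hR₁) hR₁1 hg hm0
    hsaw hη hη' hBη hij.symm hσc (fun x => by rw [abs_neg]; exact abs_softInv_le hB0 k _)
  set V : ℝ := (2 * D ^ 2) ^ r with hV
  have hV0 : 0 < V := by positivity
  -- the wave length of the correction depends on everything chosen for the walk
  obtain ⟨ρ', hρ', hρ'0, hρ'θ⟩ : ∃ ρ' : ℝ, 0 < ρ' ∧ ρ' ≤ ρ₀ ∧
      (D * (r * s) + V) * K * ρ' ≤ θ / 2 := by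
    refine ⟨min ρ₀ (θ / (2 * ((D * (r * s) + V) * K + 1))), by positivity, min_le_left _ _, ?_⟩
    have h0 : 0 ≤ (D * (r * s) + V) * K := by positivity
    calc _ ≤ (D * (r * s) + V) * K * (θ / (2 * ((D * (r * s) + V) * K + 1))) := by
          gcongr; exact min_le_right _ _
      _ ≤ θ / 2 := by
          rw [mul_div_assoc', div_le_div_iff₀ (by positivity) (by norm_num)]
          nlinarith
  set f : ℕ → Phase N → Phase N := fun l y => A l (h l y) with hf
  have hhd : ∀ k, Differentiable ℝ (h k) := fun k =>
    (h k).contMDiff.contDiff.differentiable (by norm_num)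
  have hfd : ∀ k, Differentiable ℝ (f k) := fun k => (A k).differentiable.comp (hhd k)
  set Y : Phase N → Phase N := compSeq f r with hY
  have hYd : Differentiable ℝ Y := differentiable_compSeq hfd r
  have hYm : ∀ l, Measurable fun x => Y x l / ρ' := fun l =>
    (((hcoord l).comp hYd.continuous).div_const _).measurable
  obtain ⟨τ, τ', hτ, hτ'⟩ := exists_phases_good (volume.restrict (Metric.ball (0 : Phase N) 1))
    hm0 (hYm (Sum.inl j)) (hYm (Sum.inr i))
  obtain ⟨hr', hsymp', hsupp', hclose', hcorr⟩ := hcorr ρ' τ τ' hρ' hρ'0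
  set h' : ℕ → (Phase N ≃ₘ^1⟮𝓘(ℝ, Phase N), 𝓘(ℝ, Phase N)⟯ Phase N) := fun k =>
    if k < r then h k else if k = r then hr' else Diffeomorph.refl _ _ _ with hh'
  have hlt : ∀ k < r, h' k = h k := fun k hk => by simp [hh', hk]
  have heq : h' r = hr' := by simp [hh']
  have hgt : ∀ k, r < k → h' k = Diffeomorph.refl _ _ _ := fun k hk => by
    simp [hh', not_lt.2 hk.le, hk.ne']
  -- the good points: the walk has reached a large slope, and the position at time `r` is not near a
  -- break of either sawtooth
  refine ⟨h', ?_, ?_, ?_, Metric.ball 0 R₀ ∩ ({x | |b x| ≤ 2 * B}ᶜ ∩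
    ({x | 1 / 2 - 1 / (2 * (m : ℝ)) < |(Y x (Sum.inl j) / ρ' + τ) -
      round (Y x (Sum.inl j) / ρ' + τ)|}ᶜ ∩
    {x | 1 / 2 - 1 / (2 * (m : ℝ)) < |(Y x (Sum.inr i) / ρ' + τ') -
      round (Y x (Sum.inr i) / ρ' + τ')|}ᶜ)), ?_, ?_, ?_, ?_⟩
  · intro k
    rcases lt_trichotomy k r with hkr | rfl | hkr
    · rw [hlt k hkr]; exact hsymp k
    · rw [heq]; exact hsymp'
    · rw [hgt k hkr]; intro x v w; simp
  · intro k
    rcases lt_trichotomy k r with hkr | rfl | hkr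
    · rw [hlt k hkr]; exact hsupp k
    · rw [heq]; exact hsupp'
    · rw [hgt k hkr]; exact fun _ _ => rfl
  · intro k
    rcases lt_trichotomy k r with hkr | rfl | hkr
    · rw [hlt k hkr]; exact hclose k
    · rw [heq]; exact hclose'
    · rw [hgt k hkr]; intro x v; simp; positivity
  · exact Set.inter_subset_left.trans (Metric.ball_subset_ball hR₀1.le)
  · refine Metric.isOpen_ball.measurableSet.inter (MeasurableSet.inter ?_ (MeasurableSet.inter ?_ ?_))
    · exact (measurableSet_le hbc.continuous.abs.measurable measurable_const).compl
    · exact (measurableSet_lt measurable_const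
        (measurable_phase_dist ((hYm (Sum.inl j)).add_const τ))).compl
    · exact (measurableSet_lt measurable_const
        (measurable_phase_dist ((hYm (Sum.inr i)).add_const τ'))).compl
  · have hball : 0 < volume.real (Metric.ball (0 : Phase N) 1) :=
      ENNReal.toReal_pos (Metric.measure_ball_pos volume 0 one_pos).ne' measure_ball_lt_top.ne
    rw [measureReal_restrict_apply_univ] at htt hτ hτ'
    refine lt_of_lt_of_le ?_ (measureReal_good_ge hR₀1 hvol htt
      (hτ.trans (by gcongr)) (hτ'.trans (by gcongr)))
    gcongr
    linarith
  · rintro x ⟨hx, hxb, hxp, hxq⟩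
    have hxb' : 2 * B < |b x| := not_le.1 hxb
    obtain ⟨hz, hzi, hzj, d, hder⟩ := hwalk x hx r le_rfl
    change (linSeq A r).symm (Y x) ∈ _ at hz
    change Y x (Sum.inl i) = P r * _ at hzi
    change Y x (Sum.inr j) = (P r)⁻¹ * _ at hzj
    change fderiv ℝ Y x (pVec i) = P r • (pVec i - b x • pVec j) + d • qVec i at hder
    -- the slope of the walk can be read off from the position reached at time `r`
    have hbz : b ((linSeq A r).symm (Y x)) = b x := by
      have e1 := hsq.apply_inl ((linSeq A r).symm (Y x))
      have e2 := hsq.swap.apply_inr ((linSeq A r).symm (Y x))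
      rw [ContinuousLinearEquiv.apply_symm_apply] at e1 e2
      rw [hzi] at e1
      rw [hzj] at e2
      have e3 := mul_left_cancel₀ hPr.ne' e1
      have e4 := mul_left_cancel₀ (inv_ne_zero hPr.ne') e2
      simp only [hb, walk, ← e3, ← e4]
    obtain ⟨a, ha, hv⟩ := hcorr (Y x) hz hxp hxq
    rw [hbz] at ha
    have hv := hv (fderiv ℝ Y x (pVec i))
    have hvn : ‖fderiv ℝ Y x (pVec i)‖ ≤ V := by
      have := norm_fderiv_compSeq_le (A := A) (h := h) (r := r) (D := D ^ 2) (by positivity)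
        (fun k hk v => by
          have e1 : A k v = linSeq A (k + 1) ((linSeq A k).symm v) := by simp [linSeq]
          rw [e1]
          calc _ ≤ D * (D * ‖v‖) := ((hD (k + 1) (by omega)).1 _).trans (by
                gcongr; exact (hD k (by omega)).2 v)
            _ = _ := by ring)
        (fun k x v => (hclose k x v).trans (by gcongr)) x (pVec i) r le_rfl
      simpa [pVec] using this
    set v := fderiv ℝ Y x (pVec i) with hvdef
    have hvj : v (Sum.inl j) = -(P r * b x) := by
      rw [hder]; simp [pVec, qVec, hij.symm]
    have hvi : v (Sum.inr i) = d := by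
      rw [hder]; simp [pVec, qVec]
    -- `w'` is the vector `v` sheared in the `q_j`-direction and freed from its `p_i`-component, and
    -- `w` is the vector at time `0` which the unperturbed maps take to it
    set w' : Phase N := (-(P r * b x)) • pVec j + d • qVec i + (a * d) • qVec j with hw'
    set w : Phase N := (-(b x)) • pVec j + (P r * d) • qVec i + (P r * (a * d)) • qVec j with hw
    have hww : linSeq A r w = w' := by
      rw [hw, map_add, map_add, map_smul, map_smul, map_smul, hsq.map_p', hsq.map_q, hsq.map_q',
        smul_smul, smul_smul, smul_smul]
      rw [show P r * d * (P r)⁻¹ = d by field_simp,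
        show P r * (a * d) * (P r)⁻¹ = a * d by field_simp, hw', neg_mul, mul_comm (b x)]
    have hw'n : 1 / D * (2 * B) ≤ ‖w'‖ := by
      have e1 := PiLp.norm_apply_le w' (Sum.inl j)
      have e2 : w' (Sum.inl j) = -(P r * b x) := by rw [hw']; simp [pVec, qVec]
      rw [e2, norm_neg, norm_mul, Real.norm_eq_abs, Real.norm_eq_abs, abs_of_pos hPr] at e1
      refine le_trans ?_ e1
      gcongr
      exact hPD.2
    have herr : ‖fderiv ℝ hr' (Y x) v - w'‖ ≤ θ := by
      have e1 : fderiv ℝ hr' (Y x) v - w' =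
          (fderiv ℝ hr' (Y x) v - (v - (a * v (Sum.inl j)) • pVec i + (a * v (Sum.inr i)) • qVec j))
          + (P r * ((1 - softInv B k (b x) * b x) + (a - -softInv B k (b x)) * b x)) • pVec i := by
        rw [hvj, hvi, hw', hder]; module
      have hpn : ‖(pVec i : Phase N)‖ = 1 := by simp [pVec]
      have e2 : |(1 - softInv B k (b x) * b x) + (a - -softInv B k (b x)) * b x| ≤
          (1 / 2) ^ k + K * ρ' * (r * s) := by
        refine (abs_add_le _ _).trans (add_le_add
          (abs_one_sub_softInv_mul_le hB0 k hxb'.le) ?_)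
        rw [abs_mul]
        gcongr
        exact abs_walk_le hs0.le _ _ _ _ _ _ _ _
      rw [e1]
      refine (norm_add_le _ _).trans ?_
      rw [norm_smul, hpn, mul_one, Real.norm_eq_abs, abs_mul, abs_of_pos hPr]
      calc _ ≤ K * ρ' * V + D * ((1 / 2) ^ k + K * ρ' * (r * s)) := by
            gcongr
            · exact hv.trans (by gcongr)
            · exact hPD.1
        _ ≤ K * ρ' * V + D * (θ / (2 * D) + K * ρ' * (r * s)) := by gcongr
        _ = (D * (r * s) + V) * K * ρ' + θ / 2 := by field_simp; ring
        _ ≤ _ := by linarith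
    refine ⟨w, ?_, ?_, ?_⟩
    · refine add_mem (add_mem ?_ ?_) ?_ <;>
        exact Submodule.smul_mem _ _ (Submodule.subset_span (by simp))
    · intro hw0
      rw [← hww, hw0, map_zero, norm_zero] at hw'n
      have : 0 < 1 / D * (2 * B) := by positivity
      linarith
    · have hYeq : compSeq (fun l y => A l (h' l y)) r = Y :=
        compSeq_congr (fun l hl => by rw [hlt l hl]) r le_rfl
      have hcomp : compSeq (fun l y => A l (h' l y)) n =
          fun x => linSeq A n ((linSeq A r).symm (hr' (Y x))) := by
        funext z
        rw [compSeq_eq_of_eventually_linear (h := fun l => ⇑(h' l))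
          (fun k hk x => by rw [hgt k hk]; rfl) hrn z, hYeq, heq]
      have hr'd : HasFDerivAt hr' (fderiv ℝ hr' (Y x)) (Y x) :=
        (hr'.contMDiff.contDiff.differentiable (by norm_num) _).hasFDerivAt
      have hchain := (linSeq A n).hasFDerivAt.comp x ((linSeq A r).symm.hasFDerivAt.comp x
        (hr'd.comp x (hYd x).hasFDerivAt))
      have hfin : fderiv ℝ (compSeq (fun l y => A l (h' l y)) n) x (pVec i) =
          linSeq A n ((linSeq A r).symm (fderiv ℝ hr' (Y x) v)) := by
        rw [hcomp]
        exact congrArg (fun L => L (pVec i)) hchain.fderiv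
      have hwsymm : w = (linSeq A r).symm w' := by rw [← hww]; simp
      rw [hfin, ← map_sub]
      nth_rw 1 [hwsymm]
      rw [← map_sub]
      have e1 : ‖linSeq A n ((linSeq A r).symm (fderiv ℝ hr' (Y x) v - w'))‖ ≤ D * (D * θ) :=
        ((hD n le_rfl).1 _).trans (by
          gcongr; exact ((hD r hrn.le).2 _).trans (by gcongr))
      have e2 : ‖w'‖ ≤ D * (D * ‖linSeq A n w‖) := by
        rw [← hww]
        refine ((hD r hrn.le).1 _).trans ?_
        gcongr
        have := (hD n le_rfl).2 (linSeq A n w)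
        rwa [ContinuousLinearEquiv.symm_apply_apply] at this
      refine e1.trans ?_
      have e3 : 1 / D * (2 * B) ≤ D * (D * ‖linSeq A n w‖) := hw'n.trans e2
      have e4 : D * (D * θ) = γ * (1 / D ^ 2 * (1 / D * B)) := by rw [hθ]; field_simp
      rw [e4]
      gcongr
      calc 1 / D ^ 2 * (1 / D * B) ≤ 1 / D ^ 2 * (D * (D * ‖linSeq A n w‖)) :=
            mul_le_mul_of_nonneg_left (le_trans (by gcongr; linarith) e3) (by positivity)
        _ = _ := by field_simp

/-! ### Flexible split sequences -/

theorem exists_angle_lt {γ : ℝ} (hγ : 0 < γ) : ∃ δ : ℝ, 0 < δ ∧ ∀ u w : Phase N, w ≠ 0 →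
    ‖u - w‖ ≤ δ * ‖w‖ → u ≠ 0 ∧ InnerProductGeometry.angle u w < γ := by
  set γ₀ := min γ Real.pi with hγ₀
  have h0 : 0 < γ₀ := lt_min hγ Real.pi_pos
  have hcos : Real.cos γ₀ < 1 := by
    rw [← Real.cos_zero]
    exact Real.cos_lt_cos_of_nonneg_of_le_pi le_rfl (min_le_right _ _) h0
  refine ⟨min (1 / 2) ((1 - Real.cos γ₀) / 4), lt_min (by norm_num) (by linarith),
    fun u w hw huw => ?_⟩
  set δ := min (1 / 2) ((1 - Real.cos γ₀) / 4) with hδ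
  have hδ1 : δ ≤ 1 / 2 := min_le_left _ _
  have hδ2 : δ ≤ (1 - Real.cos γ₀) / 4 := min_le_right _ _
  have hδ0 : 0 < δ := lt_min (by norm_num) (by linarith)
  have hwn : 0 < ‖w‖ := norm_pos_iff.2 hw
  have hu : u ≠ 0 := by
    rintro rfl
    rw [zero_sub, norm_neg] at huw
    nlinarith
  refine ⟨hu, lt_of_lt_of_le ?_ (min_le_left γ Real.pi)⟩
  by_contra hcon
  have h1 : Real.cos (InnerProductGeometry.angle u w) ≤ Real.cos γ₀ :=
    Real.cos_le_cos_of_nonneg_of_le_pi h0.le (InnerProductGeometry.angle_le_pi u w) (not_lt.1 hcon)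
  have hun : 0 < ‖u‖ := norm_pos_iff.2 hu
  rw [InnerProductGeometry.cos_angle, div_le_iff₀ (by positivity)] at h1
  have h2 : inner ℝ u w = ‖w‖ ^ 2 + inner ℝ (u - w) w := by
    rw [inner_sub_left, real_inner_self_eq_norm_sq]; ring
  have h3 : -(δ * ‖w‖ * ‖w‖) ≤ inner ℝ (u - w) w := by
    have e1 := abs_real_inner_le_norm (u - w) w
    have e2 : ‖u - w‖ * ‖w‖ ≤ δ * ‖w‖ * ‖w‖ := by gcongr
    linarith [neg_abs_le (inner ℝ (u - w) w)]
  have h4 : ‖u‖ ≤ (1 + δ) * ‖w‖ := by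
    calc ‖u‖ = ‖(u - w) + w‖ := by rw [sub_add_cancel]
      _ ≤ _ := by linarith [norm_add_le (u - w) w]
  have h5 : (1 - δ) * ‖w‖ ^ 2 ≤ Real.cos γ₀ * (‖u‖ * ‖w‖) := by nlinarith
  have hw2 : 0 < ‖w‖ ^ 2 := by positivity
  rcases le_or_gt 0 (Real.cos γ₀) with hc | hc
  · have h6 : Real.cos γ₀ * (‖u‖ * ‖w‖) ≤ Real.cos γ₀ * ((1 + δ) * ‖w‖ * ‖w‖) := by gcongr
    have h7 : (1 - δ) * ‖w‖ ^ 2 ≤ Real.cos γ₀ * (1 + δ) * ‖w‖ ^ 2 := by linarith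
    have h8 := le_of_mul_le_mul_right h7 hw2
    nlinarith
  · have : Real.cos γ₀ * (‖u‖ * ‖w‖) ≤ 0 := mul_nonpos_of_nonpos_of_nonneg hc.le (by positivity)
    nlinarith

theorem subspaceAngle_lt {E F : Submodule ℝ (Phase N)} {γ : ℝ} {u w : Phase N} (hu : u ∈ E)
    (hu0 : u ≠ 0) (hw : w ∈ F) (hw0 : w ≠ 0) (h : InnerProductGeometry.angle u w < γ) :
    subspaceAngle E F < γ := by
  refine lt_of_le_of_lt (csInf_le ⟨0, ?_⟩ ⟨u, hu, hu0, w, hw, hw0, rfl⟩) h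
  rintro θ ⟨v, -, -, w, -, -, rfl⟩
  exact InnerProductGeometry.angle_nonneg v w

theorem exists_equiv_of_symplectic {A : Phase N →L[ℝ] Phase N}
    (h : ∀ v w, stdForm (A v) (A w) = stdForm v w) :
    ∃ e : Phase N ≃L[ℝ] Phase N, (e : Phase N →L[ℝ] Phase N) = A := by
  have hinj : Function.Injective A.toLinearMap := by
    rw [injective_iff_map_eq_zero]
    intro v hv
    have h0 : ∀ w, stdForm v w = 0 := fun w => by
      have hv' : A v = 0 := hv
      rw [← h v w, hv']
      simp [stdForm]
    ext k
    rcases k with k | k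
    · rw [← stdForm_qVec, h0]; rfl
    · have := h0 (pVec k)
      rw [stdForm_pVec, neg_eq_zero] at this
      rw [this]; rfl
  refine ⟨(LinearEquiv.ofInjectiveEndo A.toLinearMap hinj).toContinuousLinearEquiv, ?_⟩
  ext v : 1
  rfl

theorem linSeq_mem {A : ℕ → Phase N ≃L[ℝ] Phase N} {E : ℕ → Submodule ℝ (Phase N)} {n : ℕ}
    (hE : ∀ k < n, (E k).map (A k : Phase N →L[ℝ] Phase N).toLinearMap = E (k + 1)) {v : Phase N}
    (hv : v ∈ E 0) : ∀ k ≤ n, linSeq A k v ∈ E k := by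
  intro k
  induction k with
  | zero => intro _; exact hv
  | succ k ih =>
    intro hk
    rw [← hE k (by omega)]
    exact ⟨_, ih (by omega), rfl⟩

/-- The composition with linear isomorphisms as a `C¹` diffeomorphism. -/
def conjDiffeo (T S : Phase N ≃L[ℝ] Phase N)
    (h : Phase N ≃ₘ^1⟮𝓘(ℝ, Phase N), 𝓘(ℝ, Phase N)⟯ Phase N) :
    Phase N ≃ₘ^1⟮𝓘(ℝ, Phase N), 𝓘(ℝ, Phase N)⟯ Phase N where
  toEquiv := (T.toEquiv.trans h.toEquiv).trans S.toEquiv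
  contMDiff_toFun := by
    rw [contMDiff_iff_contDiff]
    exact S.contDiff.comp (h.contMDiff.contDiff.comp T.contDiff)
  contMDiff_invFun := by
    rw [contMDiff_iff_contDiff]
    exact T.symm.contDiff.comp (h.symm.contMDiff.contDiff.comp S.symm.contDiff)

theorem conjDiffeo_apply (T S : Phase N ≃L[ℝ] Phase N)
    (h : Phase N ≃ₘ^1⟮𝓘(ℝ, Phase N), 𝓘(ℝ, Phase N)⟯ Phase N) (x : Phase N) :
    conjDiffeo T S h x = S (h (T x)) := rfl

theorem fderiv_conjDiffeo (T S : Phase N ≃L[ℝ] Phase N)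
    (h : Phase N ≃ₘ^1⟮𝓘(ℝ, Phase N), 𝓘(ℝ, Phase N)⟯ Phase N) (x v : Phase N) :
    fderiv ℝ (fun y => S (h (T y))) x v = S (fderiv ℝ h (T x) (T v)) := by
  have h1 : HasFDerivAt h (fderiv ℝ h (T x)) (T x) :=
    (h.contMDiff.contDiff.differentiable (by norm_num) _).hasFDerivAt
  exact congrArg (fun L => L v) (S.hasFDerivAt.comp x (h1.comp x T.hasFDerivAt)).fderiv

/-- A split sequence which, in symplectic coordinates of bounded distortion, starts with enough
squeezes of the `p_i p_j q_i q_j`-space is flexible if `∂/∂p_i` lies in the first space and the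
three other vectors in the second one. -/
theorem exists_isFlexible_of_isSqueeze {i j : Fin N} (hij : i ≠ j) {ε κ K : ℝ} (hε : 0 < ε)
    (hκ : 0 < κ) (hK : 0 < K) :
    ∃ r : ℕ, ∀ (n : ℕ) (A : ℕ → Phase N →L[ℝ] Phase N) (E₁ E₂ : ℕ → Submodule ℝ (Phase N))
      (T : ℕ → Phase N ≃L[ℝ] Phase N) (c : ℕ → ℝ), r < n → IsSplitSequence n A E₁ E₂ →
      (∀ k < n, ∀ v w, stdForm (T k v) (T k w) = stdForm v w) →
      (∀ k < n, ∀ v, ‖T k v‖ ≤ K * ‖v‖ ∧ ‖(T k).symm v‖ ≤ K * ‖v‖) →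
      (∀ k, k + 1 < n → 0 < c k ∧
        T (k + 1) (A k ((T k).symm (pVec i))) = c k • pVec i ∧
        T (k + 1) (A k ((T k).symm (pVec j))) = c k • pVec j ∧
        T (k + 1) (A k ((T k).symm (qVec i))) = (c k)⁻¹ • qVec i ∧
        T (k + 1) (A k ((T k).symm (qVec j))) = (c k)⁻¹ • qVec j) →
      (T 0).symm (pVec i) ∈ E₁ 0 → (T 0).symm (pVec j) ∈ E₂ 0 →
      (T 0).symm (qVec i) ∈ E₂ 0 → (T 0).symm (qVec j) ∈ E₂ 0 →
      IsFlexible ε κ n A E₁ E₂ := by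
  set η : ℝ := min 1 (ε / (2 * K ^ 2)) with hη
  have hη0 : 0 < η := by positivity
  have hηK : K * (η * K) < ε := by
    have h1 : η ≤ ε / (2 * K ^ 2) := min_le_right _ _
    rw [le_div_iff₀ (by positivity)] at h1
    nlinarith
  obtain ⟨r, hr⟩ := exists_flexible_perturbation hij hη0 (min_le_left _ _) hκ
  refine ⟨r, fun n A E₁ E₂ T c hrn hsplit hTs hTK hsq hp hp' hq hq' => ⟨hsplit, fun γ hγ => ?_⟩⟩
  have hn : 0 < n := by omega
  have hA : ∀ k, ∃ e : Phase N ≃L[ℝ] Phase N, k < n → (e : Phase N →L[ℝ] Phase N) = A k := by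
    intro k
    by_cases hk : k < n
    · obtain ⟨e, he⟩ := exists_equiv_of_symplectic (hsplit.symplectic k hk)
      exact ⟨e, fun _ => he⟩
    · exact ⟨ContinuousLinearEquiv.refl ℝ _, fun h => absurd h hk⟩
  choose Ae hAe using hA
  have hAv : ∀ k < n, ∀ v, Ae k v = A k v := fun k hk v => by rw [← hAe k hk]; rfl
  set S : ℕ → Phase N ≃L[ℝ] Phase N := fun k =>
    if k < n then T k else ContinuousLinearEquiv.refl ℝ _ with hS
  have hST : ∀ k < n, S k = T k := fun k hk => by simp [hS, hk]
  have hSn : S n = ContinuousLinearEquiv.refl ℝ _ := by simp [hS]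
  set B : ℕ → Phase N ≃L[ℝ] Phase N := fun k =>
    ((S k).symm.trans (Ae k)).trans (S (k + 1)) with hB
  have hBv : ∀ k v, B k v = S (k + 1) (Ae k ((S k).symm v)) := fun _ _ => rfl
  have hlin : ∀ k v, linSeq B k v = S k (linSeq Ae k ((S 0).symm v)) := by
    intro k
    induction k with
    | zero => intro v; simp [linSeq]
    | succ k ih =>
      intro v
      change B k (linSeq B k v) = S (k + 1) (Ae k (linSeq Ae k ((S 0).symm v)))
      rw [ih, hBv, ContinuousLinearEquiv.symm_apply_apply]
  have hBsq : ∀ k < r, IsSqueeze (B k) i j (c k) := by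
    intro k hk
    have hk1 : k + 1 < n := by omega
    obtain ⟨h0, h1, h2, h3, h4⟩ := hsq k hk1
    have hBT : ∀ v, B k v = T (k + 1) (A k ((T k).symm v)) := fun v => by
      rw [hBv, hST _ hk1, hST k (by omega), hAv k (by omega)]
    refine ⟨fun v w => ?_, h0, ?_, ?_, ?_, ?_⟩
    · rw [hBT, hBT, hTs _ hk1, hsplit.symplectic k (by omega), ← hTs k (by omega)]
      simp
    · rw [hBT, h1]
    · rw [hBT, h2]
    · rw [hBT, h3]
    · rw [hBT, h4]
  obtain ⟨δ, hδ, hangle⟩ := exists_angle_lt (N := N) hγ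
  obtain ⟨h, hsymp, hsupp, hclose, G, hGU, hGm, hGvol, hG⟩ := hr n B c hrn hBsq δ hδ
  have hcompA : ∀ k ≤ n, compSeq (fun j => ⇑(A j)) k = linSeq Ae k := fun k hk => by
    rw [← compSeq_eq_linSeq]
    refine compSeq_congr (n := n) (fun l hl => ?_) k hk
    funext v; exact (hAv l hl v).symm
  refine ⟨S 0 ⁻¹' Metric.ball 0 1, fun k => conjDiffeo (S k) ((S k).symm.trans (Ae k)) (h k),
    Metric.isOpen_ball.preimage (S 0).continuous, ?_, by simp, ?_, ?_, ?_, S 0 ⁻¹' G,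
    Set.preimage_mono hGU, (S 0).continuous.measurable hGm, ?_, ?_⟩
  · have : S 0 ⁻¹' Metric.ball 0 1 = (S 0).symm '' Metric.ball 0 1 :=
      ((S 0).toEquiv.symm.image_eq_preimage_symm _).symm
    rw [this]
    exact (S 0).symm.lipschitz.isBounded_image Metric.isBounded_ball
  · intro k hk x v w
    have e : ∀ v, fderiv ℝ (conjDiffeo (S k) ((S k).symm.trans (Ae k)) (h k)) x v =
        A k ((T k).symm (fderiv ℝ (h k) (T k x) (T k v))) := fun v => by
      rw [← hAv k hk, ← hST k hk]
      exact fderiv_conjDiffeo (S k) ((S k).symm.trans (Ae k)) (h k) x v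
    rw [e, e, hsplit.symplectic k hk, ← hTs k hk]
    simp only [ContinuousLinearEquiv.apply_symm_apply]
    rw [hsymp, hTs k hk]
  · intro k hk x hx
    rw [conjDiffeo_apply]
    have : h k (S k x) = S k x := by
      refine hsupp k _ fun ⟨y, hy, hyx⟩ => hx ⟨(S 0).symm y, by simpa using hy, ?_⟩
      rw [hcompA k hk.le]
      rw [hlin] at hyx
      exact (S k).injective hyx
    rw [this, ← hAv k hk]
    simp
  · intro k hk x
    have e : (fun y => (A k).inverse (conjDiffeo (S k) ((S k).symm.trans (Ae k)) (h k) y)) =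
        fun y => (S k).symm (h k (S k y)) := by
      funext y
      rw [conjDiffeo_apply, ← hAe k hk, ContinuousLinearMap.inverse_equiv]
      simp
    rw [e]
    refine lt_of_le_of_lt (ContinuousLinearMap.opNorm_le_bound _ (by positivity) fun v => ?_) hηK
    have e2 : (fderiv ℝ (fun y => (S k).symm (h k (S k y))) x -
        ContinuousLinearMap.id ℝ (Phase N)) v =
        (S k).symm (fderiv ℝ (h k) (S k x) (S k v) - S k v) := by
      rw [sub_apply, fderiv_conjDiffeo, map_sub]; simp
    rw [e2, hST k hk]
    calc _ ≤ K * (η * (K * ‖v‖)) := by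
          refine ((hTK k hk _).2).trans ?_
          gcongr
          refine (hclose k _ _).trans ?_
          gcongr
          exact (hTK k hk v).1
      _ = _ := by ring
  · have hvol : ∀ s : Set (Phase N), volume.real (S 0 ⁻¹' s) =
        (ENNReal.ofReal |LinearMap.det ((S 0).symm : Phase N →ₗ[ℝ] Phase N)|).toReal
          * volume.real s := fun s => by
      rw [Measure.real, Measure.addHaar_preimage_continuousLinearEquiv, ENNReal.toReal_mul]; rfl
    rw [hvol, hvol, mul_left_comm]
    refine mul_lt_mul_of_pos_left hGvol ?_
    rw [ENNReal.toReal_ofReal (abs_nonneg _)]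
    exact abs_pos.2 (LinearEquiv.isUnit_det' (S 0).symm.toLinearEquiv).ne_zero
  · intro x hx
    obtain ⟨w, hw, hw0, hwd⟩ := hG (S 0 x) hx
    set f : ℕ → Phase N → Phase N := fun l y => B l (h l y) with hf
    have hcomp : ∀ k, compSeq (fun l => ⇑(conjDiffeo (S l) ((S l).symm.trans (Ae l)) (h l))) k =
        fun y => (S k).symm (compSeq f k (S 0 y)) := by
      intro k
      induction k with
      | zero => funext y; simp [compSeq]
      | succ k ih =>
        funext y
        change conjDiffeo (S k) ((S k).symm.trans (Ae k)) (h k)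
          (compSeq (fun l => ⇑(conjDiffeo (S l) ((S l).symm.trans (Ae l)) (h l))) k y) =
          (S (k + 1)).symm (B k (h k (compSeq f k (S 0 y))))
        rw [ih, conjDiffeo_apply, hBv]
        simp
    have hfd : ∀ k, Differentiable ℝ (f k) := fun k =>
      (B k).differentiable.comp ((h k).contMDiff.contDiff.differentiable (by norm_num))
    have hder : fderiv ℝ (compSeq (fun l =>
        ⇑(conjDiffeo (S l) ((S l).symm.trans (Ae l)) (h l))) n) x ((S 0).symm (pVec i)) =
        fderiv ℝ (compSeq f n) (S 0 x) (pVec i) := by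
      rw [hcomp, hSn]
      have e1 := ((differentiable_compSeq hfd n (S 0 x)).hasFDerivAt).comp x (S 0).hasFDerivAt
      have e2 := congrArg (fun L => L ((S 0).symm (pVec i))) e1.fderiv
      refine e2.trans ?_
      simp
    have hwn : linSeq B n w = linSeq Ae n ((S 0).symm w) := by rw [hlin, hSn]; rfl
    have hwE : (S 0).symm w ∈ E₂ 0 := by
      rw [hST 0 hn]
      have hle : Submodule.span ℝ {pVec j, qVec i, qVec j} ≤
          (E₂ 0).comap ((T 0).symm : Phase N →ₗ[ℝ] Phase N) := by
        rw [Submodule.span_le]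
        rintro v (rfl | rfl | rfl)
        · exact hp'
        · exact hq
        · exact hq'
      exact hle hw
    have hw0' : linSeq B n w ≠ 0 := fun h0 => hw0 ((linSeq B n).injective (by rw [h0, map_zero]))
    obtain ⟨hu0, hlt⟩ := hangle _ _ hw0' hwd
    refine subspaceAngle_lt (u := fderiv ℝ (compSeq f n) (S 0 x) (pVec i)) (w := linSeq B n w)
      ⟨(S 0).symm (pVec i), ?_, hder⟩ hu0 ?_ hw0' hlt
    · rw [hST 0 hn]; exact hp
    · rw [hwn]
      exact linSeq_mem (fun k hk => by rw [hAe k hk]; exact hsplit.map₂ k hk) hwE n le_rfl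

/-! ### Exponential growth rates -/

section Growth

variable {V ι : Type*} [AddCommGroup V] [Module ℝ V]

/-- The vectors that grow along `l`, with respect to the seminorms `ν n` and the time scale `t n`,
at an exponential rate smaller than `c`. -/
def slowSubmodule (l : Filter ι) (t : ι → ℝ) (ht : Tendsto t l atTop) (ν : ι → Seminorm ℝ V)
    (c : ℝ) : Submodule ℝ V where
  carrier := {v | ∃ b < c, ∀ᶠ n in l, ν n v ≤ Real.exp (b * t n)}
  zero_mem' := ⟨c - 1, by linarith, Eventually.of_forall fun n => by
    rw [map_zero]; exact (Real.exp_pos _).le⟩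
  add_mem' := by
    rintro v w ⟨b, hb, hv⟩ ⟨b', hb', hw⟩
    have hm : max b b' < c := max_lt hb hb'
    refine ⟨(max b b' + c) / 2, by linarith, ?_⟩
    have hd : 0 < (c - max b b') / 2 := by linarith
    filter_upwards [hv, hw, (ht.const_mul_atTop hd).eventually_ge_atTop (Real.log 2),
      ht.eventually_ge_atTop 0] with n h1 h2 h3 h4
    calc ν n (v + w) ≤ ν n v + ν n w := map_add_le_add _ _ _
      _ ≤ Real.exp (max b b' * t n) + Real.exp (max b b' * t n) := by
        refine add_le_add (h1.trans ?_) (h2.trans ?_) <;> gcongr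
        · exact le_max_left _ _
        · exact le_max_right _ _
      _ = 2 * Real.exp (max b b' * t n) := by ring
      _ = Real.exp (Real.log 2 + max b b' * t n) := by
        rw [Real.exp_add, Real.exp_log (by norm_num)]
      _ ≤ _ := by
        refine Real.exp_le_exp.2 ?_
        linarith
  smul_mem' := by
    rintro a v ⟨b, hb, hv⟩
    refine ⟨(b + c) / 2, by linarith, ?_⟩
    have hd : 0 < (c - b) / 2 := by linarith
    filter_upwards [hv, (ht.const_mul_atTop hd).eventually_ge_atTop (Real.log (|a| + 1))]
      with n h1 h3
    have ha : 0 < |a| + 1 := by positivity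
    calc ν n (a • v) = |a| * ν n v := map_smul_eq_mul _ _ _
      _ ≤ (|a| + 1) * Real.exp (b * t n) := by
        refine mul_le_mul (by linarith) h1 (apply_nonneg _ _) ha.le
      _ = Real.exp (Real.log (|a| + 1) + b * t n) := by
        rw [Real.exp_add, Real.exp_log ha]
      _ ≤ _ := by
        refine Real.exp_le_exp.2 ?_
        linarith

variable {l : Filter ι} {t : ι → ℝ} {ht : Tendsto t l atTop} {ν : ι → Seminorm ℝ V}

theorem mem_slowSubmodule {v : V} {a c : ℝ} (hpos : ∀ n, 0 < ν n v)
    (hv : Tendsto (fun n => 1 / t n * Real.log (ν n v)) l (𝓝 a)) (hac : a < c) :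
    v ∈ slowSubmodule l t ht ν c := by
  obtain ⟨b, hab, hbc⟩ := exists_between hac
  refine ⟨b, hbc, ?_⟩
  filter_upwards [hv.eventually_lt_const hab, ht.eventually_gt_atTop 0] with n h1 h2
  rw [← Real.log_le_iff_le_exp (hpos n)]
  rw [one_div, inv_mul_lt_iff₀ h2] at h1
  linarith

theorem notMem_slowSubmodule [l.NeBot] {v : V} {a c : ℝ} (hpos : ∀ n, 0 < ν n v)
    (hv : Tendsto (fun n => 1 / t n * Real.log (ν n v)) l (𝓝 a)) (hac : c ≤ a) :
    v ∉ slowSubmodule l t ht ν c := by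
  rintro ⟨b, hbc, hb⟩
  obtain ⟨n, h1, h2, h3⟩ := ((hv.eventually_const_lt (hbc.trans_le hac)).and
    (hb.and (ht.eventually_gt_atTop 0))).exists
  rw [← Real.log_le_iff_le_exp (hpos n)] at h2
  rw [one_div, lt_inv_mul_iff₀ h3] at h1
  linarith

/-- The components of a vector, with respect to a family of vectors with pairwise different growth
rates, do not grow faster than the vector itself. -/
theorem rate_le_of_sum [l.NeBot] (ht : Tendsto t l atTop) {κ : Type*} [Fintype κ] {e : κ → ℝ}
    (he : Function.Injective e)
    (hpos : ∀ n v, v ≠ 0 → 0 < ν n v) {u : κ → V}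
    (hu : ∀ j, u j ≠ 0 → Tendsto (fun n => 1 / t n * Real.log (ν n (u j))) l (𝓝 (e j)))
    {a : ℝ} (hv0 : ∑ j, u j ≠ 0)
    (hv : Tendsto (fun n => 1 / t n * Real.log (ν n (∑ j, u j))) l (𝓝 a)) (j : κ)
    (hj : u j ≠ 0) : e j ≤ a := by
  classical
  -- If the fastest component `u j₀` were faster than the sum, then it would be a combination of
  -- strictly slower vectors.
  obtain ⟨j₀, hj₀, hmax⟩ := Finset.exists_max_image (Finset.univ.filter fun j => u j ≠ 0) e
    ⟨j, by simpa using hj⟩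
  refine (hmax j (by simpa using hj)).trans (not_lt.1 fun hlt => ?_)
  replace hj₀ : u j₀ ≠ 0 := by simpa using hj₀
  refine notMem_slowSubmodule (ht := ht) (fun n => hpos n _ hj₀) (hu j₀ hj₀) le_rfl ?_
  have hsum := Finset.add_sum_erase Finset.univ u (Finset.mem_univ j₀)
  rw [eq_sub_of_add_eq hsum]
  refine Submodule.sub_mem _ (mem_slowSubmodule (fun n => hpos n _ hv0) hv hlt)
    (Submodule.sum_mem _ fun i hi => ?_)
  by_cases h0 : u i = 0
  · rw [h0]; exact Submodule.zero_mem _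
  · refine mem_slowSubmodule (fun n => hpos n _ h0) (hu i h0) ?_
    exact lt_of_le_of_ne (hmax i (by simpa using h0)) fun h => (Finset.ne_of_mem_erase hi) (he h)

end Growth

theorem isCompl_biSup_of_iSupIndep {V ι : Type*} [AddCommGroup V] [Module ℝ V]
    {E : ι → Submodule ℝ V} (hE : iSupIndep E) (htop : ⨆ j, E j = ⊤) {s t : Set ι}
    (hst : Disjoint s t) (hu : s ∪ t = Set.univ) :
    IsCompl (⨆ j ∈ s, E j) (⨆ j ∈ t, E j) := by
  refine ⟨hE.disjoint_biSup_biSup hst, codisjoint_iff.2 ?_⟩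
  rw [← iSup_union, hu, iSup_univ, htop]

/-! ### Oseledets splittings: uniqueness and invariance -/

section Oseledets

variable {N : ℕ} {M : Type*} [TopologicalSpace M] [ChartedSpace (Phase N) M]

theorem contMDiff_zpow (f : Diff1 N M) (n : ℤ) :
    ContMDiff 𝓘(ℝ, Phase N) 𝓘(ℝ, Phase N) 1 (⇑((f.toEquiv : Equiv.Perm M) ^ n)) := by
  induction n using Int.induction_on with
  | zero => exact contMDiff_id
  | succ n ih =>
    rw [zpow_add_one]
    exact ih.comp f.contMDiff
  | pred n ih =>
    rw [zpow_sub_one]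
    exact ih.comp f.symm.contMDiff

theorem mdifferentiableAt_zpow (f : Diff1 N M) (n : ℤ) (x : M) :
    MDifferentiableAt 𝓘(ℝ, Phase N) 𝓘(ℝ, Phase N) (⇑((f.toEquiv : Equiv.Perm M) ^ n)) x :=
  (contMDiff_zpow f n).mdifferentiable one_ne_zero x

theorem tangentMapAt_zpow_injective (f : Diff1 N M) (n : ℤ) (x : M) :
    Function.Injective (tangentMapAt (N := N) (⇑((f.toEquiv : Equiv.Perm M) ^ n)) x) := by
  have h := mfderiv_comp x (mdifferentiableAt_zpow f (-n) _) (mdifferentiableAt_zpow f n x)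
  have hid : (⇑((f.toEquiv : Equiv.Perm M) ^ (-n))) ∘ (⇑((f.toEquiv : Equiv.Perm M) ^ n)) = id := by
    rw [zpow_neg]
    funext y
    exact Equiv.symm_apply_apply _ y
  -- The tangent spaces at `f⁻ⁿ (fⁿ x)` and at `x` are equal only propositionally, whence the
  -- detour over a map `k` that equals the identity.
  have key : ∀ (k : M → M) (v : TangentSpace 𝓘(ℝ, Phase N) x), k = id →
      tangentMapAt k x v = 0 → v = 0 := by
    rintro _ v rfl hv
    rwa [tangentMapAt, mfderiv_id] at hv
  refine (injective_iff_map_eq_zero _).2 fun v hv => key _ v hid ?_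
  have hv' := congrArg (fun L => L v) h
  refine hv'.trans ?_
  change mfderiv 𝓘(ℝ, Phase N) 𝓘(ℝ, Phase N) _ _ (tangentMapAt _ x v) = _
  rw [hv, map_zero]

/-- The derivative of a diffeomorphism at a point, as a linear equivalence. -/
def tangentEquiv (f : Diff1 N M) (x : M) :
    TangentSpace 𝓘(ℝ, Phase N) x ≃L[ℝ] TangentSpace 𝓘(ℝ, Phase N) (f x) :=
  (f.isLocalDiffeomorph x).mfderivToContinuousLinearEquiv one_ne_zero

theorem tangentMapAt_zpow_succ (f : Diff1 N M) (n : ℤ) (x : M) :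
    tangentMapAt (N := N) (⇑((f.toEquiv : Equiv.Perm M) ^ n * f.toEquiv)) x =
      (tangentMapAt (N := N) (⇑((f.toEquiv : Equiv.Perm M) ^ n)) (f x)).comp (tangentMapAt f x) :=
  mfderiv_comp x (mdifferentiableAt_zpow f n _) (f.contMDiff.mdifferentiable one_ne_zero x)

variable [RiemannianBundle (fun x : M => TangentSpace 𝓘(ℝ, Phase N) x)]

/-- The seminorm `v ↦ ‖Df^n(x) v‖`. -/
def growthSeminorm (f : Diff1 N M) (x : M) (n : ℤ) : Seminorm ℝ (TangentSpace 𝓘(ℝ, Phase N) x) :=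
  (normSeminorm ℝ (TangentSpace 𝓘(ℝ, Phase N) _)).comp
    (tangentMapAt (⇑((f.toEquiv : Equiv.Perm M) ^ n)) x).toLinearMap

theorem growthSeminorm_pos (f : Diff1 N M) (x : M) (n : ℤ) (v : TangentSpace 𝓘(ℝ, Phase N) x)
    (hv : v ≠ 0) : 0 < growthSeminorm f x n v :=
  norm_pos_iff.2 fun h => hv (tangentMapAt_zpow_injective f n x (h.trans (map_zero _).symm))

variable {f : Diff1 N M} {x : M}

namespace OseledetsSplitting

/-- A vector with a two-sided exponential growth rate belongs to one of the Oseledets spaces. -/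
theorem exists_mem_space (D : OseledetsSplitting f x) {v : TangentSpace 𝓘(ℝ, Phase N) x}
    (hv : v ≠ 0) {a : ℝ}
    (ha : Tendsto (fun n : ℤ =>
      1 / (n : ℝ) * Real.log ‖tangentMapAt (⇑((f.toEquiv : Equiv.Perm M) ^ n)) x v‖)
      (atTop ⊔ atBot) (𝓝 a)) : ∃ j, D.exponent j = a ∧ v ∈ D.space j := by
  classical
  obtain ⟨u, hu, huv⟩ : ∃ u : Fin D.k → TangentSpace 𝓘(ℝ, Phase N) x,
      (∀ j, u j ∈ D.space j) ∧ ∑ j, u j = v := by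
    have h := D.isInternal.submodule_iSup_eq_top
    have hv : v ∈ ⨆ j, D.space j := h ▸ Submodule.mem_top
    obtain ⟨u, hu⟩ := (Submodule.mem_iSup_iff_exists_finsupp _ _).1 hv
    refine ⟨u, hu.1, ?_⟩
    rw [← hu.2, Finsupp.sum_fintype _ _ fun _ => rfl]
  have hinj := D.exponent_strictAnti.injective
  have hpos : ∀ n v, v ≠ 0 → 0 < growthSeminorm f x n v := growthSeminorm_pos f x
  have hsum : ∑ j, u j ≠ 0 := huv.symm ▸ hv
  have hfwd : ∀ j, u j ≠ 0 → D.exponent j ≤ a := by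
    refine fun j hj => rate_le_of_sum (l := atTop) (t := fun n : ℤ => (n : ℝ))
      tendsto_intCast_atTop_atTop hinj hpos (fun i hi => ?_) hsum ?_ j hj
    · exact (D.tendsto i _ (hu i) hi).mono_left le_sup_left
    · rw [huv]; exact ha.mono_left le_sup_left
  have hneg : ∀ {w : TangentSpace 𝓘(ℝ, Phase N) x} {b : ℝ}, Tendsto (fun n : ℤ =>
      1 / (n : ℝ) * Real.log ‖tangentMapAt (⇑((f.toEquiv : Equiv.Perm M) ^ n)) x w‖)
      (atTop ⊔ atBot) (𝓝 b) → Tendsto (fun n : ℤ =>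
      1 / (-(n : ℝ)) * Real.log (growthSeminorm f x n w)) atBot (𝓝 (-b)) := fun h => by
    refine (h.mono_left le_sup_right).neg.congr fun n => ?_
    rw [one_div, one_div, inv_neg, neg_mul]
    rfl
  have hbwd : ∀ j, u j ≠ 0 → -D.exponent j ≤ -a := by
    refine fun j hj => rate_le_of_sum (l := atBot) (t := fun n : ℤ => -(n : ℝ))
      (tendsto_neg_atBot_atTop.comp (tendsto_intCast_atBot_iff.2 tendsto_id))
      (neg_injective.comp hinj) hpos (fun i hi => ?_) hsum ?_ j hj
    · exact hneg (D.tendsto i _ (hu i) hi)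
    · rw [huv]; exact hneg ha
  have heq : ∀ j, u j ≠ 0 → D.exponent j = a := fun j hj =>
    le_antisymm (hfwd j hj) (neg_le_neg_iff.1 (hbwd j hj))
  obtain ⟨j, -, hj⟩ := Finset.exists_ne_zero_of_sum_ne_zero hsum
  refine ⟨j, heq j hj, ?_⟩
  rw [← huv, Finset.sum_eq_single j]
  · exact hu j
  · intro i _ hij
    by_contra h0
    exact hij (hinj ((heq i h0).trans (heq j hj).symm))
  · simp

theorem exists_space_le (D D' : OseledetsSplitting f x) (j : Fin D.k) :
    ∃ j', D'.exponent j' = D.exponent j ∧ D.space j ≤ D'.space j' := by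
  obtain ⟨v, hv, hv0⟩ := (Submodule.ne_bot_iff _).1 (D.space_ne_bot j)
  obtain ⟨j', hj', -⟩ := D'.exists_mem_space hv0 (D.tendsto j v hv hv0)
  refine ⟨j', hj', fun w hw => ?_⟩
  by_cases hw0 : w = 0
  · rw [hw0]; exact Submodule.zero_mem _
  · obtain ⟨i, hi, hwi⟩ := D'.exists_mem_space hw0 (D.tendsto j w hw hw0)
    rwa [← D'.exponent_strictAnti.injective (hi.trans hj'.symm)]

/-- The Oseledets splitting at a point is unique. -/
instance : Subsingleton (OseledetsSplitting f x) := by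
  refine ⟨fun D D' => ?_⟩
  have hrange : Set.range D.exponent = Set.range D'.exponent := by
    refine Set.Subset.antisymm ?_ ?_
    · rintro _ ⟨j, rfl⟩
      obtain ⟨j', h, -⟩ := D.exists_space_le D' j
      exact ⟨j', h⟩
    · rintro _ ⟨j, rfl⟩
      obtain ⟨j', h, -⟩ := D'.exists_space_le D j
      exact ⟨j', h⟩
  have hk : D.k = D'.k := by
    have h : Nat.card (Set.range D.exponent) = Nat.card (Set.range D'.exponent) := by rw [hrange]
    rwa [Nat.card_range_of_injective D.exponent_strictAnti.injective,
      Nat.card_range_of_injective D'.exponent_strictAnti.injective, Nat.card_fin,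
      Nat.card_fin] at h
  have h₁ := D.exists_space_le D'
  have h₂ := D'.exists_space_le D
  obtain ⟨k, e, E, he, hE, hi, ht⟩ := D
  obtain ⟨k', e', E', he', hE', hi', ht'⟩ := D'
  dsimp only at hk hrange h₁ h₂
  subst hk
  obtain rfl : e = e' := by
    have h := (StrictMono.range_inj (f := fun j => -e j) (g := fun j => -e' j)
      (fun _ _ h => neg_lt_neg (he h)) (fun _ _ h => neg_lt_neg (he' h))).1 (by
        have h := congrArg (fun s => Neg.neg '' s) hrange
        simp only [← Set.range_comp] at h
        exact h)
    funext j
    exact neg_injective (congrFun h j)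
  obtain rfl : E = E' := by
    funext j
    obtain ⟨i, hi, hle⟩ := h₁ j
    obtain ⟨i', hi', hle'⟩ := h₂ j
    obtain rfl := he.injective hi
    obtain rfl := he.injective hi'
    exact le_antisymm hle hle'
  rfl

/-- The image under `Df` of the Oseledets splitting at `x` is the Oseledets splitting at `f x`. -/
def map (D : OseledetsSplitting f x) : OseledetsSplitting f (f x) where
  k := D.k
  exponent := D.exponent
  space j := (D.space j).map (tangentMapAt f x).toLinearMap
  exponent_strictAnti := D.exponent_strictAnti
  space_ne_bot j h := D.space_ne_bot j
    (Submodule.map_injective_of_injective (tangentEquiv f x).injective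
      (h.trans (Submodule.map_bot _).symm))
  isInternal := by
    have h := (DirectSum.isInternal_submodule_iff_iSupIndep_and_iSup_eq_top _).1 D.isInternal
    refine (DirectSum.isInternal_submodule_iff_iSupIndep_and_iSup_eq_top _).2 ⟨?_, ?_⟩
    · exact h.1.map_orderIso (Submodule.orderIsoMapComap (tangentEquiv f x).toLinearEquiv)
    · rw [← Submodule.map_iSup, h.2, Submodule.map_top]
      exact LinearMap.range_eq_top.2 (tangentEquiv f x).surjective
  tendsto := by
    rintro j _ ⟨v, hv, rfl⟩ hv0
    have hv0' : v ≠ 0 := by rintro rfl; exact hv0 (map_zero _)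
    have h := D.tendsto j v hv hv0'
    have hshift : Tendsto (fun n : ℤ => n + 1) (atTop ⊔ atBot) (atTop ⊔ atBot) :=
      Tendsto.sup_sup (tendsto_atTop_add_const_right _ _ tendsto_id)
        (tendsto_atBot_add_const_right _ _ tendsto_id)
    have hinv : Tendsto (fun n : ℤ => 1 + ((n : ℝ))⁻¹) (atTop ⊔ atBot) (𝓝 1) := by
      have h1 : Tendsto (fun n : ℤ => ((n : ℝ))⁻¹) (atTop ⊔ atBot) (𝓝 0) :=
        Tendsto.sup (tendsto_inv_atTop_zero.comp tendsto_intCast_atTop_atTop)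
          (tendsto_inv_atBot_zero.comp (tendsto_intCast_atBot_iff.2 tendsto_id))
      simpa using h1.const_add 1
    have hne : ∀ᶠ n : ℤ in atTop ⊔ atBot, n ≠ 0 ∧ n + 1 ≠ 0 := by
      refine eventually_sup.2 ⟨?_, ?_⟩
      · filter_upwards [eventually_gt_atTop 0] with n hn
        omega
      · filter_upwards [eventually_lt_atBot (-1)] with n hn
        omega
    have hlim := hinv.mul (h.comp hshift)
    rw [one_mul] at hlim
    refine hlim.congr' ?_
    filter_upwards [hne] with n hn
    have h0 : (n : ℝ) ≠ 0 := by exact_mod_cast hn.1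
    have h1 : (n : ℝ) + 1 ≠ 0 := by exact_mod_cast hn.2
    have hnorm : ‖tangentMapAt (⇑((f.toEquiv : Equiv.Perm M) ^ (n + 1))) x v‖ =
        ‖tangentMapAt (⇑((f.toEquiv : Equiv.Perm M) ^ n)) (f x) (tangentMapAt f x v)‖ := by
      rw [zpow_add_one, tangentMapAt_zpow_succ]
      rfl
    change (1 + (n : ℝ)⁻¹) * (1 / ((n + 1 : ℤ) : ℝ) * Real.log _) = 1 / (n : ℝ) * Real.log _
    rw [hnorm]
    push_cast
    field_simp

theorem lam_map (D : OseledetsSplitting f x) (i : ℕ) : D.map.lam i = D.lam i := by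
  have h : D.map.exponentList = D.exponentList := by
    unfold exponentList
    refine congrArg (fun g => (List.finRange D.k).flatMap g) (funext fun j => ?_)
    refine congrArg (fun m => List.replicate m (D.exponent j)) ?_
    exact LinearEquiv.finrank_map_eq (tangentEquiv f x).toLinearEquiv (D.space j)
  rw [lam, h, lam]

end OseledetsSplitting

theorem oseledetsSum_eq (D : OseledetsSplitting f x) (a b : ℕ) :
    oseledetsSum f a b x = ⨆ (j : Fin D.k) (_ : ∃ i, a ≤ i ∧ i ≤ b ∧ D.exponent j = D.lam i),
      D.space j := by
  have h : IsRegularPoint f x := ⟨D⟩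
  have hD : h.some = D := Subsingleton.elim _ _
  rw [oseledetsSum, dif_pos h, hD]

theorem oseledetsSum_map (h : IsRegularPoint f x) (a b : ℕ) :
    oseledetsSum f a b (f x) = (oseledetsSum f a b x).map (tangentMapAt f x).toLinearMap := by
  obtain ⟨D⟩ := h
  rw [oseledetsSum_eq D, oseledetsSum_eq D.map]
  simp only [Submodule.map_iSup, OseledetsSplitting.lam_map]
  rfl

theorem IsRegularPoint.orb (h : IsRegularPoint f x) (i : ℕ) : IsRegularPoint f (orb f x i) := by
  induction i with
  | zero => exact h
  | succ i ih => exact ⟨ih.some.map⟩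

theorem Eu_orb_succ (h : IsRegularPoint f x) (p i : ℕ) :
    Eu f p (orb f x (i + 1)) =
      (Eu f p (orb f x i)).map (tangentMapAt f (orb f x i)).toLinearMap :=
  oseledetsSum_map (h.orb i) _ _

theorem Ecs_orb_succ (h : IsRegularPoint f x) (p i : ℕ) :
    Ecs f p (orb f x (i + 1)) =
      (Ecs f p (orb f x i)).map (tangentMapAt f (orb f x i)).toLinearMap := by
  rw [Ecs, Ecs, Submodule.map_sup]
  exact congrArg₂ _ (oseledetsSum_map (h.orb i) _ _) (oseledetsSum_map (h.orb i) _ _)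

namespace OseledetsSplitting

theorem pairwise_exponentList (D : OseledetsSplitting f x) :
    D.exponentList.Pairwise (fun a b => b ≤ a) := by
  refine List.pairwise_flatMap.2 ⟨fun j _ => ?_, ?_⟩
  · exact List.pairwise_replicate.2 (Or.inr le_rfl)
  · refine (List.pairwise_lt_finRange _).imp fun {i j} hij a ha b hb => ?_
    rw [(List.mem_replicate.1 ha).2, (List.mem_replicate.1 hb).2]
    exact (D.exponent_strictAnti hij).le

theorem length_exponentList (D : OseledetsSplitting f x) : D.exponentList.length = 2 * N := by
  have : FiniteDimensional ℝ (TangentSpace 𝓘(ℝ, Phase N) x) :=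
    inferInstanceAs (FiniteDimensional ℝ (Phase N))
  have h1 : Module.finrank ℝ (TangentSpace 𝓘(ℝ, Phase N) x) = 2 * N := by
    refine (finrank_euclideanSpace (𝕜 := ℝ) (ι := Fin N ⊕ Fin N)).trans ?_
    simp [two_mul]
  rw [← h1, ← (LinearEquiv.ofBijective (DirectSum.coeLinearMap D.space) D.isInternal).finrank_eq,
    Module.finrank_directSum]
  simp [exponentList, List.length_flatMap, List.sum_ofFn, ← List.ofFn_eq_map]

theorem lam_antitone (D : OseledetsSplitting f x) {i j : ℕ} (hi : 1 ≤ i) (hij : i ≤ j)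
    (hj : j ≤ 2 * N) : D.lam j ≤ D.lam i := by
  have hl := D.length_exponentList
  rcases hij.eq_or_lt with rfl | hlt
  · exact le_rfl
  have h := List.pairwise_iff_getElem.1 D.pairwise_exponentList (i - 1) (j - 1) (by omega)
    (by omega) (by omega)
  rwa [lam, lam, List.getD_eq_getElem _ _ (by omega), List.getD_eq_getElem _ _ (by omega)]

theorem exists_exponent_eq_lam (D : OseledetsSplitting f x) (j : Fin D.k) :
    ∃ i, 1 ≤ i ∧ i ≤ 2 * N ∧ D.exponent j = D.lam i := by
  have : FiniteDimensional ℝ (TangentSpace 𝓘(ℝ, Phase N) x) :=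
    inferInstanceAs (FiniteDimensional ℝ (Phase N))
  have hmem : D.exponent j ∈ D.exponentList := by
    refine List.mem_flatMap.2 ⟨j, List.mem_finRange j, List.mem_replicate.2 ⟨?_, rfl⟩⟩
    exact fun h => D.space_ne_bot j (Submodule.finrank_eq_zero.1 h)
  obtain ⟨i, hi, h⟩ := List.getElem_of_mem hmem
  have hl := D.length_exponentList
  refine ⟨i + 1, by omega, by omega, ?_⟩
  rw [lam, Nat.add_sub_cancel, List.getD_eq_getElem _ _ hi, h]

end OseledetsSplitting

theorem isCompl_Eu_Ecs {p : ℕ} (hp : 1 ≤ p) (hpN : p ≤ N) (hx : x ∈ SigmaSet f p) :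
    IsCompl (Eu f p x) (Ecs f p x) := by
  obtain ⟨-, ⟨D⟩, hlt⟩ := hx
  have hlam : ∀ i, lyapunovExponent f x i = D.lam i := fun i => by
    have h : IsRegularPoint f x := ⟨D⟩
    have hD : h.some = D := Subsingleton.elim _ _
    rw [lyapunovExponent, dif_pos h, hD]
  rw [hlam, hlam] at hlt
  have hint := (DirectSum.isInternal_submodule_iff_iSupIndep_and_iSup_eq_top _).1 D.isInternal
  set s : Set (Fin D.k) := {j | ∃ i, 1 ≤ i ∧ i ≤ p ∧ D.exponent j = D.lam i} with hs
  set t : Set (Fin D.k) := {j | ∃ i, p + 1 ≤ i ∧ i ≤ 2 * N ∧ D.exponent j = D.lam i} with ht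
  have hu : Eu f p x = ⨆ j ∈ s, D.space j := oseledetsSum_eq D _ _
  have hcs : Ecs f p x = ⨆ j ∈ t, D.space j := by
    have ht' : t = {j | ∃ i, p + 1 ≤ i ∧ i ≤ 2 * N - p ∧ D.exponent j = D.lam i} ∪
        {j | ∃ i, 2 * N - p + 1 ≤ i ∧ i ≤ 2 * N ∧ D.exponent j = D.lam i} := by
      ext j
      constructor
      · rintro ⟨i, h1, h2, h3⟩
        rcases le_or_gt i (2 * N - p) with h | h
        · exact Or.inl ⟨i, h1, h, h3⟩
        · exact Or.inr ⟨i, h, h2, h3⟩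
      · rintro (⟨i, h1, h2, h3⟩ | ⟨i, h1, h2, h3⟩)
        · exact ⟨i, h1, by omega, h3⟩
        · exact ⟨i, by omega, h2, h3⟩
    rw [ht', iSup_union, Ecs, Ec, Es, oseledetsSum_eq D, oseledetsSum_eq D]
    rfl
  have hdisj : Disjoint s t := by
    refine Set.disjoint_left.2 ?_
    rintro j ⟨i, h1, h2, h3⟩ ⟨i', h1', h2', h3'⟩
    have e1 := D.lam_antitone h1 h2 (by omega)
    have e2 := D.lam_antitone (by omega) h1' h2'
    linarith
  rw [hu, hcs]
  refine isCompl_biSup_of_iSupIndep hint.1 hint.2 hdisj (Set.eq_univ_of_forall fun j => ?_)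
  obtain ⟨i, h1, h2, h3⟩ := D.exists_exponent_eq_lam j
  rcases le_or_gt i p with h | h
  · exact Or.inl ⟨i, h1, h, h3⟩
  · exact Or.inr ⟨i, h, h2, h3⟩

theorem isCompl_Eu_Ecs_orb {p : ℕ} (hp : 1 ≤ p) (hpN : p ≤ N) (hx : x ∈ SigmaSet f p) (i : ℕ) :
    IsCompl (Eu f p (orb f x i)) (Ecs f p (orb f x i)) := by
  induction i with
  | zero => exact isCompl_Eu_Ecs hp hpN hx
  | succ i ih =>
    rw [Eu_orb_succ hx.2.1, Ecs_orb_succ hx.2.1]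
    exact (OrderIso.isCompl_iff (Submodule.orderIsoMapComap
      (tangentEquiv f (orb f x i)).toLinearEquiv)).1 ih

end Oseledets

/-! ### Symplectic charts -/

section Charts

variable {N : ℕ} {M : Type*} [TopologicalSpace M] [ChartedSpace (Phase N) M]
  [RiemannianBundle (fun x : M => TangentSpace 𝓘(ℝ, Phase N) x)]

/-- Every tangent space is the model space as a type; at equal points its norms agree. -/
theorem norm_tangentSpace_congr {x y : M} (h : y = x) (v : Phase N) :
    ‖(show TangentSpace 𝓘(ℝ, Phase N) y from v)‖ =
      ‖(show TangentSpace 𝓘(ℝ, Phase N) x from v)‖ := by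
  subst h; rfl

variable {Ω : SymplecticForm N M} {K : ℝ} {φ : OpenPartialHomeomorph M (Phase N)} {x : M}

/-- The derivative of a symplectic chart at a point of its domain, as a linear equivalence. -/
def chartEquiv (hφ : φ ∈ symplecticCharts Ω K) (hx : x ∈ φ.source) :
    TangentSpace 𝓘(ℝ, Phase N) x ≃L[ℝ] Phase N :=
  have h₁ : MDifferentiableAt 𝓘(ℝ, Phase N) 𝓘(ℝ, Phase N) φ x :=
    (hφ.1.contMDiffAt (φ.open_source.mem_nhds hx)).mdifferentiableAt one_ne_zero
  have h₂ : MDifferentiableAt 𝓘(ℝ, Phase N) 𝓘(ℝ, Phase N) φ.symm (φ x) :=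
    (hφ.2.1.contMDiffAt (φ.open_target.mem_nhds (φ.map_source hx))).mdifferentiableAt one_ne_zero
  ContinuousLinearEquiv.equivOfInverse
    (mfderiv 𝓘(ℝ, Phase N) 𝓘(ℝ, Phase N) φ x : TangentSpace 𝓘(ℝ, Phase N) x →L[ℝ] Phase N)
    (mfderiv 𝓘(ℝ, Phase N) 𝓘(ℝ, Phase N) φ.symm (φ x) :
      Phase N →L[ℝ] TangentSpace 𝓘(ℝ, Phase N) (φ.symm (φ x)))
    (by
      intro v
      have h : mfderiv 𝓘(ℝ, Phase N) 𝓘(ℝ, Phase N) (φ.symm ∘ φ) x =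
          mfderiv 𝓘(ℝ, Phase N) 𝓘(ℝ, Phase N) (id : M → M) x :=
        Filter.EventuallyEq.mfderiv_eq (φ.eventually_left_inverse hx)
      rw [mfderiv_comp x h₂ h₁, mfderiv_id] at h
      exact congrArg (fun L : Phase N →L[ℝ] Phase N => L v) h)
    (by
      intro v
      have h : mfderiv 𝓘(ℝ, Phase N) 𝓘(ℝ, Phase N) (φ ∘ φ.symm) (φ x) =
          mfderiv 𝓘(ℝ, Phase N) 𝓘(ℝ, Phase N) (id : Phase N → Phase N) (φ x) :=
        Filter.EventuallyEq.mfderiv_eq (φ.eventually_right_inverse (φ.map_source hx))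
      have h₁' : MDifferentiableAt 𝓘(ℝ, Phase N) 𝓘(ℝ, Phase N) φ (φ.symm (φ x)) := by
        rwa [φ.left_inv hx]
      rw [mfderiv_comp _ h₁' h₂, mfderiv_id, φ.left_inv hx] at h
      exact congrArg (fun L : Phase N →L[ℝ] Phase N => L v) h)

theorem stdForm_chartEquiv (hφ : φ ∈ symplecticCharts Ω K) (hx : x ∈ φ.source)
    (v w : TangentSpace 𝓘(ℝ, Phase N) x) :
    stdForm (chartEquiv hφ hx v) (chartEquiv hφ hx w) = Ω.form x ![v, w] :=
  hφ.2.2.1 x hx v w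

theorem norm_chartEquiv_le (hφ : φ ∈ symplecticCharts Ω K) (hx : x ∈ φ.source)
    (v : TangentSpace 𝓘(ℝ, Phase N) x) : ‖chartEquiv hφ hx v‖ ≤ K * ‖v‖ :=
  norm_tangentSpace_vectorSpace.ge.trans <| ContinuousLinearMap.le_of_opNorm_le
    (mfderiv 𝓘(ℝ, Phase N) 𝓘(ℝ, Phase N) φ x : TangentSpace 𝓘(ℝ, Phase N) x →L[ℝ] Phase N)
    (hφ.2.2.2.1 x hx).le v

theorem norm_chartEquiv_symm_le (hφ : φ ∈ symplecticCharts Ω K) (hx : x ∈ φ.source)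
    (v : Phase N) : ‖(chartEquiv hφ hx).symm v‖ ≤ K * ‖v‖ := by
  refine (norm_tangentSpace_congr (φ.left_inv hx)
    (mfderiv 𝓘(ℝ, Phase N) 𝓘(ℝ, Phase N) φ.symm (φ x) v)).ge.trans ?_
  refine (ContinuousLinearMap.le_of_opNorm_le
    (mfderiv 𝓘(ℝ, Phase N) 𝓘(ℝ, Phase N) φ.symm (φ x) :
      Phase N →L[ℝ] TangentSpace 𝓘(ℝ, Phase N) (φ.symm (φ x)))
    (hφ.2.2.2.2 (φ x) (φ.map_source hx)).le v).trans_eq ?_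
  exact congrArg (K * ·) norm_tangentSpace_vectorSpace

/-- The chain rule for the expression of a diffeomorphism in symplectic charts. -/
theorem fderiv_chart_comp {ψ : OpenPartialHomeomorph M (Phase N)} (f : Diff1 N M)
    (hφ : φ ∈ symplecticCharts Ω K) (hx : x ∈ φ.source)
    (hψ : ψ ∈ symplecticCharts Ω K) (hfx : f x ∈ ψ.source) (w : Phase N) :
    fderiv ℝ (ψ ∘ f ∘ φ.symm) (φ x) w =
      chartEquiv hψ hfx (tangentMapAt f x ((chartEquiv hφ hx).symm w)) := by
  have h₂ : MDifferentiableAt 𝓘(ℝ, Phase N) 𝓘(ℝ, Phase N) φ.symm (φ x) :=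
    (hφ.2.1.contMDiffAt (φ.open_target.mem_nhds (φ.map_source hx))).mdifferentiableAt one_ne_zero
  have h₁ : MDifferentiableAt 𝓘(ℝ, Phase N) 𝓘(ℝ, Phase N) ψ (f x) :=
    (hψ.1.contMDiffAt (ψ.open_source.mem_nhds hfx)).mdifferentiableAt one_ne_zero
  have h₃ : MDifferentiableAt 𝓘(ℝ, Phase N) 𝓘(ℝ, Phase N) f x :=
    f.contMDiff.mdifferentiable one_ne_zero x
  have h₄ : MDifferentiableAt 𝓘(ℝ, Phase N) 𝓘(ℝ, Phase N) (ψ ∘ f) x := h₁.comp x h₃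
  have h₄' : MDifferentiableAt 𝓘(ℝ, Phase N) 𝓘(ℝ, Phase N) (ψ ∘ f) (φ.symm (φ x)) := by
    rwa [φ.left_inv hx]
  have h : mfderiv 𝓘(ℝ, Phase N) 𝓘(ℝ, Phase N) ((ψ ∘ f) ∘ φ.symm) (φ x) = _ :=
    mfderiv_comp (φ x) h₄' h₂
  rw [φ.left_inv hx, mfderiv_comp x h₁ h₃, mfderiv_eq_fderiv] at h
  exact congrArg (fun L : Phase N →L[ℝ] Phase N => L w) h

end Charts

/-! ### The split sequence of a segment -/

section Segments

variable {N : ℕ} {M : Type*} [TopologicalSpace M] [ChartedSpace (Phase N) M]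
  [RiemannianBundle (fun x : M => TangentSpace 𝓘(ℝ, Phase N) x)]
  {Ω : SymplecticForm N M} {K : ℝ} {f : Diff1 N M} {p : ℕ} {z : M}

theorem Eu_orb_ne_bot (h : IsRegularPoint f z) (h0 : Eu f p z ≠ ⊥) (i : ℕ) :
    Eu f p (orb f z i) ≠ ⊥ := by
  induction i with
  | zero => exact h0
  | succ i ih =>
    rw [Eu_orb_succ h]
    exact fun hb => ih (Submodule.map_injective_of_injective (tangentEquiv f _).injective
      (hb.trans (Submodule.map_bot _).symm))

theorem Ecs_orb_ne_bot (h : IsRegularPoint f z) (h0 : Ecs f p z ≠ ⊥) (i : ℕ) :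
    Ecs f p (orb f z i) ≠ ⊥ := by
  induction i with
  | zero => exact h0
  | succ i ih =>
    rw [Ecs_orb_succ h]
    exact fun hb => ih (Submodule.map_injective_of_injective (tangentEquiv f _).injective
      (hb.trans (Submodule.map_bot _).symm))

/-- The maps and splittings that symplectic charts around the points of a segment induce on the
standard symplectic space form a split sequence. -/
theorem isSplitSequence_of_charts (hf : PreservesForm Ω f) (hp1 : 1 ≤ p) (hpN : p ≤ N)
    (hz : z ∈ SigmaSet f p) (hu : Eu f p z ≠ ⊥) (hcs : Ecs f p z ≠ ⊥)
    {φ : ℕ → OpenPartialHomeomorph M (Phase N)} (hφ : ∀ i, φ i ∈ symplecticCharts Ω K)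
    (hx : ∀ i, orb f z i ∈ (φ i).source) (n : ℕ) :
    IsSplitSequence n (fun i => fderiv ℝ (φ (i + 1) ∘ f ∘ (φ i).symm) (φ i (orb f z i)))
      (fun i => (Eu f p (orb f z i)).map
        (mfderiv 𝓘(ℝ, Phase N) 𝓘(ℝ, Phase N) (φ i) (orb f z i) :
          TangentSpace 𝓘(ℝ, Phase N) (orb f z i) →L[ℝ] Phase N).toLinearMap)
      (fun i => (Ecs f p (orb f z i)).map
        (mfderiv 𝓘(ℝ, Phase N) 𝓘(ℝ, Phase N) (φ i) (orb f z i) :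
          TangentSpace 𝓘(ℝ, Phase N) (orb f z i) →L[ℝ] Phase N).toLinearMap) := by
  set P := fun i => chartEquiv (hφ i) (hx i) with hP
  have hA : ∀ i w, fderiv ℝ (φ (i + 1) ∘ f ∘ (φ i).symm) (φ i (orb f z i)) w =
      P (i + 1) (tangentMapAt f (orb f z i) ((P i).symm w)) := fun i w =>
    fderiv_chart_comp f (hφ i) (hx i) (hφ (i + 1)) (hx (i + 1)) w
  have hAP : ∀ i v, fderiv ℝ (φ (i + 1) ∘ f ∘ (φ i).symm) (φ i (orb f z i)) (P i v) =
      P (i + 1) (tangentMapAt f (orb f z i) v) := fun i v => by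
    rw [hA, ContinuousLinearEquiv.symm_apply_apply]
  have hmap : ∀ i (E : Submodule ℝ (TangentSpace 𝓘(ℝ, Phase N) (orb f z i)))
      (E' : Submodule ℝ (TangentSpace 𝓘(ℝ, Phase N) (orb f z (i + 1)))),
      E' = E.map (tangentMapAt f (orb f z i)).toLinearMap →
      (E.map (P i).toLinearEquiv.toLinearMap).map
        (fderiv ℝ (φ (i + 1) ∘ f ∘ (φ i).symm) (φ i (orb f z i))).toLinearMap =
      E'.map (P (i + 1)).toLinearEquiv.toLinearMap := by
    rintro i E _ rfl
    rw [← Submodule.map_comp]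
    refine Eq.trans ?_ (Submodule.map_comp _ _ _)
    exact congrArg (fun L => E.map L) (LinearMap.ext fun v => hAP i v)
  have hinj : ∀ i, Function.Injective (P i).toLinearEquiv.toLinearMap := fun i => (P i).injective
  refine ⟨fun i _ v w => ?_, fun i _ => ?_, fun i _ h => ?_, fun i _ h => ?_, fun i _ => ?_,
    fun i _ => ?_⟩
  · rw [hA, hA]
    refine (stdForm_chartEquiv (hφ (i + 1)) (hx (i + 1)) _ _).trans ((hf _ _ _).trans ?_)
    rw [← stdForm_chartEquiv (hφ i) (hx i)]
    exact congrArg₂ stdForm ((P i).apply_symm_apply v) ((P i).apply_symm_apply w)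
  · exact (OrderIso.isCompl_iff (Submodule.orderIsoMapComap (P i).toLinearEquiv)).1
      (isCompl_Eu_Ecs_orb hp1 hpN hz i)
  · exact Eu_orb_ne_bot hz.2.1 hu i
      (Submodule.map_injective_of_injective (hinj i) (h.trans (Submodule.map_bot _).symm))
  · exact Ecs_orb_ne_bot hz.2.1 hcs i
      (Submodule.map_injective_of_injective (hinj i) (h.trans (Submodule.map_bot _).symm))
  · exact hmap i _ _ (Eu_orb_succ hz.2.1 p i)
  · exact hmap i _ _ (Ecs_orb_succ hz.2.1 p i)

end Segments

end SympFlex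

end

theorem mainTheorem7 {N : ℕ} {M : Type*} [TopologicalSpace M] [T2Space M] [CompactSpace M]
    [ChartedSpace (SympFlex.Phase N) M] [IsManifold 𝓘(ℝ, SympFlex.Phase N) ∞ M]
    [RiemannianBundle (fun x : M => TangentSpace 𝓘(ℝ, SympFlex.Phase N) x)]
    [IsContMDiffRiemannianBundle 𝓘(ℝ, SympFlex.Phase N) ∞ (SympFlex.Phase N)
      (fun x : M => TangentSpace 𝓘(ℝ, SympFlex.Phase N) x)]
    (Ω : SympFlex.SymplecticForm N M)
    (KA : ℝ) (hKA : 1 < KA)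
    (hatlas : ∀ x : M, ∃ φ ∈ SympFlex.symplecticCharts Ω KA, x ∈ φ.source)
    (f : SympFlex.Diff1 N M) (hf : SympFlex.PreservesForm Ω f)
    (p : ℕ) (hp1 : 1 ≤ p) (hpN : p ≤ N)
    (ε κ : ℝ) (hε : 0 < ε) (hκ : 0 < κ)
    (KIV τ : ℝ) (hKIV : 1 < KIV) (hτ : 1 < τ) :
    ∃ m₁ : ℕ, ∀ m : ℕ, m₁ ≤ m → ∀ z ∈ SympFlex.SigmaSet f p,
      SympFlex.IsTypeIV Ω f p KIV τ z m →
      SympFlex.IsFlexibleSegment Ω KA f p ε κ z m := by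
  -- For `N < 2` there are no segments of type IV.
  by_cases hN : 2 ≤ N
  swap
  · exact ⟨0, fun m _ z _ h => absurd h.1 hN⟩
  have hK : 0 < KIV * KA := by positivity
  obtain ⟨r, hr⟩ := SympFlex.exists_isFlexible_of_isSqueeze
    (i := (⟨0, by omega⟩ : Fin N)) (j := ⟨1, by omega⟩) (by simp) hε hκ hK
  refine ⟨r + 1, fun m hm z hz hIV => ?_⟩
  obtain ⟨_, L, c, hL, hc⟩ := hIV
  choose φ hφ hx using fun i => hatlas (SympFlex.orb f z i)
  refine ⟨φ, fun i _ => ⟨hφ i, hx i⟩, ?_⟩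
  set P := fun i => SympFlex.chartEquiv (hφ i) (hx i) with hP
  have hKA0 : 0 ≤ KA := by linarith
  have hKIV0 : 0 ≤ KIV := by linarith
  obtain ⟨-, -, -, m₁, m₂, m₃, m₄⟩ := hL 0 (by omega)
  have hcs₂ := (le_sup_left : SympFlex.Ec f p (SympFlex.orb f z 0) ≤ SympFlex.Ecs f p _) m₂
  have hcs₃ := (le_sup_right : SympFlex.Es f p (SympFlex.orb f z 0) ≤ SympFlex.Ecs f p _) m₃
  have hcs₄ := (le_sup_left : SympFlex.Ec f p (SympFlex.orb f z 0) ≤ SympFlex.Ecs f p _) m₄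
  have hpv : ∀ i : Fin N, (L 0).symm (SympFlex.pVec i) ≠ 0 := fun i h => by
    have h0 : SympFlex.pVec i = 0 := by
      simpa using congrArg (L 0) h
    have h1 := congrArg (fun v : SympFlex.Phase N => v (Sum.inl i)) h0
    simp [SympFlex.pVec] at h1
  have hsplit := SympFlex.isSplitSequence_of_charts hf hp1 hpN hz
    ((Submodule.ne_bot_iff _).2 ⟨_, m₁, hpv _⟩) ((Submodule.ne_bot_iff _).2 ⟨_, hcs₂, hpv _⟩)
    hφ hx m
  refine hr m _ _ _ (fun k => (P k).symm.trans (L k)) c (by omega) hsplit ?_ ?_ ?_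
    ⟨_, m₁, rfl⟩ ⟨_, hcs₂, rfl⟩ ⟨_, hcs₃, rfl⟩ ⟨_, hcs₄, rfl⟩
  · intro k hk v w
    refine ((hL k hk).1 _ _).trans ?_
    rw [← SympFlex.stdForm_chartEquiv (hφ k) (hx k)]
    exact congrArg₂ SympFlex.stdForm ((P k).apply_symm_apply v) ((P k).apply_symm_apply w)
  · intro k hk v
    constructor
    · calc ‖L k ((P k).symm v)‖ ≤ KIV * ‖(P k).symm v‖ :=
          ContinuousLinearMap.le_of_opNorm_le _ (hL k hk).2.1 _
        _ ≤ KIV * (KA * ‖v‖) := by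
          gcongr
          exact SympFlex.norm_chartEquiv_symm_le (hφ k) (hx k) v
        _ = KIV * KA * ‖v‖ := by ring
    · calc ‖P k ((L k).symm v)‖ ≤ KA * ‖(L k).symm v‖ :=
          SympFlex.norm_chartEquiv_le (hφ k) (hx k) _
        _ ≤ KA * (KIV * ‖v‖) := by
          gcongr
          exact ContinuousLinearMap.le_of_opNorm_le _ (hL k hk).2.2.1 _
        _ = KIV * KA * ‖v‖ := by ring
  · intro k hk
    obtain ⟨hck, e₁, e₂, e₃, e₄⟩ := hc k hk
    have hT : ∀ v, (P (k + 1)).symm.trans (L (k + 1))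
        (fderiv ℝ (φ (k + 1) ∘ f ∘ (φ k).symm) (φ k (SympFlex.orb f z k))
          (((P k).symm.trans (L k)).symm v)) =
        L (k + 1) (SympFlex.tangentMapAt f (SympFlex.orb f z k) ((L k).symm v)) := fun v => by
      refine congrArg (L (k + 1)) ?_
      rw [SympFlex.fderiv_chart_comp f (hφ k) (hx k) (hφ (k + 1)) (hx (k + 1))]
      refine ((P (k + 1)).symm_apply_apply _).trans ?_
      exact congrArg (SympFlex.tangentMapAt f (SympFlex.orb f z k)) ((P k).symm_apply_apply _)
    exact ⟨by linarith, (hT _).trans e₁, (hT _).trans e₂, (hT _).trans e₃, (hT _).trans e₄⟩
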